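/- Let $U=(u_1,\dots,u_M)$ be the standard basis of $\mathbb R^M$. For $E\subseteq U$ let $\mathbb R(E)$ be the span of $E$, $\mathcal O(E)\subset\mathbb R(E)$ the open orthant of vectors with strictly positive $E$-coordinates (and all other coordinates zero), and $P_E$ the orthogonal projection onto $\mathbb R(E)$. An orthant space $X$ of dimension $m$ is a union of orthants $\mathcal O(E)$ in $\mathbb R^M$, of maximal dimension $m$, such that (i) with an orthant all orthants in its closure belong to $X$, and (ii) an orthant of dimension at least $2$ all of whose two-dimensional faces belong to $X$ belongs to $X$. It carries the intrinsic (length) metric $d$; any two points of $X$ are joined by a unique geodesic. Let $\log_{x^*}(x)$ be the initial tangent vector, of length $d(x^*,x)$, of the geodesic from $x^*$ to $x$, and set $\Phi(x;x^*)=\log_{x^*}(x)+x^*$ and $\Phi_\sigma(x;x^*)=P_E(\Phi(x;x^*))$ for $\sigma=\mathcal O(E)$. The support of the geodesic from $x^*$ to $x$ is the pair of sequences $\mathcal A=(A_0,\dots,A_k)$, $\mathcal B=(B_0,\dots,B_k)$ of sets of axes such that the geodesic passes successively, each time along a segment of positive length, through the orthants $\mathcal O(B_0\cup\dots\cup B_i\cup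 A_{i+1}\cup\dots\cup A_k)$, $i=0,\dots,k$; here $A_0=B_0$, for $i\ge1$ the sets $A_i$ and $B_i$ are non-empty, and the sets $A_0,A_1,\dots,A_k,B_1,\dots,B_k$ are mutually disjoint (for $x=x^*\in\mathcal O(E)$ the support is $k=0$, $A_0=B_0=E$). For a pair of sequences $(\mathcal A,\mathcal B)$, a tie at $i\ge1$ is a pair of partitions $A_i=C_1\sqcup C_2$, $B_i=D_1\sqcup D_2$ into non-empty sets with $$\mathcal O(B_0\cup\dots\cup B_{i-1}\cup D_1\cup C_2\cup A_{i+1}\cup\dots\cup A_k)\subseteq X,\qquad \frac{\|P_{C_1}(x^*)\|}{\|P_{D_1}(x)\|}=\frac{\|P_{C_2}(x^*)\|}{\|P_{D_2}(x)\|}.$$ Let $\mathcal D_{x^*}$ be the set of all $x\in X$ for which the support of the geodesic from $x^*$ to $x$ has a tie such that $\mathcal O(B_0\cup\dots\cup B_{i-1}\cup D_2\cup C_1\cup A_{i+1}\cup\dots\cup A_k)\not\subseteq X$. A resolved support of the geodesic from $x^*$ to $x$ is a pair of sequences without ties obtained from the support by splitting, for each $i\ge1$, $A_i$ and $B_i$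 into the same number ($\ge1$) of consecutive non-empty pieces, matched in order, such that the matched pieces $A'_j,B'_j$ of the same $A_i,B_i$ all have the same ratio $\|P_{A'_j}(x^*)\|/\|P_{B'_j}(x)\|$ and the new sequences $(\mathcal A',\mathcal B')$ again have all orthants $\mathcal O(B'_0\cup\dots\cup B'_j\cup A'_{j+1}\cup\dots\cup A'_{k'})$ in $X$. If the support has no ties, it is itself a resolved support. **Proposition.** Let $X$ be an orthant space, let $x^*$ lie in the stratum $\sigma=\mathcal O(E)$ of $X$, and let $x\in X\setminus\mathcal D_{x^*}$. Then the map $\sigma\to\mathbb R(E)$, $x'\mapsto\Phi_\sigma(x;x')$, is differentiable at $x'=x^*$. The geodesic from $x^*$ to $x$ has a resolved support and, for every resolved support $\mathcal A=(A_0,\dots,A_k)$, $\mathcal B=(B_0,\dots,B_k)$ (in particular for the support itself if it has no ties), $P_{A_i}(x^*)\ne0$ for $1\le i\le k$ and the derivative is given by the matrix $$M^\sigma_{x^*}(x)=J^\top\,\mathrm{diag}\bigl\{\mathbf 0_{|B_0\cap E|},\,-\|P_{B_1}(x)\|\,M^\dagger_{P_{A_1}(x^*)},\dots,-\|P_{B_k}(x)\|\,M^\dagger_{P_{A_k}(x^*)}\bigr\}\,J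 ,$$ where $J$ is the matrix of the linear map $\jmath$ that places coordinates listed in the order $(B_0\cap E,A_1,\dots,A_k)$ at their positions in $\mathbb R^M$ (vectors are rows, $\jmath(v)=vJ$) and, for a row vector $y\in\mathbb R^l\setminus\{0\}$, $$M^\dagger_y=\frac1{\|y\|}I_l-\frac1{\|y\|^3}\,y^\top y ,$$ which is the derivative of the map $y\mapsto y/\|y\|$ at $y$. -/

import Mathlib

open scoped BigOperators

noncomputable section

/-- The relatively open positive orthant `O(E)` of `ℝ^M` spanned by the coordinate axes in `E`. -/
def openOrthant {M : ℕ} (E : Finset (Fin M)) : Set (EuclideanSpace ℝ (Fin M)) :=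
  {x | (∀ i ∈ E, 0 < x i) ∧ ∀ i ∉ E, x i = 0}

/-- The linear subspace `ℝ(E)` of `ℝ^M` spanned by the coordinate axes in `E`. -/
def axisSpace {M : ℕ} (E : Finset (Fin M)) : Submodule ℝ (EuclideanSpace ℝ (Fin M)) where
  carrier := {x | ∀ i ∉ E, x i = 0}
  add_mem' := by
    intro a b ha hb i hi
    simp [ha i hi, hb i hi]
  zero_mem' := by
    intro i _
    simp
  smul_mem' := by
    intro c a ha i hi
    simp [ha i hi]

/-- The orthogonal projection `P_E` onto `ℝ(E)`, as a vector of `ℝ^M`. -/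
def proj {M : ℕ} (E : Finset (Fin M)) (x : EuclideanSpace ℝ (Fin M)) :
    EuclideanSpace ℝ (Fin M) :=
  WithLp.toLp 2 (fun i => if i ∈ E then x i else 0)

/-- The coordinate vector, indexed by `E`, of the projection `P_E(x)`. -/
def coords {M : ℕ} (E : Finset (Fin M)) (x : EuclideanSpace ℝ (Fin M)) :
    EuclideanSpace ℝ E :=
  WithLp.toLp 2 (fun i => x i)

/-- An orthant space of dimension `m` in `ℝ^M`, given by the axis sets of its orthants.
`flag` is only asked for axis sets with at least two elements, so a coordinate axis of `ℝ^M` may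
or may not belong to the space; the origin always does. -/
structure OrthantSpace (M m : ℕ) where
  /-- the axis sets of the orthants contained in the space -/
  faces : Set (Finset (Fin M))
  down_closed : ∀ E ∈ faces, ∀ F ⊆ E, F ∈ faces
  flag : ∀ E : Finset (Fin M), 2 ≤ E.card →
    (∀ e ∈ E, ∀ f ∈ E, e ≠ f → {e, f} ∈ faces) → E ∈ faces
  card_le : ∀ E ∈ faces, E.card ≤ m
  exists_card_eq : ∃ E ∈ faces, E.card = m

namespace OrthantSpace

/-- The underlying set of the orthant space: the union of its orthants. -/
def points {M m : ℕ} (X : OrthantSpace M m) : Set (EuclideanSpace ℝ (Fin M)) :=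
  ⋃ E ∈ X.faces, openOrthant E

/-- The intrinsic metric: the infimum of the Euclidean lengths of the piecewise linear paths
from `x` to `y` inside the space. -/
def idist {M m : ℕ} (X : OrthantSpace M m) (x y : EuclideanSpace ℝ (Fin M)) : ℝ :=
  sInf {L | ∃ (n : ℕ) (p : ℕ → EuclideanSpace ℝ (Fin M)), p 0 = x ∧ p n = y ∧
    (∀ i < n, segment ℝ (p i) (p (i + 1)) ⊆ X.points) ∧
    L = ∑ i ∈ Finset.range n, dist (p i) (p (i + 1))}

/-- `γ`, restricted to `[0, 1]`, is a geodesic from `x` to `y` for the intrinsic metric,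
parametrised proportionally to arc length. -/
structure IsGeodesic {M m : ℕ} (X : OrthantSpace M m) (x y : EuclideanSpace ℝ (Fin M))
    (γ : ℝ → EuclideanSpace ℝ (Fin M)) : Prop where
  source : γ 0 = x
  target : γ 1 = y
  mem : ∀ t ∈ Set.Icc (0 : ℝ) 1, γ t ∈ X.points
  speed : ∀ s ∈ Set.Icc (0 : ℝ) 1, ∀ t ∈ Set.Icc (0 : ℝ) 1,
    X.idist (γ s) (γ t) = |s - t| * X.idist x y

/-- The logarithm map `log_{xs}(x)`: the initial tangent vector of the geodesic from `xs` to `x`,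
which is parametrised on `[0, 1]`, so that this vector has length `d(xs, x)`. -/
def logMap {M m : ℕ} (X : OrthantSpace M m) (xs x : EuclideanSpace ℝ (Fin M)) :
    EuclideanSpace ℝ (Fin M) :=
  Classical.epsilon (fun v => ∃ γ : ℝ → EuclideanSpace ℝ (Fin M),
    X.IsGeodesic xs x γ ∧ HasDerivWithinAt γ v (Set.Icc 0 1) 0)

/-- The translated logarithm map `Φ(x; xs) = log_{xs}(x) + xs`. -/
def translatedLog {M m : ℕ} (X : OrthantSpace M m) (x xs : EuclideanSpace ℝ (Fin M)) :
    EuclideanSpace ℝ (Fin M) :=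
  X.logMap xs x + xs

/-- The tangential projection `Φ_σ(x; xs) = P_σ(Φ(x; xs))`, where `σ = O(E)`. -/
def tangentialLog {M m : ℕ} (X : OrthantSpace M m) (E : Finset (Fin M))
    (x xs : EuclideanSpace ℝ (Fin M)) : EuclideanSpace ℝ (Fin M) :=
  proj E (X.translatedLog x xs)

end OrthantSpace

/-- The axis set `B_0 ∪ ⋯ ∪ B_i ∪ A_{i+1} ∪ ⋯ ∪ A_k` of the orthant `O_i`. -/
def carrierAxes {M k : ℕ} (A B : Fin (k + 1) → Finset (Fin M)) (i : Fin (k + 1)) :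
    Finset (Fin M) :=
  (Finset.univ.filter (fun j => j ≤ i)).biUnion B ∪
    (Finset.univ.filter (fun j => i < j)).biUnion A

/-- The axis set `B_0 ∪ ⋯ ∪ B_{i-1} ∪ D ∪ C ∪ A_{i+1} ∪ ⋯ ∪ A_k`. -/
def splitAxes {M k : ℕ} (A B : Fin (k + 1) → Finset (Fin M)) (i : Fin (k + 1))
    (D C : Finset (Fin M)) : Finset (Fin M) :=
  (Finset.univ.filter (fun j => j < i)).biUnion B ∪ D ∪ C ∪
    (Finset.univ.filter (fun j => i < j)).biUnion A

namespace OrthantSpace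

/-- `(A, B)` is the support of the geodesic from `x` to `y`: the geodesic passes successively,
each time for an interval of positive length, through the orthants `O_0, …, O_k`; `A_i` and `B_i`
(`i ≥ 1`) are the sets of axes whose coordinates vanish, respectively become positive, on passing
from `O_{i-1}` to `O_i`, and `A_0 = B_0` is the set of the axes common to all the `O_i`. -/
structure IsSupport {M m k : ℕ} (X : OrthantSpace M m) (x y : EuclideanSpace ℝ (Fin M))
    (A B : Fin (k + 1) → Finset (Fin M)) : Prop where
  zero_eq : A 0 = B 0
  nonempty_left : ∀ i, i ≠ 0 → (A i).Nonempty
  nonempty_right : ∀ i, i ≠ 0 → (B i).Nonempty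
  disjoint_left : ∀ i j, i ≠ j → Disjoint (A i) (A j)
  disjoint_right : ∀ i j, i ≠ j → Disjoint (B i) (B j)
  disjoint_left_right : ∀ i j, i ≠ 0 → j ≠ 0 → Disjoint (A i) (B j)
  carrier : ∃ (γ : ℝ → EuclideanSpace ℝ (Fin M)) (t : Fin (k + 2) → ℝ),
    X.IsGeodesic x y γ ∧ StrictMono t ∧ t 0 = 0 ∧ t (Fin.last (k + 1)) = 1 ∧
    ∀ i : Fin (k + 1), ∀ s ∈ Set.Ioo (t i.castSucc) (t i.succ),
      γ s ∈ openOrthant (carrierAxes A B i)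

/-- The partitions `A_i = C₁ ∪ C₂` and `B_i = D₁ ∪ D₂`, `i > 0`, are non-trivial, the
orthant `O'` with axes `B_0 ∪ ⋯ ∪ B_{i-1} ∪ D₁ ∪ C₂ ∪ A_{i+1} ∪ ⋯ ∪ A_k` is in the space, and
`‖P_{C₁}(xs)‖ / ‖P_{D₁}(x)‖ = ‖P_{C₂}(xs)‖ / ‖P_{D₂}(x)‖`. -/
structure IsTie {M m k : ℕ} (X : OrthantSpace M m) (xs x : EuclideanSpace ℝ (Fin M))
    (A B : Fin (k + 1) → Finset (Fin M)) (i : Fin (k + 1))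
    (C₁ C₂ D₁ D₂ : Finset (Fin M)) : Prop where
  index_ne : i ≠ 0
  nonempty_C₁ : C₁.Nonempty
  nonempty_C₂ : C₂.Nonempty
  nonempty_D₁ : D₁.Nonempty
  nonempty_D₂ : D₂.Nonempty
  disjoint_C : Disjoint C₁ C₂
  disjoint_D : Disjoint D₁ D₂
  union_C : C₁ ∪ C₂ = A i
  union_D : D₁ ∪ D₂ = B i
  mem_faces : splitAxes A B i D₁ C₂ ∈ X.faces
  ratio_eq : ‖proj C₁ xs‖ / ‖proj D₁ x‖ = ‖proj C₂ xs‖ / ‖proj D₂ x‖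

/-- The set `𝒟_{xs}`: the points `x` for which the support of the geodesic from `xs` to `x`
has a tie whose opposite orthant `O'''`, with axes
`B_0 ∪ ⋯ ∪ B_{i-1} ∪ D₂ ∪ C₁ ∪ A_{i+1} ∪ ⋯ ∪ A_k`, is not in the space. -/
def changeSet {M m : ℕ} (X : OrthantSpace M m) (xs : EuclideanSpace ℝ (Fin M)) :
    Set (EuclideanSpace ℝ (Fin M)) :=
  {x | x ∈ X.points ∧ ∃ (k : ℕ) (A B : Fin (k + 1) → Finset (Fin M)), X.IsSupport xs x A B ∧
    ∃ (i : Fin (k + 1)) (C₁ C₂ D₁ D₂ : Finset (Fin M)),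
      X.IsTie xs x A B i C₁ C₂ D₁ D₂ ∧ splitAxes A B i D₂ C₁ ∉ X.faces}

/-- The pair of sequences admits no tie. -/
def TieFree {M m k : ℕ} (X : OrthantSpace M m) (xs x : EuclideanSpace ℝ (Fin M))
    (A B : Fin (k + 1) → Finset (Fin M)) : Prop :=
  ∀ (i : Fin (k + 1)) (C₁ C₂ D₁ D₂ : Finset (Fin M)), ¬ X.IsTie xs x A B i C₁ C₂ D₁ D₂

/-- `(A', B')` arises from `(A, B)` by splitting, for each `i ≥ 1`, the pair `(A_i, B_i)` into
one or more consecutive pairs of non-empty pieces, all with the same ratio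
`‖P_{A'_j}(xs)‖ / ‖P_{B'_j}(x)‖`, the orthants `O'_j` of the new sequences all being in the space.
The monotone map `φ` records which `(A_i, B_i)` a piece comes from. -/
structure IsTieRefinement {M m k k' : ℕ} (X : OrthantSpace M m)
    (xs x : EuclideanSpace ℝ (Fin M)) (A B : Fin (k + 1) → Finset (Fin M))
    (A' B' : Fin (k' + 1) → Finset (Fin M)) : Prop where
  nonempty_left : ∀ j, j ≠ 0 → (A' j).Nonempty
  nonempty_right : ∀ j, j ≠ 0 → (B' j).Nonempty
  disjoint_left : ∀ i j, i ≠ j → Disjoint (A' i) (A' j)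
  disjoint_right : ∀ i j, i ≠ j → Disjoint (B' i) (B' j)
  mem_faces : ∀ j, carrierAxes A' B' j ∈ X.faces
  splitting : ∃ φ : Fin (k' + 1) → Fin (k + 1), Monotone φ ∧ (∀ j, φ j = 0 ↔ j = 0) ∧
    (∀ i, A i = (Finset.univ.filter (fun j => φ j = i)).biUnion A') ∧
    (∀ i, B i = (Finset.univ.filter (fun j => φ j = i)).biUnion B') ∧
    ∀ j j', j ≠ 0 → φ j = φ j' →
      ‖proj (A' j) xs‖ / ‖proj (B' j) x‖ = ‖proj (A' j') xs‖ / ‖proj (B' j') x‖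

/-- A resolved support of the geodesic from `xs` to `x`: a tie-free pair of sequences obtained
from the support by splitting it at ties. If the support is tie-free, it is itself resolved. -/
def IsResolvedSupport {M m k' : ℕ} (X : OrthantSpace M m) (xs x : EuclideanSpace ℝ (Fin M))
    (A' B' : Fin (k' + 1) → Finset (Fin M)) : Prop :=
  (∃ (k : ℕ) (A B : Fin (k + 1) → Finset (Fin M)),
    X.IsSupport xs x A B ∧ X.IsTieRefinement xs x A B A' B') ∧ X.TieFree xs x A' B'

end OrthantSpace

/-- `M†_y = ‖y‖⁻¹ I - ‖y‖⁻³ yᵀy` (with `y` a row vector). -/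
def mDagger {ι : Type*} [Fintype ι] [DecidableEq ι] (y : EuclideanSpace ℝ ι) : Matrix ι ι ℝ :=
  (1 / ‖y‖) • (1 : Matrix ι ι ℝ) - (1 / ‖y‖ ^ 3) • Matrix.of (fun i j => y i * y j)

/-- The axis sets `B_0 ∩ E, A_1, …, A_k` of the diagonal blocks. -/
def blockAxes {M k : ℕ} (E : Finset (Fin M)) (A B : Fin (k + 1) → Finset (Fin M))
    (i : Fin (k + 1)) : Finset (Fin M) :=
  if i = 0 then B 0 ∩ E else A i

/-- The matrix of the linear map `ȷ` that puts the coordinates of a vector, listed block by block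
along `G_0, …, G_k`, at their positions in `ℝ^M` (vectors are rows: `ȷ(v) = vJ`). -/
def placeMatrix {M k : ℕ} (G : Fin (k + 1) → Finset (Fin M)) :
    Matrix (Σ i : Fin (k + 1), G i) (Fin M) ℝ :=
  Matrix.of (fun p e => if (p.2 : Fin M) = e then 1 else 0)

/-- The matrix `M^σ_{xs}(x)`, `σ = O(E)`, formed with the sequences `(A, B)`:
`Jᵀ diag{0, -‖P_{B_1}(x)‖ M†_{P_{A_1}(xs)}, …, -‖P_{B_k}(x)‖ M†_{P_{A_k}(xs)}} J`. -/
def derivMatrix {M k : ℕ} (E : Finset (Fin M)) (A B : Fin (k + 1) → Finset (Fin M))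
    (x xs : EuclideanSpace ℝ (Fin M)) : Matrix (Fin M) (Fin M) ℝ :=
  (placeMatrix (blockAxes E A B)).transpose *
    Matrix.blockDiagonal' (fun i : Fin (k + 1) =>
      if i = 0 then (0 : Matrix (blockAxes E A B i) (blockAxes E A B i) ℝ)
      else (-‖proj (B i) x‖) • mDagger (coords (blockAxes E A B i) xs)) *
    placeMatrix (blockAxes E A B)

end

/-! Geodesics are certified by a calibration. Write `x` for the starting point and `y` for the
target. A calibrated system (`IsCalibrated`) has common axes `S` and blocks `A i`, `B i` with norms
a_i = ‖P_{A_i} x‖, b_i = ‖P_{B_i} y‖. The covector `calVec` pairs with y - x to L² = ‖P_S(y - x)‖² +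
Σ (a_i + b_i)² (`speedSq`), and its restriction to any face has norm at most L. The latter is the
content of `weight_le`: compatible C ⊆ A_i and D ⊆ B_i satisfy ‖P_C x‖²/a_i² + ‖P_D y‖²/b_i² ≤ 1. By
Cauchy–Schwarz on each face no path from x to y is shorter than L, and `calPath` has length L. The
equality case constrains every geodesic: it starts with velocity `initVec` (`logMap_eq`), so Φ
equals y_e on the axes of S and -b_i x_e / a_i on those of A_i.

Calibrated systems exist (`exists_isCalibrated`): a greedy choice of least weight ratio, made in
`exists_isRatioChain`, produces blocks of non-decreasing ratio without ties. Merging blocks with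
equal break time gives a support, of which the unmerged blocks are a resolved support. Conversely
the equality case shows that every support consists of such merged blocks
(`IsSupport.exists_level_times`) and hence is itself calibrated.

It remains to move the starting point inside its stratum while keeping the blocks of a resolved
support. The definition of a calibrated system does not order the blocks; it only asks that A_i be
compatible with B_j whenever the ratio of block i exceeds that of block j. For blocks with different
ratios the strict order survives a small move. For tied blocks of one A_i the order may change
either way, and being outside the change set is what makes both orders admissible: the opposite
orthant of the tie lies in the space. Absence of further ties makes `weight_le` strict for non-empty
C and D, so it survives as well. This is `isStable_of_isTieRefinement`. Thus one formula for Φ, with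
fixed blocks, holds near the base point on the stratum, and the matrix is obtained by
differentiating w ↦ w_e / ‖P_A w‖ coordinatewise. -/

/-! ### Norms of coordinate projections -/

section Projection

variable {M : ℕ}

theorem norm_sq_proj (E : Finset (Fin M)) (x : EuclideanSpace ℝ (Fin M)) :
    ‖proj E x‖ ^ 2 = ∑ e ∈ E, x e ^ 2 := by
  simp [EuclideanSpace.norm_sq_eq, proj, ite_pow, Finset.sum_ite_mem]

theorem norm_proj_pos {E : Finset (Fin M)} {x : EuclideanSpace ℝ (Fin M)} (hE : E.Nonempty)
    (h : ∀ e ∈ E, 0 < x e) : 0 < ‖proj E x‖ := by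
  have h1 : 0 < ‖proj E x‖ ^ 2 := by
    rw [norm_sq_proj]
    exact Finset.sum_pos (fun e he => pow_pos (h e he) 2) hE
  exact (norm_nonneg _).lt_of_ne fun h => by simp [← h] at h1

theorem continuous_proj (E : Finset (Fin M)) : Continuous (proj E) := by
  unfold proj
  refine (PiLp.continuous_toLp 2 _).comp (continuous_pi fun i => ?_)
  by_cases h : i ∈ E
  · simpa [h] using (EuclideanSpace.proj (𝕜 := ℝ) i).continuous
  · simpa [h] using continuous_const

end Projection

/-- The set of axes along which `x` has a positive coordinate. -/
noncomputable def posAxes {M : ℕ} (x : EuclideanSpace ℝ (Fin M)) : Finset (Fin M) :=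
  Finset.univ.filter (fun e => 0 < x e)

theorem mem_posAxes {M : ℕ} {x : EuclideanSpace ℝ (Fin M)} {e : Fin M} :
    e ∈ posAxes x ↔ 0 < x e := by
  simp [posAxes]

theorem posAxes_eq_of_mem_openOrthant {M : ℕ} {x : EuclideanSpace ℝ (Fin M)}
    {E : Finset (Fin M)} (hx : x ∈ openOrthant E) : posAxes x = E := by
  ext e
  rw [mem_posAxes]
  by_cases h : e ∈ E
  · simp [h, hx.1 e h]
  · simp [h, hx.2 e h]

/-! ### Faces as sets of pairwise compatible axes -/

namespace OrthantSpace

variable {M m : ℕ} (X : OrthantSpace M m)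

/-- Two axes are compatible if they span a face of the space; an axis is compatible with itself
if it belongs to the space. -/
def Compat (e f : Fin M) : Prop := ({e, f} : Finset (Fin M)) ∈ X.faces

variable {X}

theorem Compat.symm {e f : Fin M} (h : X.Compat e f) : X.Compat f e := by
  unfold Compat at *
  rwa [Finset.pair_comm]

theorem empty_mem_faces : (∅ : Finset (Fin M)) ∈ X.faces := by
  obtain ⟨E, hE, -⟩ := X.exists_card_eq
  exact X.down_closed E hE ∅ (Finset.empty_subset _)

/-- This is the flag condition in the form used throughout. The diagonal pairs e = f matter: they
settle the one-element sets, about which `flag` says nothing. -/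
theorem mem_faces_iff {E : Finset (Fin M)} :
    E ∈ X.faces ↔ ∀ e ∈ E, ∀ f ∈ E, X.Compat e f := by
  constructor
  · intro h e he f hf
    refine X.down_closed E h _ ?_
    intro g hg
    rcases Finset.mem_insert.1 hg with rfl | hg
    · exact he
    · rwa [Finset.mem_singleton.1 hg]
  · intro h
    rcases Nat.lt_or_ge E.card 2 with hc | hc
    · rcases Finset.eq_empty_or_nonempty E with rfl | ⟨e, he⟩
      · exact empty_mem_faces
      · have : E = {e, e} := by
          have h1 : E.card ≤ 1 := by omega
          ext f
          simp only [Finset.pair_eq_singleton, Finset.mem_singleton]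
          exact ⟨fun hf => Finset.card_le_one.1 h1 f hf e he, fun hf => hf ▸ he⟩
        rw [this]
        exact h e he e he
    · exact X.flag E hc fun e he f hf _ => h e he f hf

theorem mem_points_iff {x : EuclideanSpace ℝ (Fin M)} :
    x ∈ X.points ↔ (∀ e, 0 ≤ x e) ∧ posAxes x ∈ X.faces := by
  unfold points
  simp only [Set.mem_iUnion, exists_prop]
  constructor
  · rintro ⟨E, hE, hx⟩
    refine ⟨fun e => ?_, by rwa [posAxes_eq_of_mem_openOrthant hx]⟩
    by_cases h : e ∈ E
    · exact (hx.1 e h).le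
    · exact (hx.2 e h).ge
  · rintro ⟨h0, h1⟩
    refine ⟨_, h1, fun e he => mem_posAxes.1 he, fun e he => ?_⟩
    rw [mem_posAxes, not_lt] at he
    exact le_antisymm he (h0 e)

theorem mem_points_of_face {x : EuclideanSpace ℝ (Fin M)} {G : Finset (Fin M)}
    (hG : G ∈ X.faces) (h0 : ∀ e, 0 ≤ x e) (hx : ∀ e ∉ G, x e = 0) : x ∈ X.points := by
  refine mem_points_iff.2 ⟨h0, X.down_closed G hG _ fun e he => ?_⟩
  by_contra h
  exact (mem_posAxes.1 he).ne' (hx e h)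

theorem segment_subset_points {p q : EuclideanSpace ℝ (Fin M)} {G : Finset (Fin M)}
    (hG : G ∈ X.faces) (hp0 : ∀ e, 0 ≤ p e) (hq0 : ∀ e, 0 ≤ q e)
    (hp : ∀ e ∉ G, p e = 0) (hq : ∀ e ∉ G, q e = 0) : segment ℝ p q ⊆ X.points := by
  rintro _ ⟨a, b, ha, hb, -, rfl⟩
  refine mem_points_of_face hG (fun e => ?_) fun e he => ?_
  · simpa using add_nonneg (mul_nonneg ha (hp0 e)) (mul_nonneg hb (hq0 e))
  · simp [hp e he, hq e he]

/-- All coordinates are non-negative, so the midpoint is positive wherever an endpoint is; its face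
carries the whole segment. -/
theorem exists_face_of_segment_subset {p q : EuclideanSpace ℝ (Fin M)}
    (h : segment ℝ p q ⊆ X.points) :
    ∃ G ∈ X.faces, ∀ e ∉ G, p e = 0 ∧ q e = 0 := by
  have hp := (mem_points_iff.1 (h (left_mem_segment ℝ p q))).1
  have hq := (mem_points_iff.1 (h (right_mem_segment ℝ p q))).1
  have hm := (mem_points_iff.1 (h (midpoint_mem_segment (𝕜 := ℝ) p q))).2
  refine ⟨_, hm, fun e he => ?_⟩
  rw [mem_posAxes, midpoint_eq_smul_add] at he
  simp only [invOf_eq_inv, PiLp.smul_apply, PiLp.add_apply, smul_eq_mul, not_lt] at he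
  have := hp e
  have := hq e
  constructor <;> linarith

/-! ### The intrinsic metric -/

section Distance

variable {x y z : EuclideanSpace ℝ (Fin M)}

theorem bddBelow_lengths :
    BddBelow {L : ℝ | ∃ (n : ℕ) (p : ℕ → EuclideanSpace ℝ (Fin M)), p 0 = x ∧ p n = y ∧
      (∀ i < n, segment ℝ (p i) (p (i + 1)) ⊆ X.points) ∧
      L = ∑ i ∈ Finset.range n, dist (p i) (p (i + 1))} := by
  refine ⟨0, ?_⟩
  rintro _ ⟨n, p, -, -, -, rfl⟩
  exact Finset.sum_nonneg fun _ _ => dist_nonneg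

theorem lengths_nonempty (hx : x ∈ X.points) (hy : y ∈ X.points) :
    {L : ℝ | ∃ (n : ℕ) (p : ℕ → EuclideanSpace ℝ (Fin M)), p 0 = x ∧ p n = y ∧
      (∀ i < n, segment ℝ (p i) (p (i + 1)) ⊆ X.points) ∧
      L = ∑ i ∈ Finset.range n, dist (p i) (p (i + 1))}.Nonempty := by
  rw [mem_points_iff] at hx hy
  have key : ∀ z : EuclideanSpace ℝ (Fin M), (∀ e, 0 ≤ z e) → ∀ e ∉ posAxes z, z e = 0 :=
    fun z hz e he => le_antisymm (not_lt.1 fun h => he (mem_posAxes.2 h)) (hz e)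
  -- The cone path through the origin joins any two points.
  refine ⟨_, 2, fun i => if i = 0 then x else if i = 1 then 0 else y, by simp, by simp, ?_, rfl⟩
  intro i hi
  interval_cases i
  · simpa using segment_subset_points hx.2 hx.1 (fun _ => le_rfl) (key x hx.1) fun _ _ => rfl
  · simpa using segment_subset_points hy.2 (fun _ => le_rfl) hy.1 (fun _ _ => rfl) (key y hy.1)

theorem le_idist (hx : x ∈ X.points) (hy : y ∈ X.points) {b : ℝ}
    (h : ∀ (n : ℕ) (p : ℕ → EuclideanSpace ℝ (Fin M)), p 0 = x → p n = y →
      (∀ i < n, segment ℝ (p i) (p (i + 1)) ⊆ X.points) →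
      b ≤ ∑ i ∈ Finset.range n, dist (p i) (p (i + 1))) : b ≤ X.idist x y := by
  refine le_csInf (lengths_nonempty hx hy) ?_
  rintro _ ⟨n, p, h0, hn, hs, rfl⟩
  exact h n p h0 hn hs

theorem idist_le_sum (n : ℕ) (p : ℕ → EuclideanSpace ℝ (Fin M)) (h0 : p 0 = x) (hn : p n = y)
    (hs : ∀ i < n, segment ℝ (p i) (p (i + 1)) ⊆ X.points) :
    X.idist x y ≤ ∑ i ∈ Finset.range n, dist (p i) (p (i + 1)) :=
  csInf_le bddBelow_lengths ⟨n, p, h0, hn, hs, rfl⟩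

theorem dist_le_idist (hx : x ∈ X.points) (hy : y ∈ X.points) : dist x y ≤ X.idist x y := by
  refine le_idist hx hy fun n p h0 hn _ => ?_
  rw [← h0, ← hn]
  exact dist_le_range_sum_dist p n

theorem idist_le_dist (h : segment ℝ x y ⊆ X.points) : X.idist x y ≤ dist x y := by
  simpa using idist_le_sum (X := X) (x := x) (y := y) 1 (fun i => if i = 0 then x else y)
    (by simp) (by simp) (fun i hi => by interval_cases i; simpa using h)

theorem idist_comm_le (hx : x ∈ X.points) (hy : y ∈ X.points) : X.idist y x ≤ X.idist x y := by
  refine le_idist hx hy fun n p h0 hn hs => ?_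
  refine (idist_le_sum n (fun i => p (n - i)) (by simpa) (by simpa) fun i hi => ?_).trans_eq ?_
  · have h1 : n - i = n - (i + 1) + 1 := by omega
    rw [h1, segment_symm]
    exact hs _ (by omega)
  · rw [← Finset.sum_range_reflect]
    refine Finset.sum_congr rfl fun i hi => ?_
    have hi := Finset.mem_range.1 hi
    have h1 : n - (n - 1 - i) = i + 1 := by omega
    have h2 : n - (n - 1 - i + 1) = i := by omega
    rw [h1, h2, dist_comm]

theorem idist_comm (hx : x ∈ X.points) (hy : y ∈ X.points) : X.idist x y = X.idist y x :=
  le_antisymm (idist_comm_le hy hx) (idist_comm_le hx hy)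

theorem idist_triangle (hx : x ∈ X.points) (hy : y ∈ X.points) (hz : z ∈ X.points) :
    X.idist x z ≤ X.idist x y + X.idist y z := by
  rw [← sub_le_iff_le_add']
  refine le_idist hy hz fun n q hq0 hqn hqs => ?_
  rw [sub_le_iff_le_add', ← sub_le_iff_le_add]
  refine le_idist hx hy fun k p hp0 hpk hps => ?_
  rw [sub_le_iff_le_add]
  -- The two paths are concatenated at index k, where both pass through y; the second path is
  -- therefore read off correctly also at i = 0.
  have h1 : ∀ i, (if k + i ≤ k then p (k + i) else q (k + i - k)) = q i := by
    intro i
    rcases Nat.eq_zero_or_pos i with rfl | hi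
    · simp [hpk, hq0]
    · rw [if_neg (by omega)]
      congr 1
      omega
  refine (idist_le_sum (k + n) (fun i => if i ≤ k then p i else q (i - k)) (by simpa)
    (by rw [h1, hqn]) fun i hi => ?_).trans_eq ?_
  · rcases Nat.lt_or_ge i k with hik | hik
    · simpa [hik.le, Nat.succ_le_of_lt hik] using hps i hik
    · obtain ⟨j, rfl⟩ := Nat.exists_eq_add_of_le hik
      rw [h1, add_assoc, h1]
      exact hqs j (by omega)
  · rw [Finset.sum_range_add]
    congr 1
    · refine Finset.sum_congr rfl fun i hi => ?_
      have hi := Finset.mem_range.1 hi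
      simp [hi.le, Nat.succ_le_of_lt hi]
    · refine Finset.sum_congr rfl fun i _ => ?_
      rw [h1, add_assoc, h1]

end Distance

end OrthantSpace

/-- The function that equals `u` on `S`, `p i` on `A i` and `q i` on `B i`, and vanishes elsewhere,
provided that these sets are disjoint. -/
noncomputable def glue {M : ℕ} {ι : Type*} [Fintype ι] (S : Finset (Fin M))
    (A B : ι → Finset (Fin M)) (u : Fin M → ℝ) (p q : ι → Fin M → ℝ) (e : Fin M) : ℝ :=
  (if e ∈ S then u e else 0) +
    ∑ i, ((if e ∈ A i then p i e else 0) + (if e ∈ B i then q i e else 0))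

theorem sum_glue {M : ℕ} {ι : Type*} [Fintype ι] (S : Finset (Fin M))
    (A B : ι → Finset (Fin M)) (u : Fin M → ℝ) (p q : ι → Fin M → ℝ) (G : Finset (Fin M)) :
    ∑ e ∈ G, glue S A B u p q e =
      ∑ e ∈ G ∩ S, u e + ∑ i, (∑ e ∈ G ∩ A i, p i e + ∑ e ∈ G ∩ B i, q i e) := by
  simp only [glue, Finset.sum_add_distrib, Finset.sum_ite_mem]
  congr 1
  congr 1
  · rw [Finset.sum_comm]
    simp only [Finset.sum_ite_mem]
  · rw [Finset.sum_comm]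
    simp only [Finset.sum_ite_mem]

/-! ### Calibrated systems and the lower bound for lengths -/

namespace OrthantSpace

variable {M m : ℕ}

/-- Combinatorial data certifying a geodesic from `x` to `y`: the axes in `S` are common to all
orthants met, those in `A i` are left, and those in `B i` entered, at the time
`‖P_{A i} x‖ / (‖P_{A i} x‖ + ‖P_{B i} y‖)`. -/
structure IsCalibrated {ι : Type*} (X : OrthantSpace M m) (x y : EuclideanSpace ℝ (Fin M))
    (S : Finset (Fin M)) (A B : ι → Finset (Fin M)) : Prop where
  nonneg_left : ∀ e, 0 ≤ x e
  nonneg_right : ∀ e, 0 ≤ y e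
  nonempty_left : ∀ i, (A i).Nonempty
  nonempty_right : ∀ i, (B i).Nonempty
  pos_left : ∀ i, ∀ e ∈ A i, 0 < x e
  pos_right : ∀ i, ∀ e ∈ B i, 0 < y e
  cover_left : ∀ e, 0 < x e → e ∈ S ∨ ∃ i, e ∈ A i
  cover_right : ∀ e, 0 < y e → e ∈ S ∨ ∃ i, e ∈ B i
  disjoint_left : ∀ i, Disjoint S (A i)
  disjoint_right : ∀ i, Disjoint S (B i)
  pairwise_left : ∀ i j, i ≠ j → Disjoint (A i) (A j)
  pairwise_right : ∀ i j, i ≠ j → Disjoint (B i) (B j)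
  disjoint_left_right : ∀ i j, Disjoint (A i) (B j)
  compat_left : ∀ e f, (e ∈ S ∨ ∃ i, e ∈ A i) → (f ∈ S ∨ ∃ i, f ∈ A i) → X.Compat e f
  compat_right : ∀ e f, (e ∈ S ∨ ∃ i, e ∈ B i) → (f ∈ S ∨ ∃ i, f ∈ B i) → X.Compat e f
  compat_cross : ∀ i j, ‖proj (A j) x‖ / ‖proj (B j) y‖ < ‖proj (A i) x‖ / ‖proj (B i) y‖ →
    ∀ e ∈ A i, ∀ f ∈ B j, X.Compat e f
  weight_le : ∀ i, ∀ C ⊆ A i, ∀ D ⊆ B i, (∀ e ∈ C, ∀ f ∈ D, X.Compat e f) →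
    ‖proj C x‖ ^ 2 * ‖proj (B i) y‖ ^ 2 + ‖proj D y‖ ^ 2 * ‖proj (A i) x‖ ^ 2 ≤
      ‖proj (A i) x‖ ^ 2 * ‖proj (B i) y‖ ^ 2

section Certificate

variable {ι : Type*} [Fintype ι] (x y : EuclideanSpace ℝ (Fin M)) (S : Finset (Fin M))
  (A B : ι → Finset (Fin M))

/-- The calibrating covector: the velocity which a coordinate has as long as it is positive. -/
noncomputable def calVec : Fin M → ℝ :=
  glue S A B (fun e => y e - x e)
    (fun i e => -((‖proj (A i) x‖ + ‖proj (B i) y‖) / ‖proj (A i) x‖ * x e))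
    (fun i e => (‖proj (A i) x‖ + ‖proj (B i) y‖) / ‖proj (B i) y‖ * y e)

/-- The squared length of the certified geodesic. -/
noncomputable def speedSq : ℝ :=
  ∑ e ∈ S, (y e - x e) ^ 2 + ∑ i, (‖proj (A i) x‖ + ‖proj (B i) y‖) ^ 2

/-- The certified geodesic. -/
noncomputable def calPath (t : ℝ) : EuclideanSpace ℝ (Fin M) :=
  WithLp.toLp 2 (glue S A B (fun e => (1 - t) * x e + t * y e)
    (fun i e => max 0 ((1 - t) * ‖proj (A i) x‖ - t * ‖proj (B i) y‖) / ‖proj (A i) x‖ * x e)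
    (fun i e => max 0 (t * ‖proj (B i) y‖ - (1 - t) * ‖proj (A i) x‖) / ‖proj (B i) y‖ * y e))

end Certificate

namespace IsCalibrated

variable {X : OrthantSpace M m} {ι : Type*} {x y : EuclideanSpace ℝ (Fin M)}
  {S : Finset (Fin M)} {A B : ι → Finset (Fin M)} (h : X.IsCalibrated x y S A B)

include h

theorem left_pos (i : ι) : 0 < ‖proj (A i) x‖ := norm_proj_pos (h.nonempty_left i) (h.pos_left i)

theorem right_pos (i : ι) : 0 < ‖proj (B i) y‖ :=
  norm_proj_pos (h.nonempty_right i) (h.pos_right i)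

omit h in
theorem block_cases (e : Fin M) : e ∈ S ∨ (∃ i, e ∈ A i) ∨ (∃ i, e ∈ B i) ∨
    (e ∉ S ∧ (∀ i, e ∉ A i) ∧ ∀ i, e ∉ B i) := by
  by_cases h1 : e ∈ S
  · exact Or.inl h1
  by_cases h2 : ∃ i, e ∈ A i
  · exact Or.inr (Or.inl h2)
  by_cases h3 : ∃ i, e ∈ B i
  · exact Or.inr (Or.inr (Or.inl h3))
  · push Not at h2 h3
    exact Or.inr (Or.inr (Or.inr ⟨h1, h2, h3⟩))

theorem right_eq_zero {i : ι} {e : Fin M} (he : e ∈ A i) : y e = 0 := by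
  by_contra hne
  rcases h.cover_right e ((h.nonneg_right e).lt_of_ne' hne) with h1 | ⟨j, hj⟩
  · exact Finset.disjoint_left.1 (h.disjoint_left i) h1 he
  · exact Finset.disjoint_left.1 (h.disjoint_left_right i j) he hj

theorem left_eq_zero {i : ι} {e : Fin M} (he : e ∈ B i) : x e = 0 := by
  by_contra hne
  rcases h.cover_left e ((h.nonneg_left e).lt_of_ne' hne) with h1 | ⟨j, hj⟩
  · exact Finset.disjoint_left.1 (h.disjoint_right i) h1 he
  · exact Finset.disjoint_left.1 (h.disjoint_left_right j i) hj he

theorem left_mem_points : x ∈ X.points := by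
  refine mem_points_iff.2 ⟨h.nonneg_left, mem_faces_iff.2 fun e he f hf => ?_⟩
  exact h.compat_left e f (h.cover_left e (mem_posAxes.1 he)) (h.cover_left f (mem_posAxes.1 hf))

theorem right_mem_points : y ∈ X.points := by
  refine mem_points_iff.2 ⟨h.nonneg_right, mem_faces_iff.2 fun e he f hf => ?_⟩
  exact h.compat_right e f (h.cover_right e (mem_posAxes.1 he))
    (h.cover_right f (mem_posAxes.1 hf))

variable [Fintype ι]

omit h in
theorem zero_le_speedSq : 0 ≤ speedSq x y S A B :=
  add_nonneg (Finset.sum_nonneg fun _ _ => sq_nonneg _) (Finset.sum_nonneg fun _ _ => sq_nonneg _)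

section Glue

variable (u : Fin M → ℝ) (p q : ι → Fin M → ℝ) {e : Fin M}

theorem glue_of_mem (he : e ∈ S) : glue S A B u p q e = u e := by
  unfold glue
  rw [if_pos he, Finset.sum_eq_zero, add_zero]
  intro i _
  rw [if_neg (Finset.disjoint_left.1 (h.disjoint_left i) he),
    if_neg (Finset.disjoint_left.1 (h.disjoint_right i) he), add_zero]

theorem glue_of_mem_left {i : ι} (he : e ∈ A i) : glue S A B u p q e = p i e := by
  unfold glue
  rw [if_neg (Finset.disjoint_right.1 (h.disjoint_left i) he), zero_add,
    Finset.sum_eq_single i]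
  · rw [if_pos he, if_neg (Finset.disjoint_left.1 (h.disjoint_left_right i i) he), add_zero]
  · intro j _ hj
    rw [if_neg (Finset.disjoint_right.1 (h.pairwise_left j i hj) he),
      if_neg (Finset.disjoint_left.1 (h.disjoint_left_right i j) he), add_zero]
  · simp

theorem glue_of_mem_right {i : ι} (he : e ∈ B i) : glue S A B u p q e = q i e := by
  unfold glue
  rw [if_neg (Finset.disjoint_right.1 (h.disjoint_right i) he), zero_add,
    Finset.sum_eq_single i]
  · rw [if_pos he, if_neg (Finset.disjoint_right.1 (h.disjoint_left_right i i) he), zero_add]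
  · intro j _ hj
    rw [if_neg (Finset.disjoint_right.1 (h.pairwise_right j i hj) he),
      if_neg (Finset.disjoint_right.1 (h.disjoint_left_right j i) he), add_zero]
  · simp

omit h in
theorem glue_of_notMem (hS : e ∉ S) (hA : ∀ i, e ∉ A i) (hB : ∀ i, e ∉ B i) :
    glue S A B u p q e = 0 := by
  simp [glue, hS, hA, hB]

/-- A function is glued from its values on the blocks if it vanishes off them. -/
theorem eq_glue {f : Fin M → ℝ} (hS : ∀ e ∈ S, f e = u e) (hA : ∀ i, ∀ e ∈ A i, f e = p i e)
    (hB : ∀ i, ∀ e ∈ B i, f e = q i e)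
    (h0 : ∀ e, e ∉ S → (∀ i, e ∉ A i) → (∀ i, e ∉ B i) → f e = 0) :
    f = glue S A B u p q := by
  funext e
  rcases block_cases (S := S) (A := A) (B := B) e with he | ⟨i, he⟩ | ⟨i, he⟩ | ⟨h1, h2, h3⟩
  · rw [h.glue_of_mem _ _ _ he, hS e he]
  · rw [h.glue_of_mem_left _ _ _ he, hA i e he]
  · rw [h.glue_of_mem_right _ _ _ he, hB i e he]
  · rw [glue_of_notMem _ _ _ h1 h2 h3, h0 e h1 h2 h3]

end Glue

theorem calVec_of_mem {e : Fin M} (he : e ∈ S) : calVec x y S A B e = y e - x e :=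
  h.glue_of_mem _ _ _ he

theorem calVec_of_mem_left {e : Fin M} {i : ι} (he : e ∈ A i) : calVec x y S A B e =
    -((‖proj (A i) x‖ + ‖proj (B i) y‖) / ‖proj (A i) x‖ * x e) :=
  h.glue_of_mem_left _ _ _ he

theorem calVec_of_mem_right {e : Fin M} {i : ι} (he : e ∈ B i) : calVec x y S A B e =
    (‖proj (A i) x‖ + ‖proj (B i) y‖) / ‖proj (B i) y‖ * y e :=
  h.glue_of_mem_right _ _ _ he

omit h in
theorem calVec_of_notMem {e : Fin M} (hS : e ∉ S) (hA : ∀ i, e ∉ A i) (hB : ∀ i, e ∉ B i) :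
    calVec x y S A B e = 0 :=
  glue_of_notMem _ _ _ hS hA hB

/-- The axes of a face are mutually compatible, so `weight_le` applies to G ∩ A_i and G ∩ B_i. After
scaling by (a_i + b_i)² it bounds the contribution of block i by (a_i + b_i)². -/
theorem sum_sq_calVec_le {G : Finset (Fin M)} (hG : G ∈ X.faces) :
    ∑ e ∈ G, calVec x y S A B e ^ 2 ≤ speedSq x y S A B := by
  have h1 : (fun e => calVec x y S A B e ^ 2) = glue S A B (fun e => (y e - x e) ^ 2)
      (fun i e => ((‖proj (A i) x‖ + ‖proj (B i) y‖) / ‖proj (A i) x‖) ^ 2 * x e ^ 2)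
      (fun i e => ((‖proj (A i) x‖ + ‖proj (B i) y‖) / ‖proj (B i) y‖) ^ 2 * y e ^ 2) := by
    refine h.eq_glue _ _ _ (fun e he => ?_) (fun i e he => ?_) (fun i e he => ?_)
      fun e h1 h2 h3 => ?_
    · rw [h.calVec_of_mem he]
    · rw [h.calVec_of_mem_left he]
      ring
    · rw [h.calVec_of_mem_right he]
      ring
    · rw [calVec_of_notMem h1 h2 h3]
      ring
  rw [h1, sum_glue]
  refine add_le_add (Finset.sum_le_sum_of_subset_of_nonneg Finset.inter_subset_right
    fun _ _ _ => sq_nonneg _) (Finset.sum_le_sum fun i _ => ?_)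
  rw [← Finset.mul_sum, ← Finset.mul_sum, ← norm_sq_proj, ← norm_sq_proj]
  have ha := h.left_pos i
  have hb := h.right_pos i
  have hw := h.weight_le i _ (Finset.inter_subset_right (s₁ := G)) _
    (Finset.inter_subset_right (s₁ := G)) fun e he f hf =>
      mem_faces_iff.1 hG e (Finset.mem_inter.1 he).1 f (Finset.mem_inter.1 hf).1
  set a := ‖proj (A i) x‖
  set b := ‖proj (B i) y‖
  have h2 : ((a + b) / a) ^ 2 * ‖proj (G ∩ A i) x‖ ^ 2 + ((a + b) / b) ^ 2 * ‖proj (G ∩ B i) y‖ ^ 2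
      = (a + b) ^ 2 * ((‖proj (G ∩ A i) x‖ ^ 2 * b ^ 2 + ‖proj (G ∩ B i) y‖ ^ 2 * a ^ 2) /
        (a ^ 2 * b ^ 2)) := by
    field_simp
  rw [h2]
  refine mul_le_of_le_one_right (sq_nonneg _) ?_
  rw [div_le_one (by positivity)]
  exact hw

/-- Block i contributes (a_i + b_i)/a_i · a_i² + (a_i + b_i)/b_i · b_i² = (a_i + b_i)², because y
vanishes on A_i and x on B_i. -/
theorem sum_calVec_mul_sub :
    ∑ e, calVec x y S A B e * (y e - x e) = speedSq x y S A B := by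
  have h1 : (fun e => calVec x y S A B e * (y e - x e)) = glue S A B (fun e => (y e - x e) ^ 2)
      (fun i e => (‖proj (A i) x‖ + ‖proj (B i) y‖) / ‖proj (A i) x‖ * x e ^ 2)
      (fun i e => (‖proj (A i) x‖ + ‖proj (B i) y‖) / ‖proj (B i) y‖ * y e ^ 2) := by
    refine h.eq_glue _ _ _ (fun e he => ?_) (fun i e he => ?_) (fun i e he => ?_)
      fun e h1 h2 h3 => ?_
    · rw [h.calVec_of_mem he]
      ring
    · rw [h.calVec_of_mem_left he, h.right_eq_zero he]
      ring
    · rw [h.calVec_of_mem_right he, h.left_eq_zero he]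
      ring
    · rw [calVec_of_notMem h1 h2 h3, zero_mul]
  rw [h1, sum_glue]
  simp only [Finset.univ_inter, ← Finset.mul_sum, ← norm_sq_proj]
  unfold speedSq
  congr 1
  refine Finset.sum_congr rfl fun i _ => ?_
  have ha := h.left_pos i
  have hb := h.right_pos i
  field_simp

/-- A segment inside the space lies in one closed face, where Cauchy–Schwarz applies with the bound
on the restricted covector. -/
theorem sum_calVec_le_dist {p q : EuclideanSpace ℝ (Fin M)} (hpq : segment ℝ p q ⊆ X.points) :
    ∑ e, calVec x y S A B e * (q e - p e) ≤ √(speedSq x y S A B) * dist p q := by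
  obtain ⟨G, hG, h0⟩ := exists_face_of_segment_subset hpq
  have h1 : ∑ e, calVec x y S A B e * (q e - p e) =
      ∑ e ∈ G, calVec x y S A B e * (q e - p e) := by
    refine (Finset.sum_subset (Finset.subset_univ G) fun e _ he => ?_).symm
    rw [(h0 e he).1, (h0 e he).2, sub_self, mul_zero]
  rw [h1]
  refine (Real.sum_mul_le_sqrt_mul_sqrt _ _ _).trans (mul_le_mul
    (Real.sqrt_le_sqrt (h.sum_sq_calVec_le hG)) ?_ (Real.sqrt_nonneg _) (Real.sqrt_nonneg _))
  rw [dist_comm, EuclideanSpace.dist_eq]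
  refine Real.sqrt_le_sqrt ?_
  simp only [Real.dist_eq, sq_abs]
  exact Finset.sum_le_sum_of_subset_of_nonneg (Finset.subset_univ G) fun _ _ _ => sq_nonneg _

theorem sum_calVec_le_idist {p q : EuclideanSpace ℝ (Fin M)} (hp : p ∈ X.points)
    (hq : q ∈ X.points) :
    ∑ e, calVec x y S A B e * (q e - p e) ≤ √(speedSq x y S A B) * X.idist p q := by
  have tel : ∀ (n : ℕ) (r : ℕ → EuclideanSpace ℝ (Fin M)), r 0 = p → r n = q →
      (∀ i < n, segment ℝ (r i) (r (i + 1)) ⊆ X.points) →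
      ∑ e, calVec x y S A B e * (q e - p e) ≤
        √(speedSq x y S A B) * ∑ i ∈ Finset.range n, dist (r i) (r (i + 1)) := by
    intro n r h1 h2 h3
    have h4 : ∑ e, calVec x y S A B e * (q e - p e) =
        ∑ i ∈ Finset.range n, ∑ e, calVec x y S A B e * (r (i + 1) e - r i e) := by
      rw [Finset.sum_comm]
      refine Finset.sum_congr rfl fun e _ => ?_
      rw [← Finset.mul_sum, Finset.sum_range_sub (fun i => r i e), h1, h2]
    rw [h4, Finset.mul_sum]
    exact Finset.sum_le_sum fun i hi => h.sum_calVec_le_dist (h3 i (Finset.mem_range.1 hi))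
  rcases (Real.sqrt_nonneg (speedSq x y S A B)).eq_or_lt with h0 | h0
  -- If L = 0 the bound cannot be divided by L, but a single path already shows that the pairing is
  -- at most 0.
  · obtain ⟨_, n, r, h1, h2, h3, -⟩ := lengths_nonempty hp hq
    have := tel n r h1 h2 h3
    rwa [← h0, zero_mul] at this ⊢
  · rw [← div_le_iff₀' h0]
    refine le_idist hp hq fun n r h1 h2 h3 => ?_
    rw [div_le_iff₀' h0]
    exact tel n r h1 h2 h3

end IsCalibrated

end OrthantSpace

/-! ### The certified path is a geodesic -/

namespace OrthantSpace

variable {M m : ℕ}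

namespace IsCalibrated

variable {X : OrthantSpace M m} {ι : Type*} {x y : EuclideanSpace ℝ (Fin M)}
  {S : Finset (Fin M)} {A B : ι → Finset (Fin M)} (h : X.IsCalibrated x y S A B)

include h

variable [Fintype ι]

section Path

variable {t : ℝ} {e : Fin M}

theorem calPath_of_mem (he : e ∈ S) : calPath x y S A B t e = (1 - t) * x e + t * y e := by
  simp only [calPath]
  rw [h.glue_of_mem _ _ _ he]

theorem calPath_of_mem_left {i : ι} (he : e ∈ A i) : calPath x y S A B t e =
    max 0 ((1 - t) * ‖proj (A i) x‖ - t * ‖proj (B i) y‖) / ‖proj (A i) x‖ * x e := by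
  simp only [calPath]
  rw [h.glue_of_mem_left _ _ _ he]

theorem calPath_of_mem_right {i : ι} (he : e ∈ B i) : calPath x y S A B t e =
    max 0 (t * ‖proj (B i) y‖ - (1 - t) * ‖proj (A i) x‖) / ‖proj (B i) y‖ * y e := by
  simp only [calPath]
  rw [h.glue_of_mem_right _ _ _ he]

omit h in
theorem calPath_of_notMem (hS : e ∉ S) (hA : ∀ i, e ∉ A i) (hB : ∀ i, e ∉ B i) :
    calPath x y S A B t e = 0 := by
  simp only [calPath]
  rw [glue_of_notMem _ _ _ hS hA hB]

theorem calPath_zero : calPath x y S A B 0 = x := by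
  ext e
  rcases block_cases (S := S) (A := A) (B := B) e with he | ⟨i, he⟩ | ⟨i, he⟩ | ⟨h1, h2, h3⟩
  · simp [h.calPath_of_mem he]
  · have := h.left_pos i
    simp [h.calPath_of_mem_left he, this.ne']
  · simp [h.calPath_of_mem_right he, h.left_eq_zero he]
  · rw [calPath_of_notMem h1 h2 h3]
    by_contra hne
    rcases h.cover_left e ((h.nonneg_left e).lt_of_ne hne) with h4 | ⟨i, h4⟩
    · exact h1 h4
    · exact h2 i h4

theorem calPath_one : calPath x y S A B 1 = y := by
  ext e
  rcases block_cases (S := S) (A := A) (B := B) e with he | ⟨i, he⟩ | ⟨i, he⟩ | ⟨h1, h2, h3⟩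
  · simp [h.calPath_of_mem he]
  · simp [h.calPath_of_mem_left he, h.right_eq_zero he]
  · have := h.right_pos i
    simp [h.calPath_of_mem_right he, this.ne']
  · rw [calPath_of_notMem h1 h2 h3]
    by_contra hne
    rcases h.cover_right e ((h.nonneg_right e).lt_of_ne hne) with h4 | ⟨i, h4⟩
    · exact h1 h4
    · exact h3 i h4

theorem calPath_nonneg (ht : t ∈ Set.Icc (0 : ℝ) 1) (e : Fin M) : 0 ≤ calPath x y S A B t e := by
  have hx := h.nonneg_left e
  have hy := h.nonneg_right e
  rcases block_cases (S := S) (A := A) (B := B) e with he | ⟨i, he⟩ | ⟨i, he⟩ | ⟨h1, h2, h3⟩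
  · rw [h.calPath_of_mem he]
    exact add_nonneg (mul_nonneg (sub_nonneg.2 ht.2) hx) (mul_nonneg ht.1 hy)
  · rw [h.calPath_of_mem_left he]
    positivity
  · rw [h.calPath_of_mem_right he]
    positivity
  · rw [calPath_of_notMem h1 h2 h3]

/-- If no breakpoint lies strictly between `s` and `t`, the certified path stays in a single face
between these times. -/
theorem exists_face_calPath {s t : ℝ} (hs : 0 ≤ s) (hst : s ≤ t)
    (hb : ∀ i, (1 - s) * ‖proj (A i) x‖ ≤ s * ‖proj (B i) y‖ ∨
      t * ‖proj (B i) y‖ ≤ (1 - t) * ‖proj (A i) x‖) :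
    ∃ G ∈ X.faces, ∀ e ∉ G, calPath x y S A B s e = 0 ∧ calPath x y S A B t e = 0 := by
  classical
  refine ⟨Finset.univ.filter fun e => e ∈ S ∨
    (∃ i, e ∈ A i ∧ s * ‖proj (B i) y‖ < (1 - s) * ‖proj (A i) x‖) ∨
    (∃ i, e ∈ B i ∧ (1 - t) * ‖proj (A i) x‖ < t * ‖proj (B i) y‖), ?_, ?_⟩
  · have cross : ∀ e f, (∃ i, e ∈ A i ∧ s * ‖proj (B i) y‖ < (1 - s) * ‖proj (A i) x‖) →
        (∃ i, f ∈ B i ∧ (1 - t) * ‖proj (A i) x‖ < t * ‖proj (B i) y‖) → X.Compat e f := by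
      rintro e f ⟨i, he, hi⟩ ⟨j, hf, hj⟩
      refine h.compat_cross i j ?_ e he f hf
      have h1 := (hb j).resolve_right (not_le.2 hj)
      have hi1 := h.left_pos i
      have hi2 := h.right_pos i
      have hj2 := h.right_pos j
      rw [div_lt_div_iff₀ hj2 hi2]
      have hs1 : 0 < 1 - s := by
        by_contra hcon
        have : (1 - s) * ‖proj (A i) x‖ ≤ 0 :=
          mul_nonpos_of_nonpos_of_nonneg (not_lt.1 hcon) hi1.le
        have : 0 ≤ s * ‖proj (B i) y‖ := mul_nonneg hs hi2.le
        linarith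
      have h2 := mul_le_mul_of_nonneg_right h1 hi2.le
      have h3 := mul_lt_mul_of_pos_right hi hj2
      refine lt_of_mul_lt_mul_left ?_ hs1.le
      linarith
    refine mem_faces_iff.2 fun e he f hf => ?_
    simp only [Finset.mem_filter, Finset.mem_univ, true_and] at he hf
    rcases he with he | he | he <;> rcases hf with hf | hf | hf
    · exact h.compat_left e f (Or.inl he) (Or.inl hf)
    · exact h.compat_left e f (Or.inl he) (Or.inr (hf.imp fun _ h => h.1))
    · exact h.compat_right e f (Or.inl he) (Or.inr (hf.imp fun _ h => h.1))
    · exact h.compat_left e f (Or.inr (he.imp fun _ h => h.1)) (Or.inl hf)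
    · exact h.compat_left e f (Or.inr (he.imp fun _ h => h.1)) (Or.inr (hf.imp fun _ h => h.1))
    · exact cross e f he hf
    · exact h.compat_right e f (Or.inr (he.imp fun _ h => h.1)) (Or.inl hf)
    · exact (cross f e hf he).symm
    · exact h.compat_right e f (Or.inr (he.imp fun _ h => h.1)) (Or.inr (hf.imp fun _ h => h.1))
  · intro e he
    simp only [Finset.mem_filter, Finset.mem_univ, true_and, not_or, not_exists, not_and,
      not_lt] at he
    obtain ⟨h1, h2, h3⟩ := he
    rcases block_cases (S := S) (A := A) (B := B) e with he | ⟨i, he⟩ | ⟨i, he⟩ | ⟨h4, h5, h6⟩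
    · exact absurd he h1
    · have hi1 := h.left_pos i
      have hi2 := h.right_pos i
      have h4 := h2 i he
      have h5 : (1 - t) * ‖proj (A i) x‖ ≤ t * ‖proj (B i) y‖ := by
        have h6 := mul_le_mul_of_nonneg_right hst hi1.le
        have h7 := mul_le_mul_of_nonneg_right hst hi2.le
        linarith
      rw [h.calPath_of_mem_left he, h.calPath_of_mem_left he, max_eq_left (by linarith),
        max_eq_left (by linarith)]
      simp
    · have hi1 := h.left_pos i
      have hi2 := h.right_pos i
      have h4 := h3 i he
      have h5 : s * ‖proj (B i) y‖ ≤ (1 - s) * ‖proj (A i) x‖ := by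
        have h6 := mul_le_mul_of_nonneg_right hst hi1.le
        have h7 := mul_le_mul_of_nonneg_right hst hi2.le
        linarith
      rw [h.calPath_of_mem_right he, h.calPath_of_mem_right he, max_eq_left (by linarith),
        max_eq_left (by linarith)]
      simp
    · exact ⟨calPath_of_notMem h4 h5 h6, calPath_of_notMem h4 h5 h6⟩

theorem calPath_mem_points (ht : t ∈ Set.Icc (0 : ℝ) 1) : calPath x y S A B t ∈ X.points := by
  obtain ⟨G, hG, h0⟩ := h.exists_face_calPath ht.1 le_rfl fun i => by
    rcases le_total ((1 - t) * ‖proj (A i) x‖) (t * ‖proj (B i) y‖) with h1 | h1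
    · exact Or.inl h1
    · exact Or.inr h1
  exact mem_points_of_face hG (h.calPath_nonneg ht) fun e he => (h0 e he).1

/-- Between consecutive breakpoints only one of the two halves of block i moves, either A_i
shrinking or B_i growing, and its norm changes at rate a_i + b_i in both cases. -/
theorem dist_calPath_of_no_break {s t : ℝ} (hst : s ≤ t)
    (hb : ∀ i, (1 - s) * ‖proj (A i) x‖ ≤ s * ‖proj (B i) y‖ ∨
      t * ‖proj (B i) y‖ ≤ (1 - t) * ‖proj (A i) x‖) :
    dist (calPath x y S A B s) (calPath x y S A B t) = (t - s) * √(speedSq x y S A B) := by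
  have h1 : (fun e => (calPath x y S A B s e - calPath x y S A B t e) ^ 2) = glue S A B
      (fun e => (t - s) ^ 2 * (y e - x e) ^ 2)
      (fun i e => ((max 0 ((1 - s) * ‖proj (A i) x‖ - s * ‖proj (B i) y‖) -
        max 0 ((1 - t) * ‖proj (A i) x‖ - t * ‖proj (B i) y‖)) / ‖proj (A i) x‖) ^ 2 * x e ^ 2)
      (fun i e => ((max 0 (s * ‖proj (B i) y‖ - (1 - s) * ‖proj (A i) x‖) -
        max 0 (t * ‖proj (B i) y‖ - (1 - t) * ‖proj (A i) x‖)) / ‖proj (B i) y‖) ^ 2 *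
        y e ^ 2) := by
    refine h.eq_glue _ _ _ (fun e he => ?_) (fun i e he => ?_) (fun i e he => ?_)
      fun e h1 h2 h3 => ?_
    · rw [h.calPath_of_mem he, h.calPath_of_mem he]
      ring
    · rw [h.calPath_of_mem_left he, h.calPath_of_mem_left he]
      ring
    · rw [h.calPath_of_mem_right he, h.calPath_of_mem_right he]
      ring
    · rw [calPath_of_notMem h1 h2 h3, calPath_of_notMem h1 h2 h3]
      ring
  have h2 : ∑ e, (calPath x y S A B s e - calPath x y S A B t e) ^ 2 =
      (t - s) ^ 2 * speedSq x y S A B := by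
    rw [h1, sum_glue]
    simp only [Finset.univ_inter, ← Finset.mul_sum, ← norm_sq_proj]
    unfold speedSq
    rw [mul_add]
    congr 1
    rw [Finset.mul_sum]
    refine Finset.sum_congr rfl fun i _ => ?_
    have ha := h.left_pos i
    have hb' := h.right_pos i
    have h6 := mul_le_mul_of_nonneg_right hst ha.le
    have h7 := mul_le_mul_of_nonneg_right hst hb'.le
    rw [div_pow, div_pow, div_mul_cancel₀ _ (by positivity), div_mul_cancel₀ _ (by positivity)]
    rcases hb i with h3 | h3
    · rw [max_eq_left (by linarith), max_eq_left (by linarith), max_eq_right (by linarith),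
        max_eq_right (by linarith)]
      ring
    · rw [max_eq_right (by linarith), max_eq_right (by linarith), max_eq_left (by linarith),
        max_eq_left (by linarith)]
      ring
  rw [EuclideanSpace.dist_eq]
  simp only [Real.dist_eq, sq_abs]
  rw [h2, Real.sqrt_mul (sq_nonneg _), Real.sqrt_sq (sub_nonneg.2 hst)]

/-- Induction on the number of blocks whose breakpoint lies strictly between s and t: the interval
is cut at one such breakpoint, which then counts for neither half. Without breakpoints the path is a
straight segment in one face. -/
theorem idist_calPath_le {s t : ℝ} (hs : 0 ≤ s) (hst : s ≤ t) (ht : t ≤ 1) :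
    X.idist (calPath x y S A B s) (calPath x y S A B t) ≤ (t - s) * √(speedSq x y S A B) := by
  classical
  induction hn : (Finset.univ.filter fun i => s * ‖proj (B i) y‖ < (1 - s) * ‖proj (A i) x‖ ∧
    (1 - t) * ‖proj (A i) x‖ < t * ‖proj (B i) y‖).card using Nat.strong_induction_on
    generalizing s t with
  | _ n ih =>
    rcases Finset.eq_empty_or_nonempty (Finset.univ.filter fun i =>
      s * ‖proj (B i) y‖ < (1 - s) * ‖proj (A i) x‖ ∧
      (1 - t) * ‖proj (A i) x‖ < t * ‖proj (B i) y‖) with h0 | ⟨i, hi⟩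
    · have hb : ∀ i, (1 - s) * ‖proj (A i) x‖ ≤ s * ‖proj (B i) y‖ ∨
          t * ‖proj (B i) y‖ ≤ (1 - t) * ‖proj (A i) x‖ := by
        intro i
        have := Finset.eq_empty_iff_forall_notMem.1 h0 i
        simp only [Finset.mem_filter, Finset.mem_univ, true_and, not_and_or, not_lt] at this
        exact this
      obtain ⟨G, hG, hz⟩ := h.exists_face_calPath hs hst hb
      rw [← h.dist_calPath_of_no_break hst hb]
      exact idist_le_dist (segment_subset_points hG (h.calPath_nonneg ⟨hs, hst.trans ht⟩)
        (h.calPath_nonneg ⟨hs.trans hst, ht⟩) (fun e he => (hz e he).1) fun e he => (hz e he).2)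
    · have hi' := hi
      simp only [Finset.mem_filter, Finset.mem_univ, true_and] at hi
      have ha := h.left_pos i
      have hb := h.right_pos i
      obtain ⟨τ, hτ⟩ : ∃ τ, τ * (‖proj (A i) x‖ + ‖proj (B i) y‖) = ‖proj (A i) x‖ :=
        ⟨_, div_mul_cancel₀ _ (by positivity)⟩
      have hsτ : s < τ := by
        refine lt_of_mul_lt_mul_right ?_ (add_pos ha hb).le
        linarith [hi.1]
      have hτt : τ < t := by
        refine lt_of_mul_lt_mul_right ?_ (add_pos ha hb).le
        linarith [hi.2]
      have hm : ∀ r : ℝ, 0 ≤ r → r ≤ 1 → calPath x y S A B r ∈ X.points :=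
        fun r h0 h1 => h.calPath_mem_points ⟨h0, h1⟩
      have h1 := ih _ (by
        rw [← hn]
        refine Finset.card_lt_card ((Finset.ssubset_iff_of_subset fun j hj => ?_).2
          ⟨i, hi', ?_⟩)
        · simp only [Finset.mem_filter, Finset.mem_univ, true_and] at hj ⊢
          refine ⟨hj.1, ?_⟩
          have h6 := mul_le_mul_of_nonneg_right hτt.le (h.left_pos j).le
          have h7 := mul_le_mul_of_nonneg_right hτt.le (h.right_pos j).le
          linarith [hj.2]
        · simp only [Finset.mem_filter, Finset.mem_univ, true_and, not_and, not_lt]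
          intro _
          linarith) hs hsτ.le (hτt.le.trans ht) rfl
      have h2 := ih _ (by
        rw [← hn]
        refine Finset.card_lt_card ((Finset.ssubset_iff_of_subset fun j hj => ?_).2
          ⟨i, hi', ?_⟩)
        · simp only [Finset.mem_filter, Finset.mem_univ, true_and] at hj ⊢
          refine ⟨?_, hj.2⟩
          have h6 := mul_le_mul_of_nonneg_right hsτ.le (h.left_pos j).le
          have h7 := mul_le_mul_of_nonneg_right hsτ.le (h.right_pos j).le
          linarith [hj.1]
        · simp only [Finset.mem_filter, Finset.mem_univ, true_and, not_and, not_lt]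
          intro h3
          linarith) (hs.trans hsτ.le) hτt.le ht rfl
      have h3 := idist_triangle (hm s hs (hst.trans ht))
        (hm τ (hs.trans hsτ.le) (hτt.le.trans ht)) (hm t (hs.trans hst) ht)
      linarith

end Path

theorem idist_eq : X.idist x y = √(speedSq x y S A B) := by
  refine le_antisymm ?_ ?_
  · have := h.idist_calPath_le le_rfl zero_le_one le_rfl
    rwa [h.calPath_zero, h.calPath_one, sub_zero, one_mul] at this
  · have h1 := h.sum_calVec_le_idist h.left_mem_points h.right_mem_points
    rw [h.sum_calVec_mul_sub] at h1
    rcases (Real.sqrt_nonneg (speedSq x y S A B)).eq_or_lt with h0 | h0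
    · rw [← h0]
      exact dist_nonneg.trans (dist_le_idist h.left_mem_points h.right_mem_points)
    · refine le_of_mul_le_mul_left ?_ h0
      rwa [Real.mul_self_sqrt zero_le_speedSq]

theorem isGeodesic_calPath : X.IsGeodesic x y (calPath x y S A B) := by
  have hm : ∀ r : ℝ, 0 ≤ r → r ≤ 1 → calPath x y S A B r ∈ X.points :=
    fun r h0 h1 => h.calPath_mem_points ⟨h0, h1⟩
  -- The upper bounds on [0, s], [s, t] and [t, 1] add up to the distance of the endpoints, so by
  -- the triangle inequality none of them can be strict.
  have key : ∀ s t : ℝ, 0 ≤ s → s ≤ t → t ≤ 1 →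
      X.idist (calPath x y S A B s) (calPath x y S A B t) = (t - s) * X.idist x y := by
    intro s t hs hst ht
    have h1 := h.idist_calPath_le le_rfl hs (hst.trans ht)
    have h2 := h.idist_calPath_le hs hst ht
    have h3 := h.idist_calPath_le (hs.trans hst) ht le_rfl
    have h4 := idist_triangle (hm 0 le_rfl zero_le_one) (hm s hs (hst.trans ht))
      (hm 1 zero_le_one le_rfl)
    have h5 := idist_triangle (hm s hs (hst.trans ht)) (hm t (hs.trans hst) ht)
      (hm 1 zero_le_one le_rfl)
    rw [h.calPath_zero, h.calPath_one] at h4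
    rw [h.calPath_zero] at h1
    rw [h.calPath_one] at h3 h5
    rw [h.idist_eq] at h4 ⊢
    linarith
  refine ⟨h.calPath_zero, h.calPath_one, fun t ht => hm t ht.1 ht.2, fun s hs t ht => ?_⟩
  rcases le_total s t with hst | hst
  · rw [key s t hs.1 hst ht.2, abs_sub_comm, abs_of_nonneg (sub_nonneg.2 hst)]
  · rw [idist_comm (hm s hs.1 hs.2) (hm t ht.1 ht.2), key t s ht.1 hst hs.2,
      abs_of_nonneg (sub_nonneg.2 hst)]

end IsCalibrated

/-! ### Rigidity: the calibration along an arbitrary geodesic -/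

namespace IsGeodesic

variable {X : OrthantSpace M m} {x y : EuclideanSpace ℝ (Fin M)}
  {γ : ℝ → EuclideanSpace ℝ (Fin M)}

theorem dist_le (hγ : X.IsGeodesic x y γ) {s t : ℝ} (hs : s ∈ Set.Icc (0 : ℝ) 1)
    (ht : t ∈ Set.Icc (0 : ℝ) 1) : dist (γ s) (γ t) ≤ X.idist x y * dist s t := by
  rw [Real.dist_eq, mul_comm, ← hγ.speed s hs t ht]
  exact dist_le_idist (hγ.mem s hs) (hγ.mem t ht)

theorem continuousOn (hγ : X.IsGeodesic x y γ) : ContinuousOn γ (Set.Icc 0 1) := by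
  have h0 : 0 ≤ X.idist x y := by
    have h1 := hγ.mem 0 (by simp)
    have h2 := hγ.mem 1 (by simp)
    rw [hγ.source] at h1
    rw [hγ.target] at h2
    exact dist_nonneg.trans (dist_le_idist h1 h2)
  refine (LipschitzOnWith.of_dist_le_mul (K := ⟨_, h0⟩) fun s hs t ht => ?_).continuousOn
  exact hγ.dist_le hs ht

end IsGeodesic

namespace IsCalibrated

variable {X : OrthantSpace M m} {ι : Type*} [Fintype ι] {x y : EuclideanSpace ℝ (Fin M)}
  {S : Finset (Fin M)} {A B : ι → Finset (Fin M)} (h : X.IsCalibrated x y S A B)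
  {γ : ℝ → EuclideanSpace ℝ (Fin M)} (hγ : X.IsGeodesic x y γ)

include h hγ

/-- The calibration bounds the growth on [0, s], [s, t] and [t, 1] from above, and these bounds sum
to the exact total, so each is an equality. -/
theorem sum_calVec_geodesic {s t : ℝ} (hs : 0 ≤ s) (hst : s ≤ t) (ht : t ≤ 1) :
    ∑ e, calVec x y S A B e * (γ t e - γ s e) = (t - s) * speedSq x y S A B := by
  have key : ∀ s t : ℝ, 0 ≤ s → s ≤ t → t ≤ 1 →
      ∑ e, calVec x y S A B e * (γ t e - γ s e) ≤ (t - s) * speedSq x y S A B := by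
    intro s t hs hst ht
    have h1 := h.sum_calVec_le_idist (hγ.mem s ⟨hs, hst.trans ht⟩) (hγ.mem t ⟨hs.trans hst, ht⟩)
    rw [hγ.speed s ⟨hs, hst.trans ht⟩ t ⟨hs.trans hst, ht⟩, h.idist_eq, abs_sub_comm,
      abs_of_nonneg (sub_nonneg.2 hst), mul_left_comm, Real.mul_self_sqrt zero_le_speedSq] at h1
    exact h1
  have h1 := key 0 s le_rfl hs (hst.trans ht)
  have h2 := key s t hs hst ht
  have h3 := key t 1 (hs.trans hst) ht le_rfl
  have h4 := h.sum_calVec_mul_sub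
  rw [← hγ.source, ← hγ.target] at h4
  have h5 : ∑ e, calVec (γ 0) (γ 1) S A B e * (γ 1 e - γ 0 e) =
      ∑ e, calVec x y S A B e * (γ s e - γ 0 e) + ∑ e, calVec x y S A B e * (γ t e - γ s e) +
        ∑ e, calVec x y S A B e * (γ 1 e - γ t e) := by
    rw [← Finset.sum_add_distrib, ← Finset.sum_add_distrib, hγ.source, hγ.target]
    exact Finset.sum_congr rfl fun e _ => by ring
  rw [h4] at h5
  rw [hγ.source, hγ.target] at h5
  rw [hγ.source] at h1
  rw [hγ.target] at h3
  linarith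

/-- Along any geodesic, a displacement on which the calibrating covector agrees with a vector `w`
that is not longer than the geodesic is proportional to `w`. -/
theorem displacement_eq {s t : ℝ} (hs : 0 ≤ s) (hst : s ≤ t) (ht : t ≤ 1) {w : Fin M → ℝ}
    (hw : ∑ e, w e ^ 2 ≤ speedSq x y S A B)
    (hc : ∑ e, w e * (γ t e - γ s e) = ∑ e, calVec x y S A B e * (γ t e - γ s e)) (e : Fin M) :
    γ t e - γ s e = (t - s) * w e := by
  have h1 := h.sum_calVec_geodesic hγ hs hst ht
  have h2 : ∑ e, (γ t e - γ s e) ^ 2 ≤ (t - s) ^ 2 * speedSq x y S A B := by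
    have h3 := hγ.dist_le ⟨hs, hst.trans ht⟩ ⟨hs.trans hst, ht⟩
    rw [h.idist_eq, EuclideanSpace.dist_eq] at h3
    simp only [Real.dist_eq, sq_abs] at h3
    have h4 := (Real.sqrt_le_left (by positivity)).1 h3
    rw [mul_pow, sq_abs, Real.sq_sqrt zero_le_speedSq] at h4
    calc ∑ e, (γ t e - γ s e) ^ 2 = ∑ e, (γ s e - γ t e) ^ 2 :=
          Finset.sum_congr rfl fun e _ => by ring
      _ ≤ _ := h4
      _ = _ := by ring
  -- Equality case of Cauchy–Schwarz: expanding the square, the three terms are bounded by 1, -2 and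
  -- 1 times (t - s)² L².
  have h3 : ∑ e, (γ t e - γ s e - (t - s) * w e) ^ 2 ≤ 0 := by
    have h4 : ∑ e, (γ t e - γ s e - (t - s) * w e) ^ 2 = ∑ e, (γ t e - γ s e) ^ 2 -
        2 * (t - s) * ∑ e, w e * (γ t e - γ s e) + (t - s) ^ 2 * ∑ e, w e ^ 2 := by
      rw [Finset.mul_sum, Finset.mul_sum, ← Finset.sum_sub_distrib, ← Finset.sum_add_distrib]
      exact Finset.sum_congr rfl fun e _ => by ring
    have h5 := mul_le_mul_of_nonneg_left hw (sq_nonneg (t - s))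
    rw [h4, hc, h1]
    nlinarith
  have h4 := (Finset.sum_eq_zero_iff_of_nonneg fun e _ =>
    sq_nonneg (γ t e - γ s e - (t - s) * w e)).1
    (le_antisymm h3 (Finset.sum_nonneg fun _ _ => sq_nonneg _)) e (Finset.mem_univ e)
  linarith [pow_eq_zero_iff (two_ne_zero) |>.1 h4]

/-- While a geodesic stays in a face, its coordinates move with the speeds `calVec`. -/
theorem displacement_eq_of_face {s t : ℝ} (hs : 0 ≤ s) (hst : s ≤ t) (ht : t ≤ 1)
    {G : Finset (Fin M)} (hG : G ∈ X.faces) (h0 : ∀ e ∉ G, γ s e = 0 ∧ γ t e = 0) {e : Fin M}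
    (he : e ∈ G) : γ t e - γ s e = (t - s) * calVec x y S A B e := by
  have h1 := h.displacement_eq hγ hs hst ht (w := fun e => if e ∈ G then calVec x y S A B e else 0)
    (by simpa [ite_pow, Finset.sum_ite_mem] using h.sum_sq_calVec_le hG)
    (Finset.sum_congr rfl fun e _ => by
      by_cases he : e ∈ G
      · simp [he]
      · simp [he, (h0 e he).1, (h0 e he).2]) e
  simpa [he] using h1

end IsCalibrated

end OrthantSpace

/-! ### The initial velocity and the logarithm map -/

namespace OrthantSpace

variable {M m : ℕ}

/-- The initial velocity of the certified geodesic. -/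
noncomputable def initVec {ι : Type*} [Fintype ι] (x y : EuclideanSpace ℝ (Fin M))
    (S : Finset (Fin M)) (A B : ι → Finset (Fin M)) : EuclideanSpace ℝ (Fin M) :=
  WithLp.toLp 2 (glue S A B (fun e => y e - x e)
    (fun i e => -((‖proj (A i) x‖ + ‖proj (B i) y‖) / ‖proj (A i) x‖ * x e)) (fun _ _ => 0))

namespace IsCalibrated

variable {X : OrthantSpace M m} {ι : Type*} [Fintype ι] {x y : EuclideanSpace ℝ (Fin M)}
  {S : Finset (Fin M)} {A B : ι → Finset (Fin M)} (h : X.IsCalibrated x y S A B)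

include h

theorem initVec_of_mem {e : Fin M} (he : e ∈ S) : initVec x y S A B e = y e - x e := by
  simp only [initVec]
  rw [h.glue_of_mem _ _ _ he]

theorem initVec_of_mem_left {e : Fin M} {i : ι} (he : e ∈ A i) : initVec x y S A B e =
    -((‖proj (A i) x‖ + ‖proj (B i) y‖) / ‖proj (A i) x‖ * x e) := by
  simp only [initVec]
  rw [h.glue_of_mem_left _ _ _ he]

theorem initVec_of_mem_right {e : Fin M} {i : ι} (he : e ∈ B i) : initVec x y S A B e = 0 := by
  simp only [initVec]
  rw [h.glue_of_mem_right _ _ _ he]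

omit h in
theorem initVec_of_notMem {e : Fin M} (hS : e ∉ S) (hA : ∀ i, e ∉ A i) (hB : ∀ i, e ∉ B i) :
    initVec x y S A B e = 0 := by
  simp only [initVec]
  rw [glue_of_notMem _ _ _ hS hA hB]

/-- At the start only the A_i-part of each block moves, and it already has speed a_i + b_i. -/
theorem sum_sq_initVec : ∑ e, initVec x y S A B e ^ 2 = speedSq x y S A B := by
  have h1 : (fun e => initVec x y S A B e ^ 2) = glue S A B (fun e => (y e - x e) ^ 2)
      (fun i e => ((‖proj (A i) x‖ + ‖proj (B i) y‖) / ‖proj (A i) x‖) ^ 2 * x e ^ 2)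
      (fun i e => 0) := by
    refine h.eq_glue _ _ _ (fun e he => ?_) (fun i e he => ?_) (fun i e he => ?_)
      fun e h1 h2 h3 => ?_
    · rw [h.initVec_of_mem he]
    · rw [h.initVec_of_mem_left he]
      ring
    · rw [h.initVec_of_mem_right he]
      ring
    · rw [initVec_of_notMem h1 h2 h3]
      ring
  rw [h1, sum_glue]
  simp only [Finset.univ_inter, ← Finset.mul_sum, ← norm_sq_proj, Finset.sum_const_zero, add_zero]
  unfold speedSq
  congr 1
  refine Finset.sum_congr rfl fun i _ => ?_
  have ha := h.left_pos i
  rw [div_pow, div_mul_cancel₀ _ (by positivity)]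

/-- For small times all axes of each A_i are still present, which leaves no room for an axis of B_i.
The displacement then pairs with `initVec` as with `calVec`, and `displacement_eq` applies. -/
theorem geodesic_eventuallyEq {γ : ℝ → EuclideanSpace ℝ (Fin M)} (hγ : X.IsGeodesic x y γ) :
    γ =ᶠ[nhdsWithin 0 (Set.Icc 0 1)] fun t => x + t • initVec x y S A B := by
  have hc := hγ.continuousOn 0 (by simp)
  have hpos : ∀ᶠ t in nhdsWithin (0 : ℝ) (Set.Icc 0 1), ∀ e, 0 < x e → 0 < γ t e := by
    refine Filter.eventually_all.2 fun e => ?_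
    by_cases he : 0 < x e
    · have h1 : Filter.Tendsto (fun t => γ t e) (nhdsWithin 0 (Set.Icc 0 1))
          (nhds (γ 0 e)) :=
        ((EuclideanSpace.proj (𝕜 := ℝ) e).continuous.tendsto _).comp hc
      rw [hγ.source] at h1
      filter_upwards [h1.eventually (lt_mem_nhds he)] with t ht _ using ht
    · exact Filter.Eventually.of_forall fun t hx => absurd hx he
  filter_upwards [hpos, self_mem_nhdsWithin] with t hp ht
  have hB : ∀ i, ∀ e ∈ B i, γ t e = 0 := by
    intro i e he
    by_contra hne
    obtain ⟨h0, hf⟩ := mem_points_iff.1 (hγ.mem t ht)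
    -- With C = A_i the weight bound is exhausted, so no axis e of B_i, where y is positive, can be
    -- compatible with all of A_i.
    have hw := h.weight_le i (A i) subset_rfl {e} (by simpa) (by
      intro a ha f hf'
      rw [Finset.mem_singleton.1 hf']
      exact mem_faces_iff.1 hf a (mem_posAxes.2 (hp a (h.pos_left i a ha))) e
        (mem_posAxes.2 ((h0 e).lt_of_ne' hne)))
    have ha := h.left_pos i
    have hy : 0 < ‖proj {e} y‖ := norm_proj_pos (by simp) (by simpa using h.pos_right i e he)
    have : 0 < ‖proj {e} y‖ ^ 2 * ‖proj (A i) x‖ ^ 2 := by positivity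
    linarith
  have key := h.displacement_eq hγ le_rfl ht.1 ht.2 (w := initVec x y S A B)
    h.sum_sq_initVec.le (by
      refine Finset.sum_congr rfl fun e _ => ?_
      rcases block_cases (S := S) (A := A) (B := B) e with he | ⟨i, he⟩ | ⟨i, he⟩ | ⟨h1, h2, h3⟩
      · rw [h.initVec_of_mem he, h.calVec_of_mem he]
      · rw [h.initVec_of_mem_left he, h.calVec_of_mem_left he]
      · rw [hγ.source, hB i e he, h.left_eq_zero he]
        ring
      · rw [initVec_of_notMem h1 h2 h3, calVec_of_notMem h1 h2 h3])
  ext e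
  have := key e
  rw [hγ.source] at this
  simp only [PiLp.add_apply, PiLp.smul_apply, smul_eq_mul]
  linarith

theorem hasDerivWithinAt_geodesic {γ : ℝ → EuclideanSpace ℝ (Fin M)}
    (hγ : X.IsGeodesic x y γ) : HasDerivWithinAt γ (initVec x y S A B) (Set.Icc 0 1) 0 := by
  have h1 : HasDerivWithinAt (fun t : ℝ => x + t • initVec x y S A B) (initVec x y S A B)
      (Set.Icc 0 1) 0 := by
    simpa using (((hasDerivAt_id (0 : ℝ)).smul_const (initVec x y S A B)).const_add
      x).hasDerivWithinAt
  exact h1.congr_of_eventuallyEq (h.geodesic_eventuallyEq hγ) (by simp [hγ.source])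

/-- All geodesics from x to y have the same initial derivative, so the arbitrary choice in `logMap`
is harmless; `calPath` shows that there is something to choose. -/
theorem logMap_eq : X.logMap x y = initVec x y S A B := by
  obtain ⟨γ, hγ, hd⟩ := Classical.epsilon_spec (p := fun v => ∃ γ : ℝ → EuclideanSpace ℝ (Fin M),
    X.IsGeodesic x y γ ∧ HasDerivWithinAt γ v (Set.Icc 0 1) 0)
    ⟨_, _, h.isGeodesic_calPath, h.hasDerivWithinAt_geodesic h.isGeodesic_calPath⟩
  exact (uniqueDiffOn_Icc_zero_one 0 (by simp)).eq_deriv _ hd (h.hasDerivWithinAt_geodesic hγ)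

theorem translatedLog_of_mem {e : Fin M} (he : e ∈ S) : X.translatedLog y x e = y e := by
  simp [translatedLog, h.logMap_eq, h.initVec_of_mem he]

theorem translatedLog_of_mem_left {e : Fin M} {i : ι} (he : e ∈ A i) :
    X.translatedLog y x e = -(‖proj (B i) y‖ * (x e / ‖proj (A i) x‖)) := by
  have ha := h.left_pos i
  simp only [translatedLog, h.logMap_eq, PiLp.add_apply, h.initVec_of_mem_left he]
  field_simp
  ring

end IsCalibrated

end OrthantSpace

/-! ### Greedy decomposition by least weight ratio -/

/-- A decomposition of a pair of weighted finite sets into consecutive blocks `P i`, `Q i` of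
non-decreasing weight ratio `lam i`, such that no pair of mutually related subsets of a block
is heavier than the block. -/
structure IsRatioChain {V : Type*} (R : V → V → Prop) (α β : V → ℝ) (A B : Finset V)
    {k : ℕ} (P Q : Fin k → Finset V) (lam : Fin k → ℝ) : Prop where
  pos : ∀ i, 0 < lam i
  mono : Monotone lam
  nonempty_left : ∀ i, (P i).Nonempty
  nonempty_right : ∀ i, (Q i).Nonempty
  mem_left : ∀ a, a ∈ A ↔ ∃ i, a ∈ P i
  mem_right : ∀ b, b ∈ B ↔ ∃ i, b ∈ Q i
  disjoint_left : ∀ i j, i ≠ j → Disjoint (P i) (P j)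
  disjoint_right : ∀ i j, i ≠ j → Disjoint (Q i) (Q j)
  rel : ∀ i j, i < j → ∀ a ∈ P j, ∀ b ∈ Q i, R a b
  ratio : ∀ i, ∑ a ∈ P i, α a = lam i * ∑ b ∈ Q i, β b
  weight_le : ∀ i, ∀ C ⊆ P i, ∀ D ⊆ Q i, (∀ a ∈ C, ∀ b ∈ D, R a b) →
    ∑ a ∈ C, α a + lam i * ∑ b ∈ D, β b ≤ ∑ a ∈ P i, α a
  trivial_of_eq : ∀ i, ∀ C ⊆ P i, ∀ D ⊆ Q i, (∀ a ∈ C, ∀ b ∈ D, R a b) →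
    ∑ a ∈ C, α a + lam i * ∑ b ∈ D, β b = ∑ a ∈ P i, α a → C = ∅ ∨ D = ∅

/-- Among related pairs (C, D) with D non-empty, one minimising α(A \ C)/β(D) gives the first block
(A \ C, D); the rest (C, B \ D) is treated by induction. The last clause of the conclusion, a lower
bound for all ratios, is there for the induction: it makes the ratios monotone. -/
theorem exists_isRatioChain {V : Type*} [DecidableEq V] (R : V → V → Prop) (α β : V → ℝ)
    (A B : Finset V) (hα : ∀ a ∈ A, 0 < α a) (hβ : ∀ b ∈ B, 0 < β b)
    (hA : ∀ a ∈ A, ∃ b ∈ B, ¬ R a b) (hB : ∀ b ∈ B, ∃ a ∈ A, ¬ R a b) :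
    ∃ (k : ℕ) (P Q : Fin k → Finset V) (lam : Fin k → ℝ), IsRatioChain R α β A B P Q lam ∧
      ∀ μ : ℝ, (∀ C ⊆ A, ∀ D ⊆ B, D.Nonempty → (∀ a ∈ C, ∀ b ∈ D, R a b) →
        μ * ∑ b ∈ D, β b ≤ ∑ a ∈ A, α a - ∑ a ∈ C, α a) → ∀ i, μ ≤ lam i := by
  classical
  induction hn : B.card using Nat.strong_induction_on generalizing A B with
  | _ n ih =>
    rcases B.eq_empty_or_nonempty with rfl | hBne
    · have hA0 : A = ∅ := Finset.eq_empty_of_forall_notMem fun a ha => by simpa using hA a ha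
      subst hA0
      exact ⟨0, fun _ => ∅, fun _ => ∅, fun _ => 0,
        ⟨fun i => i.elim0, fun i => i.elim0, fun i => i.elim0, fun i => i.elim0, by simp, by simp,
          fun i => i.elim0, fun i => i.elim0, fun i => i.elim0, fun i => i.elim0,
          fun i => i.elim0, fun i => i.elim0⟩, fun _ _ i => i.elim0⟩
    have sumpos : ∀ D ⊆ B, D.Nonempty → 0 < ∑ b ∈ D, β b :=
      fun D hD hne => Finset.sum_pos (fun b hb => hβ b (hD hb)) hne
    -- Among minimisers of the ratio, D is taken of least cardinality. This second criterion is what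
    -- yields `trivial_of_eq`.
    obtain ⟨⟨C, D⟩, hmem, hmin⟩ := Finset.exists_min_image
      ((A.powerset ×ˢ B.powerset).filter fun p => p.2.Nonempty ∧ ∀ a ∈ p.1, ∀ b ∈ p.2, R a b)
      (fun p => toLex ((∑ a ∈ A, α a - ∑ a ∈ p.1, α a) / ∑ b ∈ p.2, β b, p.2.card))
      ⟨(∅, B), by simp [hBne]⟩
    simp only [Finset.mem_filter, Finset.mem_product, Finset.mem_powerset] at hmem
    obtain ⟨⟨hC, hD⟩, hDne, hR⟩ := hmem
    have hβD := sumpos D hD hDne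
    obtain ⟨ρ, hρ⟩ : ∃ ρ, ρ = (∑ a ∈ A, α a - ∑ a ∈ C, α a) / ∑ b ∈ D, β b := ⟨_, rfl⟩
    have hρD : ρ * ∑ b ∈ D, β b = ∑ a ∈ A, α a - ∑ a ∈ C, α a := by
      rw [hρ, div_mul_cancel₀ _ hβD.ne']
    have F : ∀ C' ⊆ A, ∀ D' ⊆ B, D'.Nonempty → (∀ a ∈ C', ∀ b ∈ D', R a b) →
        ρ * ∑ b ∈ D', β b ≤ ∑ a ∈ A, α a - ∑ a ∈ C', α a ∧
        (ρ * ∑ b ∈ D', β b = ∑ a ∈ A, α a - ∑ a ∈ C', α a → D.card ≤ D'.card) := by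
      intro C' hC' D' hD' hne' hR'
      have h1 := hmin (C', D') (by simp [hC', hD', hne']; exact hR')
      rw [Prod.Lex.toLex_le_toLex] at h1
      simp only [← hρ] at h1
      have hβ' := sumpos D' hD' hne'
      rw [lt_div_iff₀ hβ', eq_div_iff hβ'.ne'] at h1
      rcases h1 with h1 | h1
      · exact ⟨h1.le, fun h2 => absurd h2 h1.ne⟩
      · exact ⟨h1.1.le, fun _ => h1.2⟩
    have hsdiff : ∑ a ∈ A \ C, α a = ∑ a ∈ A, α a - ∑ a ∈ C, α a := by
      rw [← Finset.sum_sdiff hC, add_sub_cancel_right]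
    have hne : (A \ C).Nonempty := by
      obtain ⟨d, hd⟩ := hDne
      obtain ⟨a, ha, hda⟩ := hB d (hD hd)
      exact ⟨a, Finset.mem_sdiff.2 ⟨ha, fun haC => hda (hR a haC d hd)⟩⟩
    have hρpos : 0 < ρ := by
      rw [hρ, ← hsdiff]
      exact div_pos (Finset.sum_pos (fun a ha => hα a (Finset.mem_sdiff.1 ha).1) hne) hβD
    obtain ⟨k, P, Q, lam, hch, hlam⟩ := ih (B \ D).card
      (by
        rw [← hn]
        refine Finset.card_lt_card (Finset.sdiff_ssubset hD hDne)) C (B \ D)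
      (fun a ha => hα a (hC ha)) (fun b hb => hβ b (Finset.mem_sdiff.1 hb).1)
      (fun a ha => by
        obtain ⟨b, hb, hab⟩ := hA a (hC ha)
        exact ⟨b, Finset.mem_sdiff.2 ⟨hb, fun hbD => hab (hR a ha b hbD)⟩, hab⟩)
      (fun f hf => by
        obtain ⟨hfB, hfD⟩ := Finset.mem_sdiff.1 hf
        by_contra! hcon
        -- An element f related to all of C could be added to D, which would strictly lower the
        -- minimal ratio.
        have h1 := (F C hC (insert f D) (Finset.insert_subset hfB hD)
          (Finset.insert_nonempty _ _) (fun a ha b hb => by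
            rcases Finset.mem_insert.1 hb with rfl | hb
            · exact hcon a ha
            · exact hR a ha b hb)).1
        rw [Finset.sum_insert hfD, mul_add, hρD] at h1
        have := mul_pos hρpos (hβ f hfB)
        linarith) rfl
    have hle : ∀ i, ρ ≤ lam i := by
      -- A pair (C', D') of the remainder becomes the pair (C', D ∪ D') of the whole; subtracting
      -- the equality for (C, D) from its minimality bound gives the claim.
      refine hlam ρ fun C' hC' D' hD' hne' hR' => ?_
      have hdis : Disjoint D D' :=
        Finset.disjoint_left.2 fun b hb hb' => (Finset.mem_sdiff.1 (hD' hb')).2 hb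
      have h1 := (F C' (hC'.trans hC) (D ∪ D')
        (Finset.union_subset hD (hD'.trans Finset.sdiff_subset)) (hDne.mono
          Finset.subset_union_left) (fun a ha b hb => by
            rcases Finset.mem_union.1 hb with hb | hb
            · exact hR a (hC' ha) b hb
            · exact hR' a ha b hb)).1
      rw [Finset.sum_union hdis, mul_add, hρD] at h1
      linarith
    have hPC : ∀ i, ∀ a ∈ P i, a ∈ C := fun i a ha => (hch.mem_left a).2 ⟨i, ha⟩
    have hQD : ∀ i, ∀ b ∈ Q i, b ∈ B \ D := fun i b hb => (hch.mem_right b).2 ⟨i, hb⟩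
    -- A pair inside the first block is compared with the minimiser after adjoining C, which is
    -- related to all of D.
    have hw : ∀ C' ⊆ A \ C, ∀ D' ⊆ D, D'.Nonempty → (∀ a ∈ C', ∀ b ∈ D', R a b) →
        ∑ a ∈ C', α a + ρ * ∑ b ∈ D', β b ≤ ∑ a ∈ A \ C, α a ∧
        (∑ a ∈ C', α a + ρ * ∑ b ∈ D', β b = ∑ a ∈ A \ C, α a → D.card ≤ D'.card) := by
      intro C' hC' D' hD' hne' hR'
      have hdis : Disjoint C C' :=
        Finset.disjoint_left.2 fun b hb hb' => (Finset.mem_sdiff.1 (hC' hb')).2 hb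
      have h1 := F (C ∪ C') (Finset.union_subset hC (hC'.trans Finset.sdiff_subset)) D'
        (hD'.trans hD) hne' (fun a ha b hb => by
          rcases Finset.mem_union.1 ha with ha | ha
          · exact hR a ha b (hD' hb)
          · exact hR' a ha b hb)
      rw [Finset.sum_union hdis] at h1
      rw [hsdiff]
      exact ⟨by linarith [h1.1], fun h2 => h1.2 (by linarith)⟩
    refine ⟨k + 1, Fin.cons (A \ C) P, Fin.cons D Q, Fin.cons ρ lam, ⟨?_, ?_, ?_, ?_, ?_, ?_, ?_,
      ?_, ?_, ?_, ?_, ?_⟩, ?_⟩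
    · exact Fin.cases hρpos hch.pos
    · intro i j hij
      induction i using Fin.cases with
      | zero =>
        induction j using Fin.cases with
        | zero => exact le_rfl
        | succ j => exact hle j
      | succ i =>
        induction j using Fin.cases with
        | zero => exact absurd hij (by simp)
        | succ j => exact hch.mono (Fin.succ_le_succ_iff.1 hij)
    · exact Fin.cases hne hch.nonempty_left
    · exact Fin.cases hDne hch.nonempty_right
    · intro a
      simp only [Fin.exists_fin_succ, Fin.cons_zero, Fin.cons_succ, ← hch.mem_left,
        Finset.mem_sdiff]
      have := @hC a
      tauto
    · intro b
      simp only [Fin.exists_fin_succ, Fin.cons_zero, Fin.cons_succ, ← hch.mem_right,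
        Finset.mem_sdiff]
      have := @hD b
      tauto
    · have h0 : ∀ j, Disjoint (A \ C) (P j) := fun j =>
        Finset.disjoint_left.2 fun a ha ha' => (Finset.mem_sdiff.1 ha).2 (hPC j a ha')
      refine Fin.cases (Fin.cases (fun h => absurd rfl h) fun j _ => h0 j) fun i =>
        Fin.cases (fun _ => (h0 i).symm) fun j hij => ?_
      exact hch.disjoint_left i j fun h => hij (by rw [h])
    · have h0 : ∀ j, Disjoint D (Q j) := fun j =>
        Finset.disjoint_left.2 fun b hb hb' => (Finset.mem_sdiff.1 (hQD j b hb')).2 hb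
      refine Fin.cases (Fin.cases (fun h => absurd rfl h) fun j _ => h0 j) fun i =>
        Fin.cases (fun _ => (h0 i).symm) fun j hij => ?_
      exact hch.disjoint_right i j fun h => hij (by rw [h])
    · refine Fin.cases (Fin.cases (fun h => absurd h (lt_irrefl _)) fun j _ a ha b hb => ?_)
        fun i => Fin.cases (fun h => absurd h (by simp)) fun j hij => ?_
      · exact hR a (hPC j a ha) b hb
      · exact hch.rel i j (Fin.succ_lt_succ_iff.1 hij)
    · refine Fin.cases ?_ hch.ratio
      simp only [Fin.cons_zero]
      rw [hsdiff, hρD]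
    · refine Fin.cases (fun C' hC' D' hD' hR' => ?_) hch.weight_le
      rcases D'.eq_empty_or_nonempty with rfl | hne'
      · simpa using Finset.sum_le_sum_of_subset_of_nonneg hC' fun a ha _ =>
          (hα a (Finset.mem_sdiff.1 ha).1).le
      · exact (hw C' hC' D' hD' hne' hR').1
    · refine Fin.cases (fun C' hC' D' hD' hR' heq => ?_) hch.trivial_of_eq
      rcases D'.eq_empty_or_nonempty with rfl | hne'
      · exact Or.inr rfl
      · left
        have h1 := (hw C' hC' D' hD' hne' hR').2 heq
        have h2 : D' = D := Finset.eq_of_subset_of_card_le hD' h1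
        simp only [Fin.cons_zero] at heq
        rw [h2, hρD, hsdiff] at heq
        by_contra hne''
        have := Finset.sum_pos (fun a ha => hα a (Finset.mem_sdiff.1 (hC' ha)).1)
          (Finset.nonempty_iff_ne_empty.2 hne'')
        linarith
    · intro μ hμ
      have h0 : μ ≤ ρ := by
        rw [hρ, le_div_iff₀ hβD]
        exact hμ C hC D hD hDne hR
      exact Fin.cases h0 fun i => h0.trans (hle i)

/-! ### Break times, and supports from calibrated systems -/

theorem mem_carrierAxes {M k : ℕ} {A B : Fin (k + 1) → Finset (Fin M)} {i : Fin (k + 1)}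
    {e : Fin M} : e ∈ carrierAxes A B i ↔ (∃ j, j ≤ i ∧ e ∈ B j) ∨ ∃ j, i < j ∧ e ∈ A j := by
  simp [carrierAxes]

theorem mem_splitAxes {M k : ℕ} {A B : Fin (k + 1) → Finset (Fin M)} {i : Fin (k + 1)}
    {D C : Finset (Fin M)} {e : Fin M} : e ∈ splitAxes A B i D C ↔
      (∃ j, j < i ∧ e ∈ B j) ∨ e ∈ D ∨ e ∈ C ∨ ∃ j, i < j ∧ e ∈ A j := by
  simp [splitAxes]

/-- The time at which the certified geodesic leaves the axes of `A` and enters those of `B`. -/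
noncomputable def breakTime {M : ℕ} (x y : EuclideanSpace ℝ (Fin M)) (A B : Finset (Fin M)) : ℝ :=
  ‖proj A x‖ / (‖proj A x‖ + ‖proj B y‖)

namespace OrthantSpace

variable {M m : ℕ} {X : OrthantSpace M m} {x y : EuclideanSpace ℝ (Fin M)}
  {S : Finset (Fin M)}

namespace IsCalibrated

section BreakTime

variable {ι : Type*} {A B : ι → Finset (Fin M)} (h : X.IsCalibrated x y S A B)

include h

theorem breakTime_pos (i : ι) : 0 < breakTime x y (A i) (B i) :=
  div_pos (h.left_pos i) (add_pos (h.left_pos i) (h.right_pos i))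

theorem breakTime_lt_one (i : ι) : breakTime x y (A i) (B i) < 1 := by
  unfold breakTime
  rw [div_lt_one (add_pos (h.left_pos i) (h.right_pos i))]
  linarith [h.right_pos i]

theorem lt_breakTime_iff {s : ℝ} (i : ι) : s < breakTime x y (A i) (B i) ↔
    s * ‖proj (B i) y‖ < (1 - s) * ‖proj (A i) x‖ := by
  unfold breakTime
  rw [lt_div_iff₀ (add_pos (h.left_pos i) (h.right_pos i))]
  constructor <;> intro h1 <;> linarith

theorem breakTime_lt_iff {s : ℝ} (i : ι) : breakTime x y (A i) (B i) < s ↔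
    (1 - s) * ‖proj (A i) x‖ < s * ‖proj (B i) y‖ := by
  unfold breakTime
  rw [div_lt_iff₀ (add_pos (h.left_pos i) (h.right_pos i))]
  constructor <;> intro h1 <;> linarith

/-- This translates between break times and the norm ratios in which ties are expressed. -/
theorem eq_breakTime_iff {s : ℝ} (hs : s < 1) (i : ι) : breakTime x y (A i) (B i) = s ↔
    ‖proj (A i) x‖ / ‖proj (B i) y‖ = s / (1 - s) := by
  have h1 := h.left_pos i
  have h2 := h.right_pos i
  unfold breakTime
  rw [div_eq_iff (by positivity), div_eq_div_iff (by positivity) (by linarith)]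
  constructor <;> intro h1 <;> linarith

theorem calPath_pos_left [Fintype ι] {i : ι} {s : ℝ} (hs : s < breakTime x y (A i) (B i))
    {e : Fin M} (he : e ∈ A i) : 0 < calPath x y S A B s e := by
  rw [h.calPath_of_mem_left he]
  have := (h.lt_breakTime_iff i).1 hs
  exact mul_pos (div_pos (lt_max_of_lt_right (by linarith)) (h.left_pos i)) (h.pos_left i e he)

theorem calPath_pos_right [Fintype ι] {i : ι} {s : ℝ} (hs : breakTime x y (A i) (B i) < s)
    {e : Fin M} (he : e ∈ B i) : 0 < calPath x y S A B s e := by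
  rw [h.calPath_of_mem_right he]
  have := (h.breakTime_lt_iff i).1 hs
  exact mul_pos (div_pos (lt_max_of_lt_right (by linarith)) (h.right_pos i)) (h.pos_right i e he)

theorem lt_breakTime_of_pos_left [Fintype ι] {i : ι} {s : ℝ} {e : Fin M} (he : e ∈ A i)
    (hp : 0 < calPath x y S A B s e) : s < breakTime x y (A i) (B i) := by
  rw [h.lt_breakTime_iff]
  by_contra hcon
  rw [h.calPath_of_mem_left he, max_eq_left (by linarith)] at hp
  simp at hp

theorem breakTime_lt_of_pos_right [Fintype ι] {i : ι} {s : ℝ} {e : Fin M} (he : e ∈ B i)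
    (hp : 0 < calPath x y S A B s e) : breakTime x y (A i) (B i) < s := by
  rw [h.breakTime_lt_iff]
  by_contra hcon
  rw [h.calPath_of_mem_right he, max_eq_left (by linarith)] at hp
  simp at hp

end BreakTime

variable {n : ℕ} {P Q : Fin n → Finset (Fin M)} (h : X.IsCalibrated x y S P Q)

include h

/-- Merging the blocks with equal break times turns a calibrated system into the support of the
certified geodesic. -/
theorem exists_isSupport (hS : ∀ e ∈ S, 0 < x e ∨ 0 < y e)
    (hmono : Monotone fun i => breakTime x y (P i) (Q i))
    (hrel : ∀ i j, i < j → ∀ e ∈ P j, ∀ f ∈ Q i, X.Compat e f) :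
    ∃ (k : ℕ) (A B : Fin (k + 1) → Finset (Fin M)), X.IsSupport x y A B ∧
      X.IsTieRefinement x y A B (Fin.cons S P : Fin (n + 1) → Finset (Fin M)) (Fin.cons S Q) := by
  classical
  obtain ⟨τ, hτ⟩ : ∃ τ : Fin n → ℝ, τ = fun i => breakTime x y (P i) (Q i) := ⟨_, rfl⟩
  have hτ' : ∀ i, breakTime x y (P i) (Q i) = τ i := fun i => by rw [hτ]
  have hτ0 : ∀ i, 0 < τ i := fun i => by rw [← hτ']; exact h.breakTime_pos i
  have hτ1 : ∀ i, τ i < 1 := fun i => by rw [← hτ']; exact h.breakTime_lt_one i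
  rw [← hτ] at hmono
  obtain ⟨k, hk⟩ : ∃ k, k = (Finset.univ.image τ).card := ⟨_, rfl⟩
  -- The k distinct break times lie strictly between 0 and 1; together with the endpoints, listed
  -- increasingly, they are the k + 2 times required of a support.
  obtain ⟨T, hT⟩ : ∃ T : Finset ℝ, T = insert 0 (insert 1 (Finset.univ.image τ)) := ⟨_, rfl⟩
  have hmemT : ∀ r, r ∈ T ↔ r = 0 ∨ r = 1 ∨ ∃ i, τ i = r := fun r => by simp [hT]
  have hcard : T.card = k + 2 := by
    rw [hT, Finset.card_insert_of_notMem, Finset.card_insert_of_notMem, hk]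
    · simpa using fun i => (hτ1 i).ne
    · simpa using fun i => (hτ0 i).ne'
  have hT01 : ∀ r ∈ T, 0 ≤ r ∧ r ≤ 1 := by
    intro r hr
    rcases (hmemT r).1 hr with rfl | rfl | ⟨i, rfl⟩
    · simp
    · simp
    · exact ⟨(hτ0 i).le, (hτ1 i).le⟩
  obtain ⟨t, ht⟩ : ∃ t : Fin (k + 2) → ℝ, t = T.orderEmbOfFin hcard := ⟨_, rfl⟩
  have htmono : StrictMono t := ht ▸ (T.orderEmbOfFin hcard).strictMono
  have htT : ∀ i, t i ∈ T := fun i => ht ▸ T.orderEmbOfFin_mem hcard i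
  have htsurj : ∀ r ∈ T, ∃ i, t i = r := by
    intro r hr
    have : r ∈ Set.range (T.orderEmbOfFin hcard) := by rwa [Finset.range_orderEmbOfFin]
    rwa [ht]
  have ht0 : t 0 = 0 := by
    obtain ⟨i, hi⟩ := htsurj 0 ((hmemT 0).2 (Or.inl rfl))
    exact le_antisymm (hi ▸ htmono.monotone (Fin.zero_le i)) (hT01 _ (htT 0)).1
  have ht1 : t (Fin.last (k + 1)) = 1 := by
    obtain ⟨i, hi⟩ := htsurj 1 ((hmemT 1).2 (Or.inr (Or.inl rfl)))
    exact le_antisymm (hT01 _ (htT _)).2 (hi ▸ htmono.monotone (Fin.le_last i))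
  have hidx : ∀ j, ∃ i : Fin (k + 1), t i.castSucc = τ j := by
    intro j
    obtain ⟨i, hi⟩ := htsurj (τ j) ((hmemT _).2 (Or.inr (Or.inr ⟨j, rfl⟩)))
    have hne : i ≠ Fin.last (k + 1) := by
      rintro rfl
      rw [ht1] at hi
      exact (hτ1 j).ne' hi
    exact ⟨i.castPred hne, by simpa using hi⟩
  choose idx hidx using hidx
  have hidx0 : ∀ j, idx j ≠ 0 := by
    intro j h0
    have := hidx j
    rw [h0, Fin.castSucc_zero, ht0] at this
    exact (hτ0 j).ne this
  have hlevel : ∀ i : Fin (k + 1), i ≠ 0 → ∃ j, idx j = i := by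
    intro i hi
    rcases (hmemT _).1 (htT i.castSucc) with h1 | h1 | ⟨j, hj⟩
    · rw [← ht0] at h1
      exact absurd (Fin.castSucc_injective _ (htmono.injective h1)) hi
    · rw [← ht1] at h1
      exact absurd (htmono.injective h1) (Fin.castSucc_lt_last i).ne
    · refine ⟨j, Fin.castSucc_injective _ (htmono.injective ?_)⟩
      rw [hidx, hj]
  have hidxle : ∀ j j', idx j ≤ idx j' ↔ τ j ≤ τ j' := by
    intro j j'
    rw [← hidx, ← hidx, htmono.le_iff_le, Fin.castSucc_le_castSucc_iff]
  -- The index 0 stands for the common axes; any other block goes to the position of its break time.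
  let φ : Fin (n + 1) → Fin (k + 1) := Fin.cons 0 idx
  let A : Fin (k + 1) → Finset (Fin M) := fun i =>
    (Finset.univ.filter fun j => φ j = i).biUnion (Fin.cons S P : Fin (n + 1) → Finset (Fin M))
  let B : Fin (k + 1) → Finset (Fin M) := fun i =>
    (Finset.univ.filter fun j => φ j = i).biUnion (Fin.cons S Q : Fin (n + 1) → Finset (Fin M))
  have memA : ∀ i e, e ∈ A i ↔ (i = 0 ∧ e ∈ S) ∨ ∃ j, idx j = i ∧ e ∈ P j := by
    intro i e
    simp [A, φ, Fin.exists_fin_succ, eq_comm]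
  have memB : ∀ i e, e ∈ B i ↔ (i = 0 ∧ e ∈ S) ∨ ∃ j, idx j = i ∧ e ∈ Q j := by
    intro i e
    simp [B, φ, Fin.exists_fin_succ, eq_comm]
  have hdisA : ∀ i j, i ≠ j → Disjoint (A i) (A j) := by
    refine fun i j hij => Finset.disjoint_left.2 fun e he he' => ?_
    rcases (memA i e).1 he with ⟨h1, h2⟩ | ⟨a, h1, h2⟩ <;>
      rcases (memA j e).1 he' with ⟨h3, h4⟩ | ⟨b, h3, h4⟩
    · exact hij (h1.trans h3.symm)
    · exact Finset.disjoint_left.1 (h.disjoint_left b) h2 h4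
    · exact Finset.disjoint_left.1 (h.disjoint_left a) h4 h2
    · refine Finset.disjoint_left.1 (h.pairwise_left a b ?_) h2 h4
      rintro rfl
      exact hij (h1.symm.trans h3)
  have hdisB : ∀ i j, i ≠ j → Disjoint (B i) (B j) := by
    refine fun i j hij => Finset.disjoint_left.2 fun e he he' => ?_
    rcases (memB i e).1 he with ⟨h1, h2⟩ | ⟨a, h1, h2⟩ <;>
      rcases (memB j e).1 he' with ⟨h3, h4⟩ | ⟨b, h3, h4⟩
    · exact hij (h1.trans h3.symm)
    · exact Finset.disjoint_left.1 (h.disjoint_right b) h2 h4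
    · exact Finset.disjoint_left.1 (h.disjoint_right a) h4 h2
    · refine Finset.disjoint_left.1 (h.pairwise_right a b ?_) h2 h4
      rintro rfl
      exact hij (h1.symm.trans h3)
  refine ⟨k, A, B, ⟨?_, ?_, ?_, hdisA, hdisB, ?_, ?_⟩, ⟨?_, ?_, ?_, ?_, ?_, ?_⟩⟩
  · ext e
    rw [memA, memB]
    simp [hidx0]
  · intro i hi
    obtain ⟨j, hj⟩ := hlevel i hi
    obtain ⟨e, he⟩ := h.nonempty_left j
    exact ⟨e, (memA i e).2 (Or.inr ⟨j, hj, he⟩)⟩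
  · intro i hi
    obtain ⟨j, hj⟩ := hlevel i hi
    obtain ⟨e, he⟩ := h.nonempty_right j
    exact ⟨e, (memB i e).2 (Or.inr ⟨j, hj, he⟩)⟩
  · refine fun i j hi hj => Finset.disjoint_left.2 fun e he he' => ?_
    obtain ⟨a, -, h2⟩ := ((memA i e).1 he).resolve_left fun h0 => hi h0.1
    obtain ⟨b, -, h4⟩ := ((memB j e).1 he').resolve_left fun h0 => hj h0.1
    exact Finset.disjoint_left.1 (h.disjoint_left_right a b) h2 h4
  · refine ⟨_, t, h.isGeodesic_calPath, htmono, ht0, ht1, fun i s hs => ?_⟩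
    have hs0 : 0 < s := (hT01 _ (htT _)).1.trans_lt hs.1
    have hs1 : s < 1 := hs.2.trans_le (hT01 _ (htT _)).2
    have hlow : ∀ j : Fin (k + 1), j ≤ i → t j.castSucc < s := fun j hj =>
      (htmono.monotone (Fin.castSucc_le_castSucc_iff.2 hj)).trans_lt hs.1
    have hup : ∀ j : Fin (k + 1), i < j → s < t j.castSucc := fun j hj =>
      hs.2.trans_le (htmono.monotone (Fin.succ_le_castSucc_iff.2 hj))
    constructor
    · have hSpos : ∀ e ∈ S, 0 < calPath x y S P Q s e := by
        intro e he
        rw [h.calPath_of_mem he]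
        have h1 := mul_nonneg (sub_pos.2 hs1).le (h.nonneg_left e)
        have h2 := mul_nonneg hs0.le (h.nonneg_right e)
        rcases hS e he with h3 | h3
        · linarith [mul_pos (sub_pos.2 hs1) h3]
        · linarith [mul_pos hs0 h3]
      intro e he
      rcases mem_carrierAxes.1 he with ⟨j, hj, he⟩ | ⟨j, hj, he⟩
      · rcases (memB j e).1 he with ⟨-, he⟩ | ⟨a, ha, he⟩
        · exact hSpos e he
        · refine h.calPath_pos_right ?_ he
          rw [hτ', ← hidx, ha]
          exact hlow j hj
      · rcases (memA j e).1 he with ⟨-, he⟩ | ⟨a, ha, he⟩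
        · exact hSpos e he
        · refine h.calPath_pos_left ?_ he
          rw [hτ', ← hidx, ha]
          exact hup j hj
    · intro e he
      by_contra hne
      have hpos := (h.calPath_nonneg ⟨hs0.le, hs1.le⟩ e).lt_of_ne' hne
      refine he (mem_carrierAxes.2 ?_)
      rcases block_cases (S := S) (A := P) (B := Q) e with h1 | ⟨a, h1⟩ | ⟨a, h1⟩ | ⟨h1, h2, h3⟩
      · exact Or.inl ⟨0, Fin.zero_le _, (memB 0 e).2 (Or.inl ⟨rfl, h1⟩)⟩
      · refine Or.inr ⟨idx a, ?_, (memA _ e).2 (Or.inr ⟨a, rfl, h1⟩)⟩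
        have h2 := h.lt_breakTime_of_pos_left h1 hpos
        rw [hτ', ← hidx] at h2
        by_contra hcon
        exact (h2.trans (hlow _ (not_lt.1 hcon))).false
      · refine Or.inl ⟨idx a, ?_, (memB _ e).2 (Or.inr ⟨a, rfl, h1⟩)⟩
        have h2 := h.breakTime_lt_of_pos_right h1 hpos
        rw [hτ', ← hidx] at h2
        by_contra hcon
        exact (h2.trans (hup _ (not_le.1 hcon))).false
      · exact absurd (calPath_of_notMem h1 h2 h3) hne
  · exact Fin.cases (fun h0 => absurd rfl h0) fun j _ => h.nonempty_left j
  · exact Fin.cases (fun h0 => absurd rfl h0) fun j _ => h.nonempty_right j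
  · refine Fin.cases (Fin.cases (fun h0 => absurd rfl h0) fun j _ => h.disjoint_left j) fun i =>
      Fin.cases (fun _ => (h.disjoint_left i).symm) fun j hij => ?_
    exact h.pairwise_left i j fun h0 => hij (by rw [h0])
  · refine Fin.cases (Fin.cases (fun h0 => absurd rfl h0) fun j _ => h.disjoint_right j) fun i =>
      Fin.cases (fun _ => (h.disjoint_right i).symm) fun j hij => ?_
    exact h.pairwise_right i j fun h0 => hij (by rw [h0])
  · have hA' : ∀ (j : Fin (n + 1)) (e : Fin M),
        e ∈ (Fin.cons S P : Fin (n + 1) → Finset (Fin M)) j → e ∈ S ∨ ∃ i, e ∈ P i :=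
      fun j => Fin.cases (fun e he => Or.inl he) (fun i e he => Or.inr ⟨i, he⟩) j
    have hB' : ∀ (j : Fin (n + 1)) (e : Fin M),
        e ∈ (Fin.cons S Q : Fin (n + 1) → Finset (Fin M)) j → e ∈ S ∨ ∃ i, e ∈ Q i :=
      fun j => Fin.cases (fun e he => Or.inl he) (fun i e he => Or.inr ⟨i, he⟩) j
    have hc : ∀ (i j : Fin (n + 1)) (e f : Fin M), i < j →
        e ∈ (Fin.cons S P : Fin (n + 1) → Finset (Fin M)) j →
        f ∈ (Fin.cons S Q : Fin (n + 1) → Finset (Fin M)) i → X.Compat e f := by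
      intro i j e f hij he hf
      induction j using Fin.cases with
      | zero => exact absurd hij (by simp)
      | succ j =>
        induction i using Fin.cases with
        | zero => exact h.compat_left e f (Or.inr ⟨j, he⟩) (Or.inl hf)
        | succ i => exact hrel i j (Fin.succ_lt_succ_iff.1 hij) e he f hf
    refine fun j => mem_faces_iff.2 fun e he f hf => ?_
    rcases mem_carrierAxes.1 he with ⟨a, ha, he⟩ | ⟨a, ha, he⟩ <;>
      rcases mem_carrierAxes.1 hf with ⟨b, hb, hf⟩ | ⟨b, hb, hf⟩
    · exact h.compat_right e f (hB' a e he) (hB' b f hf)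
    · exact (hc a b f e (ha.trans_lt hb) hf he).symm
    · exact hc b a e f (hb.trans_lt ha) he hf
    · exact h.compat_left e f (hA' a e he) (hA' b f hf)
  · refine ⟨φ, ?_, ?_, fun _ => rfl, fun _ => rfl, ?_⟩
    · refine fun i j => ?_
      induction i using Fin.cases with
      | zero => exact fun _ => Fin.zero_le _
      | succ i =>
        induction j using Fin.cases with
        | zero => exact fun hij => absurd hij (by simp)
        | succ j => exact fun hij => (hidxle i j).2 (hmono (Fin.succ_le_succ_iff.1 hij))
    · exact Fin.cases (by simp [φ]) fun j => by simpa [φ] using hidx0 j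
    · refine fun i j => ?_
      induction i using Fin.cases with
      | zero => exact fun h0 => absurd rfl h0
      | succ i =>
        induction j using Fin.cases with
        | zero => exact fun _ hij => absurd hij (hidx0 i)
        | succ j =>
          intro _ hij
          have h1 : τ i = τ j := by
            rw [← hidx, ← hidx]
            exact congrArg (fun r : Fin (k + 1) => t r.castSucc) hij
          simp only [Fin.cons_succ]
          rw [(h.eq_breakTime_iff (hτ1 j) i).1 (by rw [hτ', h1]),
            (h.eq_breakTime_iff (hτ1 j) j).1 (hτ' j)]

/-- A pair of sequences without heavy proper pairs of compatible subsets has no ties. -/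
theorem tieFree (hs : ∀ i, ∀ C ⊆ P i, ∀ D ⊆ Q i, (∀ e ∈ C, ∀ f ∈ D, X.Compat e f) →
    ‖proj C x‖ ^ 2 * ‖proj (Q i) y‖ ^ 2 + ‖proj D y‖ ^ 2 * ‖proj (P i) x‖ ^ 2 =
      ‖proj (P i) x‖ ^ 2 * ‖proj (Q i) y‖ ^ 2 → C = ∅ ∨ D = ∅) :
    X.TieFree x y (Fin.cons S P : Fin (n + 1) → Finset (Fin M)) (Fin.cons S Q) := by
  intro i C₁ C₂ D₁ D₂ ht
  induction i using Fin.cases with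
  | zero => exact ht.index_ne rfl
  | succ i =>
    have hC := ht.union_C
    have hD := ht.union_D
    simp only [Fin.cons_succ] at hC hD
    -- The orthant of a tie makes C₂ and D₁ compatible, and the equality of ratios makes this pair
    -- exactly as heavy as the block, which is excluded.
    have hd1 : 0 < ‖proj D₁ y‖ := norm_proj_pos ht.nonempty_D₁ fun e he =>
      h.pos_right i e (hD ▸ Finset.mem_union_left _ he)
    have hd2 : 0 < ‖proj D₂ y‖ := norm_proj_pos ht.nonempty_D₂ fun e he =>
      h.pos_right i e (hD ▸ Finset.mem_union_right _ he)
    have hr := ht.ratio_eq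
    obtain ⟨r, hr1⟩ : ∃ r, r = ‖proj C₂ x‖ / ‖proj D₂ y‖ := ⟨_, rfl⟩
    rw [← hr1, div_eq_iff hd1.ne'] at hr
    rw [eq_div_iff hd2.ne'] at hr1
    have h1 : ‖proj (P i) x‖ ^ 2 = ‖proj C₁ x‖ ^ 2 + ‖proj C₂ x‖ ^ 2 := by
      rw [norm_sq_proj, norm_sq_proj, norm_sq_proj, ← hC, Finset.sum_union ht.disjoint_C]
    have h2 : ‖proj (Q i) y‖ ^ 2 = ‖proj D₁ y‖ ^ 2 + ‖proj D₂ y‖ ^ 2 := by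
      rw [norm_sq_proj, norm_sq_proj, norm_sq_proj, ← hD, Finset.sum_union ht.disjoint_D]
    rcases hs i C₂ (hC ▸ Finset.subset_union_right) D₁ (hD ▸ Finset.subset_union_left)
      (fun e he f hf => mem_faces_iff.1 ht.mem_faces e
        (mem_splitAxes.2 (Or.inr (Or.inr (Or.inl he)))) f
        (mem_splitAxes.2 (Or.inr (Or.inl hf)))) (by
        rw [h1, h2, hr, ← hr1]
        ring) with h0 | h0
    · exact ht.nonempty_C₂.ne_empty h0
    · exact ht.nonempty_D₁.ne_empty h0

end IsCalibrated

/-- The ratio chain is applied with squared coordinates as weights, so `lam i` is the square of the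
norm ratio. The axes outside `S` have an incompatible partner on the other side, as the chain
requires. -/
theorem exists_isCalibrated (hx : x ∈ X.points) (hy : y ∈ X.points) :
    ∃ (n : ℕ) (S : Finset (Fin M)) (P Q : Fin n → Finset (Fin M)), X.IsCalibrated x y S P Q ∧
      (∀ e ∈ S, 0 < x e ∨ 0 < y e) ∧ Monotone (fun i => breakTime x y (P i) (Q i)) ∧
      (∀ i j, i < j → ∀ e ∈ P j, ∀ f ∈ Q i, X.Compat e f) ∧
      ∀ i, ∀ C ⊆ P i, ∀ D ⊆ Q i, (∀ e ∈ C, ∀ f ∈ D, X.Compat e f) →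
        ‖proj C x‖ ^ 2 * ‖proj (Q i) y‖ ^ 2 + ‖proj D y‖ ^ 2 * ‖proj (P i) x‖ ^ 2 =
          ‖proj (P i) x‖ ^ 2 * ‖proj (Q i) y‖ ^ 2 → C = ∅ ∨ D = ∅ := by
  classical
  obtain ⟨hx0, hxf⟩ := mem_points_iff.1 hx
  obtain ⟨hy0, hyf⟩ := mem_points_iff.1 hy
  rw [mem_faces_iff] at hxf hyf
  simp only [mem_posAxes] at hxf hyf
  -- Axes of x or y compatible with all axes of both. These include the axes on which both points
  -- are positive, so the remaining axes of x and of y are disjoint.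
  let S : Finset (Fin M) := Finset.univ.filter fun e =>
    (0 < x e ∨ 0 < y e) ∧ ∀ f, (0 < x f ∨ 0 < y f) → X.Compat e f
  have memS : ∀ e, e ∈ S ↔ (0 < x e ∨ 0 < y e) ∧ ∀ f, (0 < x f ∨ 0 < y f) → X.Compat e f :=
    fun e => by simp [S]
  have memA : ∀ e, e ∈ posAxes x \ S ↔ 0 < x e ∧ e ∉ S := fun e => by
    rw [Finset.mem_sdiff, mem_posAxes]
  have memB : ∀ e, e ∈ posAxes y \ S ↔ 0 < y e ∧ e ∉ S := fun e => by
    rw [Finset.mem_sdiff, mem_posAxes]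
  obtain ⟨n, P, Q, lam, hch, -⟩ := exists_isRatioChain X.Compat (fun e => x e ^ 2)
    (fun e => y e ^ 2) (posAxes x \ S) (posAxes y \ S)
    (fun e he => pow_pos ((memA e).1 he).1 2) (fun e he => pow_pos ((memB e).1 he).1 2)
    (fun e he => by
      obtain ⟨h1, h2⟩ := (memA e).1 he
      rw [memS] at h2
      push Not at h2
      obtain ⟨f, hf, hef⟩ := h2 (Or.inl h1)
      rcases hf with hf | hf
      · exact absurd (hxf e h1 f hf) hef
      · exact ⟨f, (memB f).2 ⟨hf, fun hfS => hef (((memS f).1 hfS).2 e (Or.inl h1)).symm⟩, hef⟩)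
    (fun e he => by
      obtain ⟨h1, h2⟩ := (memB e).1 he
      rw [memS] at h2
      push Not at h2
      obtain ⟨f, hf, hef⟩ := h2 (Or.inr h1)
      rcases hf with hf | hf
      · exact ⟨f, (memA f).2 ⟨hf, fun hfS => hef (((memS f).1 hfS).2 e (Or.inr h1)).symm⟩,
          fun h3 => hef h3.symm⟩
      · exact absurd (hyf e h1 f hf) hef)
  have hP : ∀ i, ∀ e ∈ P i, 0 < x e ∧ e ∉ S := fun i e he =>
    (memA e).1 ((hch.mem_left e).2 ⟨i, he⟩)
  have hQ : ∀ i, ∀ e ∈ Q i, 0 < y e ∧ e ∉ S := fun i e he =>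
    (memB e).1 ((hch.mem_right e).2 ⟨i, he⟩)
  have ha : ∀ i, 0 < ‖proj (P i) x‖ := fun i =>
    norm_proj_pos (hch.nonempty_left i) fun e he => (hP i e he).1
  have hb : ∀ i, 0 < ‖proj (Q i) y‖ := fun i =>
    norm_proj_pos (hch.nonempty_right i) fun e he => (hQ i e he).1
  have hratio : ∀ i, ‖proj (P i) x‖ ^ 2 = lam i * ‖proj (Q i) y‖ ^ 2 := fun i => by
    rw [norm_sq_proj, norm_sq_proj]
    exact hch.ratio i
  have hle : ∀ i j, i ≤ j →
      ‖proj (P i) x‖ * ‖proj (Q j) y‖ ≤ ‖proj (P j) x‖ * ‖proj (Q i) y‖ := by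
    intro i j hij
    refine (pow_le_pow_iff_left₀ (mul_nonneg (ha i).le (hb j).le)
      (mul_nonneg (ha j).le (hb i).le) two_ne_zero).1 ?_
    rw [mul_pow, mul_pow, hratio i, hratio j]
    have h1 := mul_le_mul_of_nonneg_right (hch.mono hij)
      (mul_nonneg (sq_nonneg ‖proj (Q i) y‖) (sq_nonneg ‖proj (Q j) y‖))
    linarith
  have hxy : ∀ e, 0 < x e → 0 < y e → e ∈ S := by
    refine fun e h1 h2 => (memS e).2 ⟨Or.inl h1, fun f hf => ?_⟩
    exact hf.elim (hxf e h1 f) (hyf e h2 f)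
  have hcl : ∀ e, (e ∈ S ∨ ∃ i, e ∈ P i) → e ∈ S ∨ 0 < x e := fun e he =>
    he.imp id fun ⟨i, hi⟩ => (hP i e hi).1
  have hcr : ∀ e, (e ∈ S ∨ ∃ i, e ∈ Q i) → e ∈ S ∨ 0 < y e := fun e he =>
    he.imp id fun ⟨i, hi⟩ => (hQ i e hi).1
  refine ⟨n, S, P, Q, ⟨hx0, hy0, hch.nonempty_left, hch.nonempty_right, fun i e he => (hP i e he).1,
    fun i e he => (hQ i e he).1, ?_, ?_, ?_, ?_, hch.disjoint_left, hch.disjoint_right, ?_, ?_, ?_,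
    ?_, ?_⟩, fun e he => ((memS e).1 he).1, ?_, hch.rel, ?_⟩
  · intro e he
    by_cases h1 : e ∈ S
    · exact Or.inl h1
    · exact Or.inr ((hch.mem_left e).1 ((memA e).2 ⟨he, h1⟩))
  · intro e he
    by_cases h1 : e ∈ S
    · exact Or.inl h1
    · exact Or.inr ((hch.mem_right e).1 ((memB e).2 ⟨he, h1⟩))
  · exact fun i => Finset.disjoint_right.2 fun e he => (hP i e he).2
  · exact fun i => Finset.disjoint_right.2 fun e he => (hQ i e he).2
  · exact fun i j => Finset.disjoint_left.2 fun e he he' =>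
      (hP i e he).2 (hxy e (hP i e he).1 (hQ j e he').1)
  · intro e f he hf
    rcases hcl e he with he | he
    · refine ((memS e).1 he).2 f ?_
      rcases hcl f hf with hf | hf
      · exact ((memS f).1 hf).1
      · exact Or.inl hf
    · rcases hcl f hf with hf | hf
      · exact (((memS f).1 hf).2 e (Or.inl he)).symm
      · exact hxf e he f hf
  · intro e f he hf
    rcases hcr e he with he | he
    · refine ((memS e).1 he).2 f ?_
      rcases hcr f hf with hf | hf
      · exact ((memS f).1 hf).1
      · exact Or.inr hf
    · rcases hcr f hf with hf | hf
      · exact (((memS f).1 hf).2 e (Or.inr he)).symm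
      · exact hyf e he f hf
  · intro i j hij
    rw [div_lt_div_iff₀ (hb j) (hb i)] at hij
    refine hch.rel j i ?_
    by_contra hcon
    have := hle i j (not_lt.1 hcon)
    linarith
  · intro i C hC D hD hR
    have h1 := hch.weight_le i C hC D hD hR
    rw [← norm_sq_proj, ← norm_sq_proj, ← norm_sq_proj] at h1
    have h2 := mul_le_mul_of_nonneg_right h1 (sq_nonneg ‖proj (Q i) y‖)
    have h3 := congrArg (fun r => ‖proj D y‖ ^ 2 * r) (hratio i)
    linarith
  · intro i j hij
    have h1 := hle i j hij
    have h2 := ha i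
    have h3 := ha j
    have h4 := hb i
    have h5 := hb j
    simp only [breakTime]
    rw [div_le_div_iff₀ (by positivity) (by positivity)]
    linarith
  · intro i C hC D hD hR heq
    refine hch.trivial_of_eq i C hC D hD hR ?_
    rw [← norm_sq_proj, ← norm_sq_proj, ← norm_sq_proj]
    refine mul_right_cancel₀ (pow_ne_zero 2 (hb i).ne') ?_
    have h3 := congrArg (fun r => ‖proj D y‖ ^ 2 * r) (hratio i)
    linarith

end OrthantSpace

/-! ### Every support is a calibrated system -/

theorem norm_sq_proj_eq_sum_inter {M : ℕ} {ι : Type*} {J : Finset ι} {P : ι → Finset (Fin M)}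
    (hP : ∀ i j, i ≠ j → Disjoint (P i) (P j)) {C : Finset (Fin M)} (hC : C ⊆ J.biUnion P)
    (x : EuclideanSpace ℝ (Fin M)) :
    ‖proj C x‖ ^ 2 = ∑ j ∈ J, ‖proj (C ∩ P j) x‖ ^ 2 := by
  simp only [norm_sq_proj]
  rw [← Finset.sum_biUnion fun i _ j _ hij =>
    (hP i j hij).mono Finset.inter_subset_right Finset.inter_subset_right]
  refine Finset.sum_congr ?_ fun _ _ => rfl
  rw [← Finset.inter_biUnion, Finset.inter_eq_left.2 hC]

theorem norm_proj_biUnion {M : ℕ} {ι : Type*} {J : Finset ι} {P Q : ι → Finset (Fin M)}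
    (hP : ∀ i j, i ≠ j → Disjoint (P i) (P j)) (hQ : ∀ i j, i ≠ j → Disjoint (Q i) (Q j))
    {x y : EuclideanSpace ℝ (Fin M)} {r : ℝ} (hr : 0 ≤ r)
    (hJ : ∀ j ∈ J, ‖proj (P j) x‖ = r * ‖proj (Q j) y‖) :
    ‖proj (J.biUnion P) x‖ = r * ‖proj (J.biUnion Q) y‖ := by
  refine (pow_left_inj₀ (norm_nonneg _) (mul_nonneg hr (norm_nonneg _)) two_ne_zero).1 ?_
  rw [mul_pow, norm_sq_proj_eq_sum_inter hP subset_rfl, norm_sq_proj_eq_sum_inter hQ subset_rfl,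
    Finset.mul_sum]
  refine Finset.sum_congr rfl fun j hj => ?_
  rw [Finset.inter_eq_right.2 (Finset.subset_biUnion_of_mem P hj),
    Finset.inter_eq_right.2 (Finset.subset_biUnion_of_mem Q hj), hJ j hj, mul_pow]

theorem norm_sq_proj_union {M : ℕ} {C D : Finset (Fin M)} (h : Disjoint C D)
    (x : EuclideanSpace ℝ (Fin M)) :
    ‖proj (C ∪ D) x‖ ^ 2 = ‖proj C x‖ ^ 2 + ‖proj D x‖ ^ 2 := by
  rw [norm_sq_proj, norm_sq_proj, norm_sq_proj, Finset.sum_union h]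

namespace OrthantSpace

variable {M m : ℕ} {X : OrthantSpace M m} {x y : EuclideanSpace ℝ (Fin M)}

namespace IsCalibrated

variable {ι : Type*} {S : Finset (Fin M)} {P Q : ι → Finset (Fin M)}
  (h : X.IsCalibrated x y S P Q) {J : Finset ι} {r : ℝ}

include h

/-- With a common ratio r the block inequalities carry the same factor r², so they can be added. -/
theorem weight_le_biUnion (hJ : ∀ j ∈ J, ‖proj (P j) x‖ = r * ‖proj (Q j) y‖)
    {C D : Finset (Fin M)} (hC : C ⊆ J.biUnion P) (hD : D ⊆ J.biUnion Q)
    (hR : ∀ e ∈ C, ∀ f ∈ D, X.Compat e f) :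
    ‖proj C x‖ ^ 2 + r ^ 2 * ‖proj D y‖ ^ 2 ≤ ‖proj (J.biUnion P) x‖ ^ 2 := by
  rw [norm_sq_proj_eq_sum_inter h.pairwise_left hC, norm_sq_proj_eq_sum_inter h.pairwise_right hD,
    norm_sq_proj_eq_sum_inter h.pairwise_left subset_rfl, Finset.mul_sum,
    ← Finset.sum_add_distrib]
  refine Finset.sum_le_sum fun j hj => ?_
  rw [Finset.inter_eq_right.2 (Finset.subset_biUnion_of_mem P hj)]
  have h1 := h.weight_le j (C ∩ P j) Finset.inter_subset_right (D ∩ Q j)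
    Finset.inter_subset_right fun e he f hf =>
      hR e (Finset.mem_inter.1 he).1 f (Finset.mem_inter.1 hf).1
  refine le_of_mul_le_mul_right ?_ (pow_pos (h.right_pos j) 2)
  rw [hJ j hj] at h1 ⊢
  linarith

end IsCalibrated

namespace IsSupport

variable {k : ℕ} {A B : Fin (k + 1) → Finset (Fin M)}

theorem mem_carrier_left_iff (hs : X.IsSupport x y A B) {i : Fin (k + 1)} (hi : i ≠ 0)
    {e : Fin M} (he : e ∈ A i) (j : Fin (k + 1)) : e ∈ carrierAxes A B j ↔ j < i := by
  rw [mem_carrierAxes]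
  constructor
  · rintro (⟨l, -, hl⟩ | ⟨l, hjl, hl⟩)
    · by_cases h0 : l = 0
      · subst h0
        rw [← hs.zero_eq] at hl
        exact absurd he (Finset.disjoint_left.1 (hs.disjoint_left 0 i hi.symm) hl)
      · exact absurd hl (Finset.disjoint_left.1 (hs.disjoint_left_right i l hi h0) he)
    · by_cases hli : l = i
      · exact hli ▸ hjl
      · exact absurd he (Finset.disjoint_left.1 (hs.disjoint_left l i hli) hl)
  · exact fun hj => Or.inr ⟨i, hj, he⟩

theorem mem_carrier_right_iff (hs : X.IsSupport x y A B) {i : Fin (k + 1)} (hi : i ≠ 0)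
    {e : Fin M} (he : e ∈ B i) (j : Fin (k + 1)) : e ∈ carrierAxes A B j ↔ i ≤ j := by
  rw [mem_carrierAxes]
  constructor
  · rintro (⟨l, hlj, hl⟩ | ⟨l, hjl, hl⟩)
    · by_cases hli : l = i
      · exact hli ▸ hlj
      · exact absurd he (Finset.disjoint_left.1 (hs.disjoint_right l i hli) hl)
    · have h0 : l ≠ 0 := fun h0 => by simp [h0] at hjl
      exact absurd he (Finset.disjoint_left.1 (hs.disjoint_left_right l i h0 hi) hl)
  · exact fun hj => Or.inl ⟨i, hj, he⟩

/-- By rigidity every coordinate of the given geodesic moves with its `calVec` speed while its axis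
is in the current orthant. An axis of A_i therefore reaches 0, and one of B_i leaves 0, exactly at
the break time of its calibrated block, so t_i must be that break time. -/
theorem exists_level_times (hs : X.IsSupport x y A B) {n : ℕ} {S : Finset (Fin M)}
    {P Q : Fin n → Finset (Fin M)} (h : X.IsCalibrated x y S P Q)
    (hS : ∀ e ∈ S, 0 < x e ∨ 0 < y e) :
    (∀ i, carrierAxes A B i ∈ X.faces) ∧ B 0 = S ∧
    ∃ t : Fin (k + 1) → ℝ, StrictMono t ∧ (∀ i, 0 ≤ t i ∧ t i < 1) ∧
      (∀ i, i ≠ 0 → A i =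
        (Finset.univ.filter fun j => breakTime x y (P j) (Q j) = t i).biUnion P) ∧
      (∀ i, i ≠ 0 → B i =
        (Finset.univ.filter fun j => breakTime x y (P j) (Q j) = t i).biUnion Q) ∧
      (∀ e, 0 < x e → ∃ i, e ∈ A i) ∧ (∀ e, 0 < y e → ∃ i, e ∈ B i) := by
  classical
  obtain ⟨γ, t, hγ, htm, ht0, ht1, hcar⟩ := hs.carrier
  have hnn : ∀ i, 0 ≤ t i := fun i => ht0 ▸ htm.monotone (Fin.zero_le i)
  have hle1 : ∀ i, t i ≤ 1 := fun i => ht1 ▸ htm.monotone (Fin.le_last i)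
  have hlt : ∀ i : Fin (k + 1), t i.castSucc < t i.succ := fun i => htm i.castSucc_lt_succ
  have hlt1 : ∀ i : Fin (k + 1), t i.castSucc < 1 := fun i => (hlt i).trans_le (hle1 _)
  have hpts : ∀ e, 0 ≤ x e ∧ 0 ≤ y e := fun e => ⟨h.nonneg_left e, h.nonneg_right e⟩
  obtain ⟨c, hc⟩ : ∃ c, c = calVec x y S P Q := ⟨_, rfl⟩
  have hface : ∀ i, carrierAxes A B i ∈ X.faces := by
    intro i
    obtain ⟨s, hs'⟩ := exists_between (hlt i)
    have h1 := (mem_points_iff.1 (hγ.mem s ⟨(hnn _).trans hs'.1.le, hs'.2.le.trans (hle1 _)⟩)).2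
    rwa [posAxes_eq_of_mem_openOrthant (hcar i s hs')] at h1
  have hzero : ∀ i, ∀ e ∉ carrierAxes A B i, ∀ s ∈ Set.Icc (t i.castSucc) (t i.succ),
      γ s e = 0 := by
    intro i e he
    have h1 : ContinuousOn (fun s => γ s e) (Set.Icc (t i.castSucc) (t i.succ)) :=
      (EuclideanSpace.proj (𝕜 := ℝ) e).continuous.comp_continuousOn
        (hγ.continuousOn.mono (Set.Icc_subset_Icc (hnn _) (hle1 _)))
    have h2 : Set.EqOn (fun s => γ s e) (fun _ => 0) (Set.Ioo (t i.castSucc) (t i.succ)) :=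
      fun s hs' => (hcar i s hs').2 e he
    exact h2.of_subset_closure h1 continuousOn_const Set.Ioo_subset_Icc_self
      (closure_Ioo (hlt i).ne).ge
  have hslope : ∀ i, ∀ e ∈ carrierAxes A B i, ∀ s s', t i.castSucc ≤ s → s ≤ s' →
      s' ≤ t i.succ → γ s' e - γ s e = (s' - s) * c e := by
    intro i e he s s' h1 h2 h3
    rw [hc]
    exact h.displacement_eq_of_face hγ ((hnn _).trans h1) h2 (h3.trans (hle1 _)) (hface i)
      (fun f hf => ⟨hzero i f hf s ⟨h1, h2.trans h3⟩, hzero i f hf s' ⟨h1.trans h2, h3⟩⟩) he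
  have hpos : ∀ i, ∀ e ∈ carrierAxes A B i, ∀ s ∈ Set.Ioo (t i.castSucc) (t i.succ),
      0 < γ s e := fun i e he s hs' => (hcar i s hs').1 e he
  have hfwd : ∀ e, ∀ i : Fin (k + 2), (∀ l : Fin (k + 1), l.castSucc < i →
      e ∈ carrierAxes A B l) → γ (t i) e = x e + t i * c e := by
    intro e i
    induction i using Fin.induction with
    | zero => simp [ht0, hγ.source]
    | succ i ih =>
      intro hl
      have h1 := ih fun l hli => hl l (hli.trans i.castSucc_lt_succ)
      have h2 := hslope i e (hl i i.castSucc_lt_succ) _ _ le_rfl (hlt i).le le_rfl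
      linarith
  have hbwd : ∀ e, ∀ i : Fin (k + 2), (∀ l : Fin (k + 1), i ≤ l.castSucc →
      e ∈ carrierAxes A B l) → y e - γ (t i) e = (1 - t i) * c e := by
    intro e i
    induction i using Fin.reverseInduction with
    | last => simp [ht1, hγ.target]
    | cast i ih =>
      intro hl
      have h1 := ih fun l hli => hl l (i.castSucc_lt_succ.le.trans hli)
      have h2 := hslope i e (hl i le_rfl) _ _ le_rfl (hlt i).le le_rfl
      linarith
  obtain ⟨s₀, hs₀⟩ := exists_between (hlt 0)
  rw [Fin.castSucc_zero, ht0] at hs₀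
  -- The starting point may lie on the boundary of the first orthant, so positivity is only
  -- available at an interior time s₀ of the first interval; s₁ plays this role at the end.
  have hstart : ∀ e ∈ carrierAxes A B 0, 0 < x e + s₀ * c e := by
    intro e he
    have h1 := hpos 0 e he s₀ (by rwa [Fin.castSucc_zero, ht0])
    have h2 := hslope 0 e he 0 s₀ (by rw [Fin.castSucc_zero, ht0]) hs₀.1.le hs₀.2.le
    rw [hγ.source] at h2
    linarith
  obtain ⟨s₁, hs₁⟩ := exists_between (hlt (Fin.last k))
  rw [Fin.succ_last, ht1] at hs₁
  have hend : ∀ e ∈ carrierAxes A B (Fin.last k), 0 < y e - (1 - s₁) * c e := by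
    intro e he
    have h1 := hpos (Fin.last k) e he s₁ (by rwa [Fin.succ_last, ht1])
    have h2 := hslope (Fin.last k) e he s₁ 1 hs₁.1.le hs₁.2.le (by rw [Fin.succ_last, ht1])
    rw [hγ.target] at h2
    linarith
  have hstartmem : ∀ e, 0 < x e → e ∈ carrierAxes A B 0 := by
    intro e he
    by_contra hne
    have h1 := hzero 0 e hne 0 (by
      rw [Fin.castSucc_zero, ht0]
      exact ⟨le_rfl, hnn _⟩)
    rw [hγ.source] at h1
    exact he.ne' h1
  have hendmem : ∀ e, 0 < y e → e ∈ carrierAxes A B (Fin.last k) := by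
    intro e he
    by_contra hne
    have h1 := hzero (Fin.last k) e hne 1 (by
      rw [Fin.succ_last, ht1]
      exact ⟨hle1 _, le_rfl⟩)
    rw [hγ.target] at h1
    exact he.ne' h1
  have hleft : ∀ i, i ≠ 0 → ∀ e ∈ A i, ∃ j, breakTime x y (P j) (Q j) = t i.castSucc ∧
      e ∈ P j := by
    intro i hi e he
    have hmem := hs.mem_carrier_left_iff hi he
    have hi0 := Fin.pos_iff_ne_zero.2 hi
    have h1 := hfwd e i.castSucc fun l hl => (hmem l).2 (Fin.castSucc_lt_castSucc_iff.1 hl)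
    rw [hzero i e (fun hcon => ((hmem i).1 hcon).false) _ ⟨le_rfl, (hlt i).le⟩] at h1
    have h2 := hstart e ((hmem 0).2 hi0)
    have h3 : s₀ < t i.castSucc :=
      hs₀.2.trans_le (htm.monotone (Fin.succ_le_castSucc_iff.2 hi0))
    -- The coordinate is affine, positive at s₀ and zero at the later time t_i.
    have h4 : c e < 0 := by
      by_contra hcon
      have := mul_le_mul_of_nonneg_right h3.le (not_lt.1 hcon)
      linarith
    have h5 : 0 < t i.castSucc := hs₀.1.trans h3
    have h6 : 0 < x e := by linarith [mul_pos_of_neg_of_neg h4 (neg_neg_iff_pos.2 h5)]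
    rcases IsCalibrated.block_cases (S := S) (A := P) (B := Q) e with he | ⟨j, he⟩ | ⟨j, he⟩ | ⟨h7, h8, h9⟩
    · rw [hc, h.calVec_of_mem he] at h1
      have h7 := mul_pos (sub_pos.2 (hlt1 i)) h6
      have h8 := mul_nonneg h5.le (hpts e).2
      linarith
    · refine ⟨j, ?_, he⟩
      rw [hc, h.calVec_of_mem_left he] at h1
      have h7 := h.left_pos j
      have h8 := h.right_pos j
      field_simp at h1
      unfold breakTime
      rw [div_eq_iff (by positivity)]
      refine mul_right_cancel₀ h6.ne' ?_
      linarith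
    · rw [h.left_eq_zero he] at h6
      exact absurd h6 (lt_irrefl _)
    · rw [hc, IsCalibrated.calVec_of_notMem h7 h8 h9] at h4
      exact absurd h4 (lt_irrefl _)
  have hright : ∀ i, i ≠ 0 → ∀ e ∈ B i, ∃ j, breakTime x y (P j) (Q j) = t i.castSucc ∧
      e ∈ Q j := by
    intro i hi e he
    have hmem := hs.mem_carrier_right_iff hi he
    have h1 := hbwd e i.castSucc fun l hl => (hmem l).2 (Fin.castSucc_le_castSucc_iff.1 hl)
    obtain ⟨i', rfl⟩ := Fin.exists_succ_eq.2 hi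
    have h0 : γ (t i'.succ.castSucc) e = 0 := by
      rw [← Fin.succ_castSucc]
      refine hzero i'.castSucc e (fun hcon => ?_) _ ⟨(hlt _).le, le_rfl⟩
      exact absurd ((hmem _).1 hcon) (not_le.2 i'.castSucc_lt_succ)
    rw [h0] at h1
    have h2 := hend e ((hmem _).2 (Fin.le_last _))
    have h3 : t i'.succ.castSucc < s₁ :=
      (htm.monotone (Fin.castSucc_le_castSucc_iff.2 (Fin.le_last _))).trans_lt hs₁.1
    have h4 : 0 < c e := by
      by_contra hcon
      have := mul_nonneg_of_nonpos_of_nonpos (not_lt.1 hcon) (sub_neg.2 h3).le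
      linarith
    have h5 : 0 < t i'.succ.castSucc := by
      rw [← ht0, ← Fin.castSucc_zero]
      exact htm (Fin.castSucc_lt_castSucc_iff.2 (Fin.succ_pos _))
    have h6 : 0 < y e := by linarith [mul_pos (sub_pos.2 (hlt1 i'.succ)) h4]
    rcases IsCalibrated.block_cases (S := S) (A := P) (B := Q) e with he | ⟨j, he⟩ | ⟨j, he⟩ | ⟨h7, h8, h9⟩
    · rw [hc, h.calVec_of_mem he] at h1
      have h7 := mul_pos h5 h6
      have h8 := mul_nonneg (sub_pos.2 (hlt1 i'.succ)).le (hpts e).1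
      linarith
    · rw [h.right_eq_zero he] at h6
      exact absurd h6 (lt_irrefl _)
    · refine ⟨j, ?_, he⟩
      rw [hc, h.calVec_of_mem_right he] at h1
      have h7 := h.left_pos j
      have h8 := h.right_pos j
      field_simp at h1
      unfold breakTime
      rw [div_eq_iff (by positivity)]
      refine mul_right_cancel₀ h6.ne' ?_
      linarith
    · rw [hc, IsCalibrated.calVec_of_notMem h7 h8 h9] at h4
      exact absurd h4 (lt_irrefl _)
  have hcommon : ∀ e ∈ B 0, e ∈ S := by
    intro e he
    have hmem : ∀ l, e ∈ carrierAxes A B l := fun l =>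
      mem_carrierAxes.2 (Or.inl ⟨0, Fin.zero_le _, he⟩)
    -- An axis present throughout moves affinely from x_e to y_e, so c_e = y_e - x_e; on a block
    -- `calVec` is strictly steeper than that.
    have h1 := hfwd e (Fin.last (k + 1)) fun l _ => hmem l
    rw [ht1, hγ.target, one_mul] at h1
    have h2 := hstart e (hmem 0)
    rcases IsCalibrated.block_cases (S := S) (A := P) (B := Q) e with he | ⟨j, he⟩ | ⟨j, he⟩ | ⟨h7, h8, h9⟩
    · exact he
    · rw [hc, h.calVec_of_mem_left he, h.right_eq_zero he] at h1
      have h3 := h.left_pos j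
      have h4 := mul_pos (div_pos (h.right_pos j) h3) (h.pos_left j e he)
      rw [add_div, div_self h3.ne'] at h1
      linarith
    · rw [hc, h.calVec_of_mem_right he, h.left_eq_zero he] at h1
      have h3 := h.right_pos j
      have h4 := mul_pos (div_pos (h.left_pos j) h3) (h.pos_right j e he)
      rw [add_div, div_self h3.ne'] at h1
      linarith
    · rw [hc, IsCalibrated.calVec_of_notMem h7 h8 h9, mul_zero, add_zero] at h2
      exact (h.cover_left e h2).elim id fun ⟨i, hi⟩ => absurd hi (h8 i)
  have hPA : ∀ j, ∀ e ∈ P j, ∃ i, i ≠ 0 ∧ e ∈ A i ∧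
      breakTime x y (P j) (Q j) = t i.castSucc := by
    intro j e he
    rcases mem_carrierAxes.1 (hstartmem e (h.pos_left j e he)) with ⟨l, hl, hl'⟩ | ⟨l, hl, hl'⟩
    · rw [Fin.le_zero_iff.1 hl] at hl'
      exact absurd he (Finset.disjoint_left.1 (h.disjoint_left j) (hcommon e hl'))
    · obtain ⟨j', hj', he'⟩ := hleft l hl.ne' e hl'
      have : j' = j := by
        by_contra hne
        exact Finset.disjoint_left.1 (h.pairwise_left j' j hne) he' he
      exact ⟨l, hl.ne', hl', this ▸ hj'⟩
  have hQB : ∀ j, ∀ e ∈ Q j, ∃ i, i ≠ 0 ∧ e ∈ B i ∧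
      breakTime x y (P j) (Q j) = t i.castSucc := by
    intro j e he
    rcases mem_carrierAxes.1 (hendmem e (h.pos_right j e he)) with ⟨l, hl, hl'⟩ | ⟨l, hl, hl'⟩
    · have hl0 : l ≠ 0 := by
        rintro rfl
        exact Finset.disjoint_left.1 (h.disjoint_right j) (hcommon e hl') he
      obtain ⟨j', hj', he'⟩ := hright l hl0 e hl'
      have : j' = j := by
        by_contra hne
        exact Finset.disjoint_left.1 (h.pairwise_right j' j hne) he' he
      exact ⟨l, hl0, hl', this ▸ hj'⟩
    · exact absurd hl (not_lt.2 (Fin.le_last l))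
  have hSB : ∀ e ∈ S, e ∈ B 0 := by
    intro e he
    have key : ∀ l, e ∈ carrierAxes A B l → e ∈ B 0 := by
      intro l hl
      rcases mem_carrierAxes.1 hl with ⟨i, -, hi⟩ | ⟨i, hi', hi⟩
      · by_cases h0 : i = 0
        · exact h0 ▸ hi
        · obtain ⟨j, -, hj⟩ := hright i h0 e hi
          exact absurd hj (Finset.disjoint_left.1 (h.disjoint_right j) he)
      · obtain ⟨j, -, hj⟩ := hleft i (fun h0 => by simp [h0] at hi') e hi
        exact absurd hj (Finset.disjoint_left.1 (h.disjoint_left j) he)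
    exact (hS e he).elim (fun h1 => key _ (hstartmem e h1)) fun h1 => key _ (hendmem e h1)
  have hinj : ∀ i j : Fin (k + 1), t i.castSucc = t j.castSucc → i = j := fun i j hij =>
    Fin.castSucc_injective _ (htm.injective hij)
  refine ⟨hface, Finset.Subset.antisymm hcommon hSB, fun i => t i.castSucc,
    fun i j hij => htm (Fin.castSucc_lt_castSucc_iff.2 hij), fun i => ⟨hnn _, hlt1 i⟩,
    fun i hi => ?_, fun i hi => ?_, fun e he => ?_, fun e he => ?_⟩
  · ext e
    simp only [Finset.mem_biUnion, Finset.mem_filter, Finset.mem_univ, true_and]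
    refine ⟨hleft i hi e, fun ⟨j, hj, he⟩ => ?_⟩
    obtain ⟨l, -, hl, hl'⟩ := hPA j e he
    rwa [← hinj l i (hl'.symm.trans hj)]
  · ext e
    simp only [Finset.mem_biUnion, Finset.mem_filter, Finset.mem_univ, true_and]
    refine ⟨hright i hi e, fun ⟨j, hj, he⟩ => ?_⟩
    obtain ⟨l, -, hl, hl'⟩ := hQB j e he
    rwa [← hinj l i (hl'.symm.trans hj)]
  · rcases h.cover_left e he with h1 | ⟨j, hj⟩
    · exact ⟨0, hs.zero_eq ▸ hSB e h1⟩
    · obtain ⟨l, -, hl, -⟩ := hPA j e hj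
      exact ⟨l, hl⟩
  · rcases h.cover_right e he with h1 | ⟨j, hj⟩
    · exact ⟨0, hSB e h1⟩
    · obtain ⟨l, -, hl, -⟩ := hQB j e hj
      exact ⟨l, hl⟩

/-- The support of a geodesic is a calibrated system with increasing ratios. -/
theorem isCalibrated (hs : X.IsSupport x y A B) (hx : x ∈ X.points) (hy : y ∈ X.points) :
    X.IsCalibrated x y (B 0) (fun i : Fin k => A i.succ) (fun i : Fin k => B i.succ) ∧
      (∀ i, carrierAxes A B i ∈ X.faces) ∧
      ∀ i j : Fin k, i < j → ‖proj (A i.succ) x‖ / ‖proj (B i.succ) y‖ <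
        ‖proj (A j.succ) x‖ / ‖proj (B j.succ) y‖ := by
  classical
  obtain ⟨n, S, P, Q, h, hS, -⟩ := exists_isCalibrated hx hy
  obtain ⟨hface, -, t, htm, ht01, hA, hB, hcx, hcy⟩ := hs.exists_level_times h hS
  -- The norm ratio belonging to the break time t_i.
  obtain ⟨r, hr⟩ : ∃ r : Fin (k + 1) → ℝ, r = fun i => t i / (1 - t i) := ⟨_, rfl⟩
  have hr0 : ∀ i, 0 ≤ r i := fun i => by
    rw [hr]
    exact div_nonneg (ht01 i).1 (sub_pos.2 (ht01 i).2).le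
  have hrm : StrictMono r := by
    intro i j hij
    have h1 := htm hij
    have h2 := (ht01 i).2
    have h3 := (ht01 j).2
    rw [hr]
    simp only
    rw [div_lt_div_iff₀ (by linarith) (by linarith)]
    linarith
  have hJ : ∀ i, ∀ j ∈ Finset.univ.filter (fun j => breakTime x y (P j) (Q j) = t i),
      ‖proj (P j) x‖ = r i * ‖proj (Q j) y‖ := by
    intro i j hj
    have h1 := (h.eq_breakTime_iff (ht01 i).2 j).1 (Finset.mem_filter.1 hj).2
    rw [div_eq_iff (h.right_pos j).ne'] at h1
    rw [h1, hr]
  have hpx : ∀ i, i ≠ 0 → ∀ e ∈ A i, 0 < x e := by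
    intro i hi e he
    rw [hA i hi, Finset.mem_biUnion] at he
    obtain ⟨j, -, hj⟩ := he
    exact h.pos_left j e hj
  have hpy : ∀ i, i ≠ 0 → ∀ e ∈ B i, 0 < y e := by
    intro i hi e he
    rw [hB i hi, Finset.mem_biUnion] at he
    obtain ⟨j, -, hj⟩ := he
    exact h.pos_right j e hj
  have hnorm : ∀ i, i ≠ 0 → ‖proj (A i) x‖ = r i * ‖proj (B i) y‖ := by
    intro i hi
    rw [hA i hi, hB i hi]
    exact norm_proj_biUnion h.pairwise_left h.pairwise_right (hr0 i) (hJ i)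
  have hbpos : ∀ i, i ≠ 0 → 0 < ‖proj (B i) y‖ := fun i hi =>
    norm_proj_pos (hs.nonempty_right i hi) (hpy i hi)
  have hratio : ∀ i, i ≠ 0 → ‖proj (A i) x‖ / ‖proj (B i) y‖ = r i := fun i hi => by
    rw [hnorm i hi, mul_div_cancel_right₀ _ (hbpos i hi).ne']
  have hfaceA : ∀ e, (e ∈ B 0 ∨ ∃ i : Fin k, e ∈ A i.succ) → e ∈ carrierAxes A B 0 := by
    rintro e (he | ⟨i, he⟩)
    · exact mem_carrierAxes.2 (Or.inl ⟨0, le_rfl, he⟩)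
    · exact mem_carrierAxes.2 (Or.inr ⟨_, Fin.succ_pos i, he⟩)
  have hfaceB : ∀ e, (e ∈ B 0 ∨ ∃ i : Fin k, e ∈ B i.succ) →
      e ∈ carrierAxes A B (Fin.last k) := by
    rintro e (he | ⟨i, he⟩)
    · exact mem_carrierAxes.2 (Or.inl ⟨0, Fin.zero_le _, he⟩)
    · exact mem_carrierAxes.2 (Or.inl ⟨_, Fin.le_last _, he⟩)
  have hsn : ∀ i : Fin k, i.succ ≠ 0 := Fin.succ_ne_zero
  refine ⟨⟨h.nonneg_left, h.nonneg_right, fun i => hs.nonempty_left _ (hsn i),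
    fun i => hs.nonempty_right _ (hsn i), fun i => hpx _ (hsn i), fun i => hpy _ (hsn i),
    fun e he => ?_, fun e he => ?_, fun i => ?_, fun i => hs.disjoint_right _ _ (hsn i).symm,
    fun i j hij => hs.disjoint_left _ _ fun h0 => hij (Fin.succ_injective _ h0),
    fun i j hij => hs.disjoint_right _ _ fun h0 => hij (Fin.succ_injective _ h0),
    fun i j => hs.disjoint_left_right _ _ (hsn i) (hsn j),
    fun e f he hf => mem_faces_iff.1 (hface 0) e (hfaceA e he) f (hfaceA f hf),
    fun e f he hf => mem_faces_iff.1 (hface _) e (hfaceB e he) f (hfaceB f hf),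
    fun i j hij e he f hf => ?_, fun i C hC D hD hR => ?_⟩, hface, fun i j hij => ?_⟩
  · obtain ⟨i, hi⟩ := hcx e he
    rw [← hs.zero_eq]
    exact (Fin.exists_fin_succ (P := fun i => e ∈ A i)).1 ⟨i, hi⟩
  · obtain ⟨i, hi⟩ := hcy e he
    exact (Fin.exists_fin_succ (P := fun i => e ∈ B i)).1 ⟨i, hi⟩
  · rw [← hs.zero_eq]
    exact hs.disjoint_left _ _ (hsn i).symm
  · rw [hratio _ (hsn i), hratio _ (hsn j), hrm.lt_iff_lt] at hij
    exact mem_faces_iff.1 (hface j.succ) e (mem_carrierAxes.2 (Or.inr ⟨_, hij, he⟩)) f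
      (mem_carrierAxes.2 (Or.inl ⟨_, le_rfl, hf⟩))
  · have h1 : ‖proj C x‖ ^ 2 + r i.succ ^ 2 * ‖proj D y‖ ^ 2 ≤ ‖proj (A i.succ) x‖ ^ 2 := by
      have h2 := h.weight_le_biUnion (hJ i.succ) (C := C) (D := D) (by rwa [← hA _ (hsn i)])
        (by rwa [← hB _ (hsn i)]) hR
      rwa [← hA _ (hsn i)] at h2
    have h3 := mul_le_mul_of_nonneg_right h1 (sq_nonneg ‖proj (B i.succ) y‖)
    have h4 : ‖proj D y‖ ^ 2 * ‖proj (A i.succ) x‖ ^ 2 =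
        ‖proj D y‖ ^ 2 * (r i.succ ^ 2 * ‖proj (B i.succ) y‖ ^ 2) := by
      rw [hnorm _ (hsn i), mul_pow]
    linarith
  · rw [hratio _ (hsn i), hratio _ (hsn j)]
    exact hrm (Fin.succ_lt_succ_iff.2 hij)

end IsSupport

end OrthantSpace

/-! ### Stability of resolved supports -/

theorem norm_sq_proj_mono {M : ℕ} {C D : Finset (Fin M)} (h : C ⊆ D)
    (x : EuclideanSpace ℝ (Fin M)) : ‖proj C x‖ ^ 2 ≤ ‖proj D x‖ ^ 2 := by
  rw [norm_sq_proj, norm_sq_proj]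
  exact Finset.sum_le_sum_of_subset_of_nonneg h fun _ _ _ => sq_nonneg _

theorem norm_sq_proj_empty {M : ℕ} (x : EuclideanSpace ℝ (Fin M)) : ‖proj ∅ x‖ ^ 2 = 0 := by
  rw [norm_sq_proj, Finset.sum_empty]

namespace OrthantSpace

variable {M m : ℕ} {X : OrthantSpace M m} {x y : EuclideanSpace ℝ (Fin M)}

/-- The properties of a resolved support that persist when the starting point moves in its
stratum. -/
structure IsStable {k : ℕ} (X : OrthantSpace M m) (x y : EuclideanSpace ℝ (Fin M))
    (S : Finset (Fin M)) (A B : Fin k → Finset (Fin M)) : Prop where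
  nonneg_right : ∀ e, 0 ≤ y e
  nonempty_left : ∀ i, (A i).Nonempty
  nonempty_right : ∀ i, (B i).Nonempty
  pos_left : ∀ i, ∀ e ∈ A i, 0 < x e
  pos_right : ∀ i, ∀ e ∈ B i, 0 < y e
  cover_left : ∀ e, 0 < x e → e ∈ S ∨ ∃ i, e ∈ A i
  cover_right : ∀ e, 0 < y e → e ∈ S ∨ ∃ i, e ∈ B i
  disjoint_left : ∀ i, Disjoint S (A i)
  disjoint_right : ∀ i, Disjoint S (B i)
  pairwise_left : ∀ i j, i ≠ j → Disjoint (A i) (A j)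
  pairwise_right : ∀ i j, i ≠ j → Disjoint (B i) (B j)
  disjoint_left_right : ∀ i j, Disjoint (A i) (B j)
  compat_left : ∀ e f, (e ∈ S ∨ ∃ i, e ∈ A i) → (f ∈ S ∨ ∃ i, f ∈ A i) → X.Compat e f
  compat_right : ∀ e f, (e ∈ S ∨ ∃ i, e ∈ B i) → (f ∈ S ∨ ∃ i, f ∈ B i) → X.Compat e f
  cross : ∀ i j, i ≠ j → (∀ e ∈ A i, ∀ f ∈ B j, X.Compat e f) ∨
    ‖proj (A i) x‖ / ‖proj (B i) y‖ < ‖proj (A j) x‖ / ‖proj (B j) y‖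
  weight_lt : ∀ i, ∀ C ⊆ A i, ∀ D ⊆ B i, (∀ e ∈ C, ∀ f ∈ D, X.Compat e f) →
    C.Nonempty → D.Nonempty →
    ‖proj C x‖ ^ 2 * ‖proj (B i) y‖ ^ 2 + ‖proj D y‖ ^ 2 * ‖proj (A i) x‖ ^ 2 <
      ‖proj (A i) x‖ ^ 2 * ‖proj (B i) y‖ ^ 2

/-- Finitely many strict inequalities between continuous functions of the starting point persist
nearby. When C or D is empty the weight bound may be an equality, but then it holds for every
starting point. -/
theorem IsStable.eventually_isCalibrated {k : ℕ} {S : Finset (Fin M)}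
    {A B : Fin k → Finset (Fin M)} (h : X.IsStable x y S A B) :
    ∀ᶠ x' in nhds x, (∀ e, 0 ≤ x' e) → posAxes x' = posAxes x → X.IsCalibrated x' y S A B := by
  have hcont : ∀ C : Finset (Fin M), Filter.Tendsto (fun x' => ‖proj C x'‖) (nhds x)
      (nhds ‖proj C x‖) := fun C => (continuous_proj C).norm.tendsto x
  have hcross : ∀ᶠ x' in nhds x, ∀ i j, i ≠ j → (∀ e ∈ A i, ∀ f ∈ B j, X.Compat e f) ∨
      ‖proj (A i) x'‖ / ‖proj (B i) y‖ < ‖proj (A j) x'‖ / ‖proj (B j) y‖ := by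
    refine Filter.eventually_all.2 fun i => Filter.eventually_all.2 fun j => ?_
    by_cases hij : i = j
    · exact Filter.Eventually.of_forall fun _ h0 => absurd hij h0
    rcases h.cross i j hij with h1 | h1
    · exact Filter.Eventually.of_forall fun _ _ => Or.inl h1
    · filter_upwards [((hcont (A i)).div_const _).eventually_lt ((hcont (A j)).div_const _) h1]
        with x' hx' _ using Or.inr hx'
  have hweight : ∀ᶠ x' in nhds x, ∀ i C D, C ⊆ A i → D ⊆ B i →
      (∀ e ∈ C, ∀ f ∈ D, X.Compat e f) →
      ‖proj C x'‖ ^ 2 * ‖proj (B i) y‖ ^ 2 + ‖proj D y‖ ^ 2 * ‖proj (A i) x'‖ ^ 2 ≤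
        ‖proj (A i) x'‖ ^ 2 * ‖proj (B i) y‖ ^ 2 := by
    refine Filter.eventually_all.2 fun i => Filter.eventually_all.2 fun C =>
      Filter.eventually_all.2 fun D => ?_
    by_cases hall : C ⊆ A i ∧ D ⊆ B i ∧ ∀ e ∈ C, ∀ f ∈ D, X.Compat e f
    · obtain ⟨hC, hD, hR⟩ := hall
      rcases C.eq_empty_or_nonempty with rfl | hCne
      · refine Filter.Eventually.of_forall fun x' _ _ _ => ?_
        rw [norm_sq_proj_empty, zero_mul, zero_add, mul_comm]
        exact mul_le_mul_of_nonneg_left (norm_sq_proj_mono hD y) (sq_nonneg _)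
      rcases D.eq_empty_or_nonempty with rfl | hDne
      · refine Filter.Eventually.of_forall fun x' _ _ _ => ?_
        rw [norm_sq_proj_empty, zero_mul, add_zero]
        exact mul_le_mul_of_nonneg_right (norm_sq_proj_mono hC x') (sq_nonneg _)
      · have h1 := h.weight_lt i C hC D hD hR hCne hDne
        filter_upwards [((((hcont C).pow 2).mul_const _).add
          (((hcont (A i)).pow 2).const_mul _)).eventually_lt
          (((hcont (A i)).pow 2).mul_const _) h1] with x' hx' _ _ _ using hx'.le
    · exact Filter.Eventually.of_forall fun _ h1 h2 h3 => absurd ⟨h1, h2, h3⟩ hall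
  filter_upwards [hcross, hweight] with x' h1 h2 h0 hp
  have hp' : ∀ e, 0 < x' e ↔ 0 < x e := fun e => by rw [← mem_posAxes, ← mem_posAxes, hp]
  refine ⟨h0, h.nonneg_right, h.nonempty_left, h.nonempty_right,
    fun i e he => (hp' e).2 (h.pos_left i e he), h.pos_right,
    fun e he => h.cover_left e ((hp' e).1 he), h.cover_right, h.disjoint_left, h.disjoint_right,
    h.pairwise_left, h.pairwise_right, h.disjoint_left_right, h.compat_left, h.compat_right,
    fun i j hij => ?_, fun i C hC D hD => h2 i C D hC hD⟩
  refine (h1 i j ?_).resolve_right hij.not_gt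
  rintro rfl
  exact hij.false

/-- The support supplies strict ratio inequalities between pieces of different blocks, the
complement of the change set supplies compatibility between pieces of the same block, and
tie-freeness supplies strictness of the weight bound. -/
theorem isStable_of_isTieRefinement {k k' : ℕ} {A B : Fin (k + 1) → Finset (Fin M)}
    {A' B' : Fin (k' + 1) → Finset (Fin M)} (hs : X.IsSupport x y A B)
    (href : X.IsTieRefinement x y A B A' B') (htf : X.TieFree x y A' B')
    (hx : x ∈ X.points) (hy : y ∈ X.points) (hD : y ∉ X.changeSet x) :
    X.IsStable x y (B' 0) (fun i : Fin k' => A' i.succ) (fun i : Fin k' => B' i.succ) := by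
  classical
  obtain ⟨hcal, hface, hmono⟩ := hs.isCalibrated hx hy
  obtain ⟨φ, hφm, hφ0, hφA, hφB, hφr⟩ := href.splitting
  have hsn : ∀ i : Fin k', i.succ ≠ 0 := Fin.succ_ne_zero
  have hφs : ∀ i : Fin k', φ i.succ ≠ 0 := fun i h0 => hsn i ((hφ0 _).1 h0)
  have hA0 : A 0 = A' 0 := by
    ext e
    rw [hφA]
    simp [hφ0]
  have hB0 : B 0 = B' 0 := by
    ext e
    rw [hφB]
    simp [hφ0]
  have hAB0 : A' 0 = B' 0 := by rw [← hA0, ← hB0, hs.zero_eq]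
  have hsubA : ∀ j, A' j ⊆ A (φ j) := fun j => by
    rw [hφA]
    exact Finset.subset_biUnion_of_mem A' (by simp)
  have hsubB : ∀ j, B' j ⊆ B (φ j) := fun j => by
    rw [hφB]
    exact Finset.subset_biUnion_of_mem B' (by simp)
  have hposA : ∀ i, i ≠ 0 → ∀ e ∈ A i, 0 < x e := by
    intro i hi
    obtain ⟨j, rfl⟩ := Fin.exists_succ_eq.2 hi
    exact hcal.pos_left j
  have hposB : ∀ i, i ≠ 0 → ∀ e ∈ B i, 0 < y e := by
    intro i hi
    obtain ⟨j, rfl⟩ := Fin.exists_succ_eq.2 hi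
    exact hcal.pos_right j
  have hposA' : ∀ j, j ≠ 0 → ∀ e ∈ A' j, 0 < x e := fun j hj e he =>
    hposA (φ j) (fun h0 => hj ((hφ0 j).1 h0)) e (hsubA j he)
  have hposB' : ∀ j, j ≠ 0 → ∀ e ∈ B' j, 0 < y e := fun j hj e he =>
    hposB (φ j) (fun h0 => hj ((hφ0 j).1 h0)) e (hsubB j he)
  have hbpos : ∀ j, j ≠ 0 → 0 < ‖proj (B' j) y‖ := fun j hj =>
    norm_proj_pos (href.nonempty_right j hj) (hposB' j hj)
  have hbpos' : ∀ i, i ≠ 0 → 0 < ‖proj (B i) y‖ := fun i hi =>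
    norm_proj_pos (hs.nonempty_right i hi) (hposB i hi)
  obtain ⟨r, hr⟩ : ∃ r : Fin (k + 1) → ℝ, r = fun i => ‖proj (A i) x‖ / ‖proj (B i) y‖ :=
    ⟨_, rfl⟩
  -- all pieces of a block have the ratio of the block
  have hpiece : ∀ j, j ≠ 0 → ‖proj (A' j) x‖ = r (φ j) * ‖proj (B' j) y‖ := by
    intro j hj
    have h1 : ‖proj (A (φ j)) x‖ =
        ‖proj (A' j) x‖ / ‖proj (B' j) y‖ * ‖proj (B (φ j)) y‖ := by
      rw [hφA (φ j), hφB (φ j)]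
      refine norm_proj_biUnion href.disjoint_left href.disjoint_right
        (div_nonneg (norm_nonneg _) (norm_nonneg _)) fun j' hj' => ?_
      have h2 := (Finset.mem_filter.1 hj').2
      have h3 : j' ≠ 0 := fun h0 => hj ((hφ0 j).1 (by rw [← h2, (hφ0 j').2 h0]))
      rw [hφr j j' hj h2.symm, div_mul_cancel₀ _ (hbpos j' h3).ne']
    rw [hr]
    simp only
    rw [h1, mul_div_cancel_right₀ _ (hbpos' (φ j) fun h0 => hj ((hφ0 j).1 h0)).ne',
      div_mul_cancel₀ _ (hbpos j hj).ne']
  have hBlock : ∀ i, i ≠ 0 → ‖proj (A i) x‖ = r i * ‖proj (B i) y‖ := fun i hi => by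
    rw [hr]
    exact (div_mul_cancel₀ _ (hbpos' i hi).ne').symm
  have cAA : ∀ i j, ∀ e ∈ A' i, ∀ f ∈ A' j, X.Compat e f := by
    have : ∀ i, ∀ e ∈ A' i, e ∈ carrierAxes A' B' 0 := by
      intro i e he
      rw [mem_carrierAxes]
      by_cases h0 : i = 0
      · exact Or.inl ⟨0, le_rfl, hAB0 ▸ h0 ▸ he⟩
      · exact Or.inr ⟨i, Fin.pos_iff_ne_zero.2 h0, he⟩
    exact fun i j e he f hf => mem_faces_iff.1 (href.mem_faces 0) e (this i e he) f (this j f hf)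
  have cBB : ∀ i j, ∀ e ∈ B' i, ∀ f ∈ B' j, X.Compat e f := fun i j e he f hf =>
    mem_faces_iff.1 (href.mem_faces (Fin.last k'))
      e (mem_carrierAxes.2 (Or.inl ⟨i, Fin.le_last _, he⟩))
      f (mem_carrierAxes.2 (Or.inl ⟨j, Fin.le_last _, hf⟩))
  have cAB : ∀ i j, i < j → ∀ e ∈ A' j, ∀ f ∈ B' i, X.Compat e f := fun i j hij e he f hf =>
    mem_faces_iff.1 (href.mem_faces i) e (mem_carrierAxes.2 (Or.inr ⟨j, hij, he⟩))
      f (mem_carrierAxes.2 (Or.inl ⟨i, le_rfl, hf⟩))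
  -- the pieces of a block strictly before, up to, and after a given one
  have hratio_union : ∀ (i : Fin (k + 1)) (p : Fin (k' + 1) → Prop) [DecidablePred p], i ≠ 0 →
      ‖proj ((Finset.univ.filter fun j => φ j = i ∧ p j).biUnion A') x‖ =
        r i * ‖proj ((Finset.univ.filter fun j => φ j = i ∧ p j).biUnion B') y‖ := by
    intro i p _ hi
    refine norm_proj_biUnion href.disjoint_left href.disjoint_right ?_ fun j hj => ?_
    · rw [hr]
      exact div_nonneg (norm_nonneg _) (norm_nonneg _)
    · have h1 := (Finset.mem_filter.1 hj).2.1
      rw [← h1]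
      exact hpiece j fun h0 => hi (by rw [← h1, (hφ0 j).2 h0])
  have hsplit : ∀ (P : Fin (k' + 1) → Finset (Fin M)) (i : Fin (k + 1))
      (p : Fin (k' + 1) → Prop) [DecidablePred p],
      (Finset.univ.filter fun j => φ j = i ∧ p j).biUnion P ∪
        (Finset.univ.filter fun j => φ j = i ∧ ¬ p j).biUnion P =
      (Finset.univ.filter fun j => φ j = i).biUnion P := by
    intro P i p _
    ext e
    simp only [Finset.mem_union, Finset.mem_biUnion, Finset.mem_filter, Finset.mem_univ, true_and]
    constructor
    · rintro (⟨j, h1, h2⟩ | ⟨j, h1, h2⟩)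
      · exact ⟨j, h1.1, h2⟩
      · exact ⟨j, h1.1, h2⟩
    · rintro ⟨j, h1, h2⟩
      by_cases h3 : p j
      · exact Or.inl ⟨j, ⟨h1, h3⟩, h2⟩
      · exact Or.inr ⟨j, ⟨h1, h3⟩, h2⟩
  have hdisj : ∀ (P : Fin (k' + 1) → Finset (Fin M)), (∀ i j, i ≠ j → Disjoint (P i) (P j)) →
      ∀ p q : Fin (k' + 1) → Prop, ∀ [DecidablePred p] [DecidablePred q], (∀ j, p j → ¬ q j) →
      Disjoint ((Finset.univ.filter p).biUnion P) ((Finset.univ.filter q).biUnion P) := by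
    intro P hP p q _ _ hpq
    refine (Finset.disjoint_biUnion_left _ _ _).2 fun a ha =>
      (Finset.disjoint_biUnion_right _ _ _).2 fun b hb => hP a b ?_
    rintro rfl
    exact hpq a (Finset.mem_filter.1 ha).2 (Finset.mem_filter.1 hb).2
  have crossSame : ∀ a b, φ a = φ b → a ≠ 0 → a < b → ∀ e ∈ A' a, ∀ f ∈ B' b, X.Compat e f := by
    intro a b hab ha0 hlt e he f hf
    have hi0 : φ a ≠ 0 := fun h0 => ha0 ((hφ0 a).1 h0)
    -- Cutting the block after the piece a is a tie of the support itself; its orthant is contained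
    -- in the orthant of the refined sequences at a.
    have htie : X.IsTie x y A B (φ a)
        ((Finset.univ.filter fun j => φ j = φ a ∧ j ≤ a).biUnion A')
        ((Finset.univ.filter fun j => φ j = φ a ∧ ¬ j ≤ a).biUnion A')
        ((Finset.univ.filter fun j => φ j = φ a ∧ j ≤ a).biUnion B')
        ((Finset.univ.filter fun j => φ j = φ a ∧ ¬ j ≤ a).biUnion B') := by
      have hb0 : b ≠ 0 := (Fin.zero_le a |>.trans_lt hlt).ne'
      have hma : a ∈ Finset.univ.filter fun j => φ j = φ a ∧ j ≤ a := by simp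
      have hmb : b ∈ Finset.univ.filter fun j => φ j = φ a ∧ ¬ j ≤ a := by
        simp [hab.symm, hlt]
      refine ⟨hi0, (href.nonempty_left a ha0).mono (Finset.subset_biUnion_of_mem A' hma),
        (href.nonempty_left b hb0).mono (Finset.subset_biUnion_of_mem A' hmb),
        (href.nonempty_right a ha0).mono (Finset.subset_biUnion_of_mem B' hma),
        (href.nonempty_right b hb0).mono (Finset.subset_biUnion_of_mem B' hmb),
        hdisj A' href.disjoint_left _ _ fun j h1 h2 => h2.2 h1.2,
        hdisj B' href.disjoint_right _ _ fun j h1 h2 => h2.2 h1.2,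
        (hsplit A' _ _).trans (hφA _).symm, (hsplit B' _ _).trans (hφB _).symm, ?_, ?_⟩
      · refine X.down_closed _ (href.mem_faces a) _ fun g hg => ?_
        simp only [mem_splitAxes, Finset.mem_biUnion, Finset.mem_filter, Finset.mem_univ,
          true_and, hφA, hφB] at hg
        rw [mem_carrierAxes]
        rcases hg with ⟨i, hi, j, hj, hg⟩ | ⟨j, hj, hg⟩ | ⟨j, hj, hg⟩ | ⟨i, hi, j, hj, hg⟩
        · refine Or.inl ⟨j, ?_, hg⟩
          by_contra hcon
          exact absurd (hφm (not_le.1 hcon).le) (not_le.2 (hj ▸ hi))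
        · exact Or.inl ⟨j, hj.2, hg⟩
        · exact Or.inr ⟨j, not_le.1 hj.2, hg⟩
        · refine Or.inr ⟨j, ?_, hg⟩
          by_contra hcon
          exact absurd (hφm (not_lt.1 hcon)) (not_le.2 (hj ▸ hi))
      · have h1 : ∀ j, j ≠ 0 → ∀ D : Finset (Fin M), B' j ⊆ D → D ⊆ B (φ a) → 0 < ‖proj D y‖ :=
          fun j hj D hjD hD => norm_proj_pos ((href.nonempty_right j hj).mono hjD)
            fun e he => hposB _ hi0 e (hD he)
        rw [hratio_union _ _ hi0, hratio_union _ _ hi0, mul_div_cancel_right₀,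
          mul_div_cancel_right₀]
        · refine (h1 b hb0 _ (Finset.subset_biUnion_of_mem B' hmb) ?_).ne'
          rw [hφB (φ a), ← hsplit B' (φ a) fun j => j ≤ a]
          exact Finset.subset_union_right
        · refine (h1 a ha0 _ (Finset.subset_biUnion_of_mem B' hma) ?_).ne'
          rw [hφB (φ a), ← hsplit B' (φ a) fun j => j ≤ a]
          exact Finset.subset_union_left
    have hopp : splitAxes A B (φ a) ((Finset.univ.filter fun j => φ j = φ a ∧ ¬ j ≤ a).biUnion B')
        ((Finset.univ.filter fun j => φ j = φ a ∧ j ≤ a).biUnion A') ∈ X.faces := by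
      -- This is where the change set enters: the opposite orthant contains the earlier piece of A
      -- together with the later piece of B.
      by_contra hcon
      exact hD ⟨hy, k, A, B, hs, φ a, _, _, _, _, htie, hcon⟩
    refine mem_faces_iff.1 hopp e (mem_splitAxes.2 (Or.inr (Or.inr (Or.inl ?_)))) f
      (mem_splitAxes.2 (Or.inr (Or.inl ?_)))
    · exact Finset.mem_biUnion.2 ⟨a, by simp, he⟩
    · exact Finset.mem_biUnion.2 ⟨b, by simp [hab.symm, hlt], hf⟩
  have hweight : ∀ a, a ≠ 0 → ∀ C ⊆ A' a, ∀ D ⊆ B' a, (∀ e ∈ C, ∀ f ∈ D, X.Compat e f) →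
      ‖proj C x‖ ^ 2 + r (φ a) ^ 2 * ‖proj D y‖ ^ 2 ≤ ‖proj (A' a) x‖ ^ 2 := by
    intro a ha0 C hC D hD hR
    have hi0 : φ a ≠ 0 := fun h0 => ha0 ((hφ0 a).1 h0)
    obtain ⟨i, hi⟩ := Fin.exists_succ_eq.2 hi0
    obtain ⟨CR, hCR⟩ : ∃ CR, CR = (Finset.univ.filter fun j => φ j = φ a ∧ ¬ j ≤ a).biUnion A' :=
      ⟨_, rfl⟩
    obtain ⟨DL, hDL⟩ : ∃ DL, DL = (Finset.univ.filter fun j => φ j = φ a ∧ j < a).biUnion B' :=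
      ⟨_, rfl⟩
    obtain ⟨CL, hCL⟩ : ∃ CL, CL = (Finset.univ.filter fun j => φ j = φ a ∧ j < a).biUnion A' :=
      ⟨_, rfl⟩
    have hsingle : ∀ P : Fin (k' + 1) → Finset (Fin M),
        (Finset.univ.filter fun j => φ j = φ a ∧ j ≤ a).biUnion P =
        (Finset.univ.filter fun j => φ j = φ a ∧ j < a).biUnion P ∪ P a := by
      intro P
      ext e
      simp only [Finset.mem_union, Finset.mem_biUnion, Finset.mem_filter, Finset.mem_univ,
        true_and]
      constructor
      · rintro ⟨j, h1, h2⟩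
        rcases h1.2.lt_or_eq with h3 | h3
        · exact Or.inl ⟨j, ⟨h1.1, h3⟩, h2⟩
        · exact Or.inr (h3 ▸ h2)
      · rintro (⟨j, h1, h2⟩ | h2)
        · exact ⟨j, ⟨h1.1, h1.2.le⟩, h2⟩
        · exact ⟨a, ⟨rfl, le_rfl⟩, h2⟩
    have hAunion : A (φ a) = CL ∪ A' a ∪ CR := by
      rw [hφA (φ a), ← hsplit A' (φ a) fun j => j ≤ a, hsingle, ← hCL, ← hCR]
    have hBsub : DL ∪ B' a ⊆ B (φ a) := by
      rw [hφB (φ a), ← hsplit B' (φ a) fun j => j ≤ a, hsingle, ← hDL]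
      exact Finset.subset_union_left
    have d1 : Disjoint CL (A' a) := by
      rw [hCL, Finset.disjoint_biUnion_left]
      exact fun j hj => href.disjoint_left j a (Finset.mem_filter.1 hj).2.2.ne
    have d2 : Disjoint (CL ∪ A' a) CR := by
      rw [hCL, ← hsingle, hCR]
      exact hdisj A' href.disjoint_left _ _ fun j h1 h2 => h2.2 h1.2
    have d3 : Disjoint DL (B' a) := by
      rw [hDL, Finset.disjoint_biUnion_left]
      exact fun j hj => href.disjoint_right j a (Finset.mem_filter.1 hj).2.2.ne
    -- The pair (C, D) inside a piece is enlarged by the later pieces of A and the earlier pieces of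
    -- B, which are compatible by the order of the refinement. Since ‖P_{CL} x‖² = r² ‖P_{DL} y‖²,
    -- the added weights cancel.
    have hw := hcal.weight_le i (C ∪ CR) (by
      rw [hi, hAunion]
      exact Finset.union_subset_union (hC.trans Finset.subset_union_right) subset_rfl) (DL ∪ D) (by
      rw [hi]
      exact (Finset.union_subset_union subset_rfl hD).trans hBsub) (fun e he f hf => by
      rcases Finset.mem_union.1 he with he | he <;> rcases Finset.mem_union.1 hf with hf | hf
      · rw [hDL, Finset.mem_biUnion] at hf
        obtain ⟨j, hj, hf⟩ := hf
        exact cAB j a (Finset.mem_filter.1 hj).2.2 e (hC he) f hf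
      · exact hR e he f hf
      · rw [hDL, Finset.mem_biUnion] at hf
        obtain ⟨j, hj, hf⟩ := hf
        rw [hCR, Finset.mem_biUnion] at he
        obtain ⟨j', hj', he⟩ := he
        exact cAB j j' ((Finset.mem_filter.1 hj).2.2.trans (not_le.1 (Finset.mem_filter.1 hj').2.2))
          e he f hf
      · rw [hCR, Finset.mem_biUnion] at he
        obtain ⟨j', hj', he⟩ := he
        exact cAB a j' (not_le.1 (Finset.mem_filter.1 hj').2.2) e he f (hD hf))
    rw [hi] at hw
    rw [norm_sq_proj_union (d2.mono_left (hC.trans Finset.subset_union_right)),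
      norm_sq_proj_union (d3.mono_right hD)] at hw
    have h1 : ‖proj (A (φ a)) x‖ ^ 2 =
        ‖proj CL x‖ ^ 2 + ‖proj (A' a) x‖ ^ 2 + ‖proj CR x‖ ^ 2 := by
      rw [hAunion, norm_sq_proj_union d2, norm_sq_proj_union d1]
    have h2 : ‖proj CL x‖ ^ 2 = r (φ a) ^ 2 * ‖proj DL y‖ ^ 2 := by
      rw [hCL, hDL, hratio_union _ _ hi0, mul_pow]
    have h3 : ‖proj (A (φ a)) x‖ ^ 2 = r (φ a) ^ 2 * ‖proj (B (φ a)) y‖ ^ 2 := by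
      rw [hBlock _ hi0, mul_pow]
    refine le_of_mul_le_mul_right ?_ (pow_pos (hbpos' _ hi0) 2)
    have h4 : (‖proj DL y‖ ^ 2 + ‖proj D y‖ ^ 2) * ‖proj (A (φ a)) x‖ ^ 2 =
        (r (φ a) ^ 2 * ‖proj DL y‖ ^ 2 + r (φ a) ^ 2 * ‖proj D y‖ ^ 2) *
          ‖proj (B (φ a)) y‖ ^ 2 := by
      rw [h3]
      ring
    rw [h4, ← h2, h1] at hw
    linarith
  have hstrict : ∀ a, a ≠ 0 → ∀ C ⊆ A' a, ∀ D ⊆ B' a, (∀ e ∈ C, ∀ f ∈ D, X.Compat e f) →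
      C.Nonempty → D.Nonempty →
      ‖proj C x‖ ^ 2 + r (φ a) ^ 2 * ‖proj D y‖ ^ 2 ≠ ‖proj (A' a) x‖ ^ 2 := by
    intro a ha0 C hC D hD hR hCne hDne heq
    have hCpos : 0 < ‖proj C x‖ := norm_proj_pos hCne fun e he => hposA' a ha0 e (hC he)
    have hDpos : 0 < ‖proj D y‖ := norm_proj_pos hDne fun e he => hposB' a ha0 e (hD he)
    have h1 := norm_sq_proj_union (Finset.sdiff_disjoint (s := C) (t := A' a)) x
    rw [Finset.sdiff_union_of_subset hC] at h1
    have h2 := norm_sq_proj_union (Finset.sdiff_disjoint (s := D) (t := B' a)) y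
    rw [Finset.sdiff_union_of_subset hD] at h2
    have h3 : ‖proj (A' a) x‖ ^ 2 = r (φ a) ^ 2 * ‖proj (B' a) y‖ ^ 2 := by
      rw [hpiece a ha0, mul_pow]
    have hr0 : 0 < r (φ a) := by
      have h4 : 0 < ‖proj (A' a) x‖ := norm_proj_pos (href.nonempty_left a ha0) (hposA' a ha0)
      rw [hpiece a ha0] at h4
      exact pos_of_mul_pos_left h4 (norm_nonneg _)
    have h4 : ‖proj (A' a \ C) x‖ = r (φ a) * ‖proj D y‖ := by
      refine (pow_left_inj₀ (norm_nonneg _) (mul_nonneg hr0.le (norm_nonneg _)) two_ne_zero).1 ?_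
      rw [mul_pow]
      linarith
    have h5 : ‖proj C x‖ = r (φ a) * ‖proj (B' a \ D) y‖ := by
      refine (pow_left_inj₀ (norm_nonneg _) (mul_nonneg hr0.le (norm_nonneg _)) two_ne_zero).1 ?_
      rw [mul_pow]
      rw [h2] at h3
      linarith
    have hne : ∀ (s : Finset (Fin M)) (z : EuclideanSpace ℝ (Fin M)), 0 < ‖proj s z‖ →
        s.Nonempty := by
      intro s z hz
      rw [Finset.nonempty_iff_ne_empty]
      rintro rfl
      have := norm_sq_proj_empty z
      exact (pow_pos hz 2).ne' this
    have hD2 : 0 < ‖proj (B' a \ D) y‖ := by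
      rw [h5] at hCpos
      exact pos_of_mul_pos_right hCpos hr0.le
    -- Equality of weights gives the complementary pieces the ratio r against D and C, so the two
    -- splittings form a tie of the refined sequences.
    refine htf a (A' a \ C) C D (B' a \ D) ⟨ha0, hne _ x (h4 ▸ mul_pos hr0 hDpos), hCne, hDne,
      hne _ y hD2, Finset.sdiff_disjoint, Finset.disjoint_sdiff,
      Finset.sdiff_union_of_subset hC, Finset.union_sdiff_of_subset hD, ?_, ?_⟩
    · have key : ∀ e, e ∈ splitAxes A' B' a D C → (∃ j, j < a ∧ e ∈ B' j) ∨ e ∈ D ∨ e ∈ C ∨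
          ∃ j, a < j ∧ e ∈ A' j := fun e he => mem_splitAxes.1 he
      refine mem_faces_iff.2 fun e he f hf => ?_
      rcases key e he with ⟨i, hi, he⟩ | he | he | ⟨i, hi, he⟩ <;>
        rcases key f hf with ⟨j, hj, hf⟩ | hf | hf | ⟨j, hj, hf⟩
      · exact cBB i j e he f hf
      · exact cBB i a e he f (hD hf)
      · exact (cAB i a hi f (hC hf) e he).symm
      · exact (cAB i j (hi.trans hj) f hf e he).symm
      · exact cBB a j e (hD he) f hf
      · exact cBB a a e (hD he) f (hD hf)
      · exact (hR f hf e he).symm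
      · exact (cAB a j hj f hf e (hD he)).symm
      · exact cAB j a hj e (hC he) f hf
      · exact hR e he f hf
      · exact cAA a a e (hC he) f (hC hf)
      · exact cAA a j e (hC he) f hf
      · exact cAB j i (hj.trans hi) e he f hf
      · exact cAB a i hi e he f (hD hf)
      · exact cAA i a e he f (hC hf)
      · exact cAA i j e he f hf
    · rw [h4, h5, mul_div_cancel_right₀ _ hDpos.ne', mul_div_cancel_right₀ _ hD2.ne']
  have hcoverA : ∀ i e, e ∈ A i → e ∈ B' 0 ∨ ∃ j : Fin k', e ∈ A' j.succ := by
    intro i e he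
    rw [hφA, Finset.mem_biUnion] at he
    obtain ⟨j, -, hj⟩ := he
    rw [← hAB0]
    exact (Fin.exists_fin_succ (P := fun j => e ∈ A' j)).1 ⟨j, hj⟩
  have hcoverB : ∀ i e, e ∈ B i → e ∈ B' 0 ∨ ∃ j : Fin k', e ∈ B' j.succ := by
    intro i e he
    rw [hφB, Finset.mem_biUnion] at he
    obtain ⟨j, -, hj⟩ := he
    exact (Fin.exists_fin_succ (P := fun j => e ∈ B' j)).1 ⟨j, hj⟩
  refine ⟨hcal.nonneg_right, fun i => href.nonempty_left _ (hsn i),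
    fun i => href.nonempty_right _ (hsn i), fun i => hposA' _ (hsn i), fun i => hposB' _ (hsn i),
    fun e he => ?_, fun e he => ?_, fun i => hAB0 ▸ href.disjoint_left _ _ (hsn i).symm,
    fun i => href.disjoint_right _ _ (hsn i).symm,
    fun i j hij => href.disjoint_left _ _ fun h0 => hij (Fin.succ_injective _ h0),
    fun i j hij => href.disjoint_right _ _ fun h0 => hij (Fin.succ_injective _ h0),
    fun i j => (hs.disjoint_left_right _ _ (hφs i) (hφs j)).mono (hsubA _) (hsubB _),
    fun e f he hf => ?_, fun e f he hf => ?_, fun i j hij => ?_, fun i C hC D hD hR hCne hDne => ?_⟩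
  · rcases hcal.cover_left e he with h1 | ⟨i, h1⟩
    · exact Or.inl (hB0 ▸ h1)
    · exact hcoverA _ e h1
  · rcases hcal.cover_right e he with h1 | ⟨i, h1⟩
    · exact Or.inl (hB0 ▸ h1)
    · exact hcoverB _ e h1
  · rw [← hAB0] at he hf
    obtain ⟨i, hi⟩ := (Fin.exists_fin_succ (P := fun j => e ∈ A' j)).2 he
    obtain ⟨j, hj⟩ := (Fin.exists_fin_succ (P := fun j => f ∈ A' j)).2 hf
    exact cAA i j e hi f hj
  · obtain ⟨i, hi⟩ := (Fin.exists_fin_succ (P := fun j => e ∈ B' j)).2 he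
    obtain ⟨j, hj⟩ := (Fin.exists_fin_succ (P := fun j => f ∈ B' j)).2 hf
    exact cBB i j e hi f hj
  -- Earlier block: strict ratio inequality. Same block: compatible in both orders. Later block:
  -- compatible by the order of the refinement.
  · rcases lt_trichotomy (φ i.succ) (φ j.succ) with h1 | h1 | h1
    · right
      rw [hpiece _ (hsn i), hpiece _ (hsn j), mul_div_cancel_right₀ _ (hbpos _ (hsn i)).ne',
        mul_div_cancel_right₀ _ (hbpos _ (hsn j)).ne', hr]
      obtain ⟨i', hi'⟩ := Fin.exists_succ_eq.2 (hφs i)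
      obtain ⟨j', hj'⟩ := Fin.exists_succ_eq.2 (hφs j)
      rw [← hi', ← hj'] at h1 ⊢
      exact hmono i' j' (Fin.succ_lt_succ_iff.1 h1)
    · left
      rcases lt_or_gt_of_ne hij with h2 | h2
      · exact crossSame _ _ h1 (hsn i) (Fin.succ_lt_succ_iff.2 h2)
      · exact cAB _ _ (Fin.succ_lt_succ_iff.2 h2)
    · left
      refine cAB _ _ ?_
      by_contra hcon
      exact absurd (hφm (not_lt.1 hcon)) (not_le.2 h1)
  · have h1 := (hweight _ (hsn i) C hC D hD hR).lt_of_ne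
      (hstrict _ (hsn i) C hC D hD hR hCne hDne)
    have h2 := mul_lt_mul_of_pos_right h1 (pow_pos (hbpos _ (hsn i)) 2)
    have h3 : ‖proj D y‖ ^ 2 * ‖proj (A' i.succ) x‖ ^ 2 =
        ‖proj D y‖ ^ 2 * (r (φ i.succ) ^ 2 * ‖proj (B' i.succ) y‖ ^ 2) := by
      rw [hpiece _ (hsn i), mul_pow]
    linarith

end OrthantSpace

/-! ### Derivative of the normalised projection, and the matrix -/

section Derivative

theorem norm_coords {M : ℕ} (E : Finset (Fin M)) (x : EuclideanSpace ℝ (Fin M)) :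
    ‖coords E x‖ = ‖proj E x‖ := by
  refine (pow_left_inj₀ (norm_nonneg _) (norm_nonneg _) two_ne_zero).1 ?_
  rw [norm_sq_proj, EuclideanSpace.norm_sq_eq]
  simp only [coords, Real.norm_eq_abs, sq_abs]
  exact Finset.sum_coe_sort E fun e => x e ^ 2

theorem coords_apply {M : ℕ} (E : Finset (Fin M)) (x : EuclideanSpace ℝ (Fin M)) (b : E) :
    coords E x b = x b := rfl

/-- The quotient rule with the norm written as the square root of the sum of squares over A; this is
one row of M†. -/
theorem hasFDerivAt_div_norm_proj {M : ℕ} {A : Finset (Fin M)} {z : EuclideanSpace ℝ (Fin M)}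
    (hz : ‖proj A z‖ ≠ 0) (e : Fin M) :
    HasFDerivAt (fun w : EuclideanSpace ℝ (Fin M) => w e / ‖proj A w‖)
      ((1 / ‖proj A z‖) • EuclideanSpace.proj (𝕜 := ℝ) e -
        (z e / ‖proj A z‖ ^ 3) • ∑ f ∈ A, z f • EuclideanSpace.proj (𝕜 := ℝ) f) z := by
  have hnorm : ∀ w : EuclideanSpace ℝ (Fin M), ‖proj A w‖ = √(∑ f ∈ A, w f ^ 2) := fun w => by
    rw [← norm_sq_proj, Real.sqrt_sq (norm_nonneg _)]
  have hp : ∀ f, HasFDerivAt (fun w : EuclideanSpace ℝ (Fin M) => w f)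
      (EuclideanSpace.proj (𝕜 := ℝ) f) z := fun f =>
    (EuclideanSpace.proj (𝕜 := ℝ) f : EuclideanSpace ℝ (Fin M) →L[ℝ] ℝ).hasFDerivAt
  have h1 := HasFDerivAt.fun_sum fun f (_ : f ∈ A) => (hp f).pow 2
  have h2 := h1.sqrt (by
    rw [← norm_sq_proj]
    exact pow_ne_zero 2 hz)
  rw [← hnorm] at h2
  have h3 := (hp e).mul ((hasDerivAt_inv (by rwa [← hnorm])).comp_hasFDerivAt z h2)
  have h4 : (fun w : EuclideanSpace ℝ (Fin M) => w e / ‖proj A w‖) =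
      fun w => w e * (√(∑ f ∈ A, w f ^ 2))⁻¹ := by
    funext w
    rw [hnorm, div_eq_mul_inv]
  rw [h4]
  refine h3.congr_fderiv ?_
  ext v
  simp only [Function.comp_apply, add_apply, sub_apply, smul_apply, sum_apply, PiLp.proj_apply,
    smul_eq_mul, nsmul_eq_mul, ← hnorm]
  have h5 : ∑ f ∈ A, 2 * z f ^ 1 * v f = 2 * ∑ f ∈ A, z f * v f := by
    rw [Finset.mul_sum]
    exact Finset.sum_congr rfl fun f _ => by ring
  push_cast
  rw [h5]
  field_simp
  ring

theorem sum_mDagger_coords_mul {M : ℕ} (G : Finset (Fin M)) (xs : EuclideanSpace ℝ (Fin M))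
    (v : Fin M → ℝ) (r : ℝ) (e : Fin M) :
    (∑ b : G, if (b : Fin M) = e then
      ∑ b' : G, (-r • mDagger (coords G xs)) b b' * v b' else 0) = if e ∈ G then
      -(r * (1 / ‖proj G xs‖ * v e - xs e / ‖proj G xs‖ ^ 3 * ∑ f ∈ G, xs f * v f)) else 0 := by
  by_cases he : e ∈ G
  · rw [if_pos he, Finset.sum_eq_single ⟨e, he⟩, if_pos rfl]
    · rw [← Finset.sum_coe_sort G]
      simp only [mDagger, norm_coords, coords_apply, Matrix.smul_apply, Matrix.sub_apply,
        Matrix.one_apply, Matrix.of_apply, smul_eq_mul, mul_ite, mul_one, mul_zero, mul_sub, sub_mul,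
        ite_mul, zero_mul, Finset.sum_sub_distrib, Finset.sum_ite_eq, Finset.mem_univ, if_true,
        Finset.mul_sum, neg_mul, neg_sub]
      rw [Finset.sum_neg_distrib, sub_neg_eq_add, add_comm, ← sub_eq_add_neg]
      congr 1
      · exact Finset.sum_congr rfl fun f _ => by ring
      · ring
    · exact fun b _ hb => if_neg fun h => hb (Subtype.ext h)
    · simp
  · rw [if_neg he]
    exact Finset.sum_eq_zero fun b _ => if_neg fun (h : (b : Fin M) = e) => he (h ▸ b.2)

/-- Only the blocks A_i with i ≥ 1 contribute. The matrix is symmetric, so its action on columns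
agrees with the row convention of the definition. -/
theorem derivMatrix_mulVec {M k : ℕ} (E : Finset (Fin M)) (A B : Fin (k + 1) → Finset (Fin M))
    (x xs : EuclideanSpace ℝ (Fin M)) (v : Fin M → ℝ) (e : Fin M) :
    (derivMatrix E A B x xs).mulVec v e = ∑ i : Fin k, if e ∈ A i.succ then
      -(‖proj (B i.succ) x‖ * (1 / ‖proj (A i.succ) xs‖ * v e -
        xs e / ‖proj (A i.succ) xs‖ ^ 3 * ∑ f ∈ A i.succ, xs f * v f)) else 0 := by
  have hJ : ∀ p, (placeMatrix (blockAxes E A B)).mulVec v p = v p.2 := fun p => by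
    simp [placeMatrix, Matrix.mulVec, dotProduct]
  have hT : ∀ u : (Σ i : Fin (k + 1), blockAxes E A B i) → ℝ,
      (placeMatrix (blockAxes E A B)).transpose.mulVec u e =
        ∑ i, ∑ b : blockAxes E A B i, if (b : Fin M) = e then u ⟨i, b⟩ else 0 := fun u => by
    simp [placeMatrix, Matrix.mulVec, dotProduct, Fintype.sum_sigma]
  have hD : ∀ (N : ∀ i, Matrix (blockAxes E A B i) (blockAxes E A B i) ℝ)
      (w : (Σ i : Fin (k + 1), blockAxes E A B i) → ℝ) (i : Fin (k + 1)) (a : blockAxes E A B i),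
      (Matrix.blockDiagonal' N).mulVec w ⟨i, a⟩ = ∑ b, N i a b * w ⟨i, b⟩ := fun N w i a => by
    simp only [Matrix.mulVec, dotProduct, Fintype.sum_sigma]
    rw [Finset.sum_eq_single i]
    · simp
    · intro j _ hj
      exact Finset.sum_eq_zero fun b _ => by rw [Matrix.blockDiagonal'_apply_ne _ _ _ hj.symm,
        zero_mul]
    · simp
  have hG : ∀ i : Fin k, blockAxes E A B i.succ = A i.succ := fun i =>
    if_neg (Fin.succ_ne_zero i)
  unfold derivMatrix
  rw [← Matrix.mulVec_mulVec, ← Matrix.mulVec_mulVec, hT]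
  simp only [hD, hJ]
  rw [Fin.sum_univ_succ]
  simp only [if_true, Matrix.zero_apply, zero_mul, Finset.sum_const_zero, ite_self, zero_add]
  refine Finset.sum_congr rfl fun i _ => ?_
  rw [if_neg (Fin.succ_ne_zero i), sum_mDagger_coords_mul, hG]

end Derivative

/-! ### Differentiability of the tangential projection -/

namespace OrthantSpace

variable {M m : ℕ} {X : OrthantSpace M m}

/-- Near `xs` in its stratum the same blocks calibrate every starting point, so each coordinate of
Φ_σ is locally given by one formula: normalised on some A_i, constant otherwise. -/
theorem IsStable.hasFDerivAt_tangentialLog {k : ℕ} {E : Finset (Fin M)} {xs : axisSpace E}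
    (hxs : (xs : EuclideanSpace ℝ (Fin M)) ∈ openOrthant E) {x : EuclideanSpace ℝ (Fin M)}
    {A B : Fin (k + 1) → Finset (Fin M)}
    (h : X.IsStable (xs : EuclideanSpace ℝ (Fin M)) x (B 0) (fun i : Fin k => A i.succ)
      (fun i : Fin k => B i.succ)) :
    HasFDerivAt
      (fun x' : axisSpace E => X.tangentialLog E x (x' : EuclideanSpace ℝ (Fin M)))
      ((Matrix.toEuclideanCLM (n := Fin M) (𝕜 := ℝ)
        (derivMatrix E A B x (xs : EuclideanSpace ℝ (Fin M)))).comp (axisSpace E).subtypeL)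
      xs := by
  have hE : ∀ x' : axisSpace E, (∀ e ∈ E, 0 < (x' : EuclideanSpace ℝ (Fin M)) e) →
      (x' : EuclideanSpace ℝ (Fin M)) ∈ openOrthant E := fun x' hx' => ⟨hx', x'.2⟩
  have hcoe : Filter.Tendsto (fun x' : axisSpace E => (x' : EuclideanSpace ℝ (Fin M))) (nhds xs)
      (nhds (xs : EuclideanSpace ℝ (Fin M))) := continuous_subtype_val.tendsto xs
  have hcal : ∀ᶠ x' : axisSpace E in nhds xs, (x' : EuclideanSpace ℝ (Fin M)) ∈ openOrthant E ∧
      X.IsCalibrated (x' : EuclideanSpace ℝ (Fin M)) x (B 0) (fun i : Fin k => A i.succ)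
        (fun i : Fin k => B i.succ) := by
    have h1 : ∀ᶠ x' : axisSpace E in nhds xs, ∀ e, e ∈ E →
        0 < (x' : EuclideanSpace ℝ (Fin M)) e := by
      refine Filter.eventually_all.2 fun e => ?_
      by_cases he : e ∈ E
      · have h2 : Filter.Tendsto (fun x' : axisSpace E => (x' : EuclideanSpace ℝ (Fin M)) e)
            (nhds xs) (nhds ((xs : EuclideanSpace ℝ (Fin M)) e)) :=
          ((EuclideanSpace.proj (𝕜 := ℝ) e).continuous.tendsto _).comp hcoe
        filter_upwards [h2.eventually (lt_mem_nhds (hxs.1 e he))] with x' hx' _ using hx'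
      · exact Filter.Eventually.of_forall fun _ h0 => absurd h0 he
    filter_upwards [h1, hcoe.eventually h.eventually_isCalibrated] with x' h2 h3
    have h4 := hE x' h2
    refine ⟨h4, h3 (fun e => ?_) ?_⟩
    · by_cases he : e ∈ E
      · exact (h2 e he).le
      · exact (h4.2 e he).ge
    · rw [posAxes_eq_of_mem_openOrthant h4, posAxes_eq_of_mem_openOrthant hxs]
  have hAE : ∀ i : Fin k, A i.succ ⊆ E := fun i e he => by
    by_contra hne
    exact (h.pos_left i e he).ne' (hxs.2 e hne)
  rw [← hasFDerivWithinAt_univ, hasFDerivWithinAt_euclidean]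
  intro e
  rw [hasFDerivWithinAt_univ]
  by_cases hA : ∃ i : Fin k, e ∈ A i.succ
  · obtain ⟨i, hi⟩ := hA
    have hpos := norm_proj_pos (h.nonempty_left i) (h.pos_left i)
    have h1 := (((hasFDerivAt_div_norm_proj hpos.ne' e).const_mul ‖proj (B i.succ) x‖).neg).comp xs
      (axisSpace E).subtypeL.hasFDerivAt
    refine (h1.congr_of_eventuallyEq ?_).congr_fderiv ?_
    · filter_upwards [hcal] with x' hx'
      simp only [tangentialLog, proj, if_pos (hAE i hi)]
      exact hx'.2.translatedLog_of_mem_left (i := i) hi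
    · ext v
      have h2 := derivMatrix_mulVec E A B x (xs : EuclideanSpace ℝ (Fin M))
        (v : EuclideanSpace ℝ (Fin M)) e
      rw [Finset.sum_eq_single i, if_pos hi] at h2
      · simpa [Finset.mul_sum] using h2.symm
      · intro j _ hji
        rw [if_neg (Finset.disjoint_right.1 (h.pairwise_left j i hji) hi)]
      · simp
  · have hconst : ∀ᶠ x' : axisSpace E in nhds xs,
        X.tangentialLog E x (x' : EuclideanSpace ℝ (Fin M)) e = if e ∈ E then x e else 0 := by
      filter_upwards [hcal] with x' hx'
      simp only [tangentialLog, proj]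
      by_cases he : e ∈ E
      · rw [if_pos he, if_pos he]
        exact hx'.2.translatedLog_of_mem
          ((hx'.2.cover_left e (hx'.1.1 e he)).resolve_right hA)
      · rw [if_neg he, if_neg he]
    refine ((hasFDerivAt_const _ xs).congr_of_eventuallyEq hconst).congr_fderiv ?_
    ext v
    have h2 := derivMatrix_mulVec E A B x (xs : EuclideanSpace ℝ (Fin M))
      (v : EuclideanSpace ℝ (Fin M)) e
    rw [Finset.sum_eq_zero fun i _ => if_neg fun hi => hA ⟨i, hi⟩] at h2
    simpa using h2.symm

/-- A support without ties is its own refinement. -/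
theorem IsSupport.isTieRefinement_self {k : ℕ} {x y : EuclideanSpace ℝ (Fin M)}
    {A B : Fin (k + 1) → Finset (Fin M)} (hs : X.IsSupport x y A B) (hx : x ∈ X.points)
    (hy : y ∈ X.points) : X.IsTieRefinement x y A B A B := by
  classical
  refine ⟨hs.nonempty_left, hs.nonempty_right, hs.disjoint_left, hs.disjoint_right,
    (hs.isCalibrated hx hy).2.1, id, monotone_id, fun _ => Iff.rfl, fun i => ?_, fun i => ?_,
    fun j j' _ hj => ?_⟩
  · ext e
    simp
  · ext e
    simp
  · rw [show j = j' from hj]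

end OrthantSpace

theorem mainTheorem4 {M m : ℕ} (X : OrthantSpace M m) (E : Finset (Fin M)) (hE : E ∈ X.faces)
    (xs : axisSpace E) (hxs : (xs : EuclideanSpace ℝ (Fin M)) ∈ openOrthant E)
    (x : EuclideanSpace ℝ (Fin M)) (hx : x ∈ X.points)
    (hxD : x ∉ X.changeSet (xs : EuclideanSpace ℝ (Fin M))) :
    (∃ (k : ℕ) (A B : Fin (k + 1) → Finset (Fin M)),
      X.IsResolvedSupport (xs : EuclideanSpace ℝ (Fin M)) x A B) ∧
    (∀ (k : ℕ) (A B : Fin (k + 1) → Finset (Fin M)),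
      X.IsResolvedSupport (xs : EuclideanSpace ℝ (Fin M)) x A B →
        (∀ i, i ≠ 0 → proj (A i) (xs : EuclideanSpace ℝ (Fin M)) ≠ 0) ∧
        HasFDerivAt
          (fun x' : axisSpace E => X.tangentialLog E x (x' : EuclideanSpace ℝ (Fin M)))
          ((Matrix.toEuclideanCLM (n := Fin M) (𝕜 := ℝ)
            (derivMatrix E A B x (xs : EuclideanSpace ℝ (Fin M)))).comp (axisSpace E).subtypeL)
          xs) ∧
    (∀ (k : ℕ) (A B : Fin (k + 1) → Finset (Fin M)),
      X.IsSupport (xs : EuclideanSpace ℝ (Fin M)) x A B →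
      X.TieFree (xs : EuclideanSpace ℝ (Fin M)) x A B →
        HasFDerivAt
          (fun x' : axisSpace E => X.tangentialLog E x (x' : EuclideanSpace ℝ (Fin M)))
          ((Matrix.toEuclideanCLM (n := Fin M) (𝕜 := ℝ)
            (derivMatrix E A B x (xs : EuclideanSpace ℝ (Fin M)))).comp (axisSpace E).subtypeL)
          xs) ∧
    (∀ (l : ℕ) (y : EuclideanSpace ℝ (Fin l)), y ≠ 0 →
      HasFDerivAt (fun z : EuclideanSpace ℝ (Fin l) => (1 / ‖z‖) • z)
        (Matrix.toEuclideanCLM (n := Fin l) (𝕜 := ℝ) (mDagger y)) y) := by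
  have hxsX : (xs : EuclideanSpace ℝ (Fin M)) ∈ X.points :=
    Set.mem_iUnion₂.2 ⟨E, hE, hxs⟩
  have key : ∀ (k : ℕ) (A B : Fin (k + 1) → Finset (Fin M)),
      X.IsResolvedSupport (xs : EuclideanSpace ℝ (Fin M)) x A B →
      X.IsStable (xs : EuclideanSpace ℝ (Fin M)) x (B 0) (fun i : Fin k => A i.succ)
        (fun i : Fin k => B i.succ) := by
    rintro k A B ⟨⟨k₀, A₀, B₀, hs, href⟩, htf⟩
    exact OrthantSpace.isStable_of_isTieRefinement hs href htf hxsX hx hxD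
  refine ⟨?_, fun k A B hAB => ⟨fun i hi => ?_, (key k A B hAB).hasFDerivAt_tangentialLog hxs⟩,
    fun k A B hs htf => ?_, fun l y hy => ?_⟩
  · obtain ⟨n, S, P, Q, h, hS, hmono, hrel, hstrict⟩ :=
      OrthantSpace.exists_isCalibrated hxsX hx
    obtain ⟨k, A, B, hs, href⟩ := h.exists_isSupport hS hmono hrel
    exact ⟨n, _, _, ⟨k, A, B, hs, href⟩, h.tieFree hstrict⟩
  · obtain ⟨j, rfl⟩ := Fin.exists_succ_eq.2 hi
    have hst := key k A B hAB
    exact norm_pos_iff.1 (norm_proj_pos (hst.nonempty_left j) (hst.pos_left j))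
  · exact (key k A B ⟨⟨k, A, B, hs, hs.isTieRefinement_self hxsX hx⟩,
      htf⟩).hasFDerivAt_tangentialLog hxs
  -- The derivative of y ↦ y/‖y‖ is the case of the full axis set.
  · have huniv : ∀ z : EuclideanSpace ℝ (Fin l), proj Finset.univ z = z := fun z => by
      ext i
      simp [proj]
    rw [← hasFDerivWithinAt_univ, hasFDerivWithinAt_euclidean]
    intro e
    rw [hasFDerivWithinAt_univ]
    have h1 := hasFDerivAt_div_norm_proj (A := Finset.univ) (z := y)
      (by rwa [huniv, norm_ne_zero_iff]) e
    simp only [huniv] at h1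
    have h2 : (fun z : EuclideanSpace ℝ (Fin l) => ((1 / ‖z‖) • z) e) = fun z => z e / ‖z‖ := by
      funext z
      simp only [PiLp.smul_apply, smul_eq_mul]
      ring
    rw [h2]
    refine h1.congr_fderiv ?_
    ext v
    simp [mDagger, Matrix.mulVec, dotProduct, Finset.mul_sum]
    exact Finset.sum_congr rfl fun i _ => by ring
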